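/- **Setting.** Let $G\subset\mathbb R^2$ be a bounded domain, $\mathcal K=\{g_1,\dots,g_N\}\subset\partial G$ a set of $N$ points, and $\partial G\setminus\mathcal K=\bigcup_{i=1}^N\Gamma_i$, where the $\Gamma_i$ are disjoint connected $C^\infty$-curves, open in $\partial G$, with $G$ locally on one side of them. Write $\mathcal O_r(M)$ for the open $r$-neighbourhood of $M$, $W^k=W^k_2$ for Sobolev spaces, and $\|\psi\|_{W^{k-1/2}(\Gamma)}=\inf\{\|v\|_{W^k(G)}: v|_\Gamma=\psi\}$ for traces on curves $\Gamma\subset\overline G$. Let $$\mathbf Pu=\sum_{i,k=1}^2p_{ik}(y)u_{y_iy_k}+\sum_{k=1}^2p_k(y)u_{y_k}+p_0(y)u$$ have complex $C^\infty$ coefficients and be properly elliptic on $\overline G$. Let $0<\varepsilon\le\varepsilon_1$ be such that the discs $\overline{\mathcal O_{\varepsilon_1}(g_j)}$ are disjoint and, for each $j$, there is a rigid motion $Y_j$ (the shift by $-g_j$ followed by a rotation) taking $G\cap\mathcal O_{\varepsilon_1}(g_j)$ to $K_j\cap\mathcal O_{\varepsilon_1}(0)$, where $K_j=\{r>0,\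 |\omega|<\omega_j\}$ in polar coordinates $(r,\omega)$ and $0<\omega_j<\pi$, and such that each side $\gamma_{j\sigma}=\{r>0,\ \omega=(-1)^\sigma\omega_j\}$ $(\sigma=1,2)$ is, within $\mathcal O_{\varepsilon_1}(0)$, the image of exactly one curve $\Gamma_i$, $i=i(j,\sigma)$. For $1\le s\le S_i$ let $\Omega_{is}$ be $C^\infty$-diffeomorphisms of a neighbourhood $\mathcal O_i$ of $\overline{\Gamma_i\cap\mathcal O_\varepsilon(\mathcal K)}$ onto $\Omega_{is}(\mathcal O_i)$ with $\Omega_{is}(\Gamma_i\cap\mathcal O_\varepsilon(\mathcal K))\subset G$ and $\Omega_{is}(\overline{\Gamma_i}\cap\mathcal K)\subset\mathcal K$. If $g_j\in\overline{\Gamma_i}$ and $\Omega_{is}(g_j)=g_k$, assume that $\mathcal O_\varepsilon(g_j)\subset\mathcal O_i$, that $\Omega_{is}(\mathcal O_\varepsilon(g_j))\subset\mathcal O_{\varepsilon_1}(g_k)$, and that $Y_k\circ\Omega_{is}\circ Y_j^{-1}$ is on $\mathcal O_\varepsilon(0)$ the composition of the rotation through an angle $\omega_{j\sigma is}$ and the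 homothety with coefficient $\chi_{j\sigma is}>0$, the angle being normalized by $|(-1)^\sigma\omega_j+\omega_{j\sigma is}|<\omega_k$. Assume that $\mathcal K$ is a single orbit under the maps $\Omega_{is}^{\pm1}$. Let $b_{is}\in C^\infty(\mathbb R^2)$, $\operatorname{supp}b_{is}\subset\mathcal O_\varepsilon(\mathcal K)$, and put $\mathbf B_i^1u=\sum_sb_{is}(y)\,u(\Omega_{is}(y))$ on $\Gamma_i\cap\mathcal O_\varepsilon(\mathcal K)$, $\mathbf B_i^1u=0$ on the rest of $\Gamma_i$. Let $\mathbf B_i^2$ be linear operators for which there are $\varkappa_1>\varkappa_2>0$, $\rho>0$, $c_1,c_2$ with $$\|\mathbf B_i^2u\|_{W^{3/2}(\Gamma_i)}\le c_1\|u\|_{W^2(G\setminus\overline{\mathcal O_{\varkappa_1}(\mathcal K)})},\qquad \|\mathbf B_i^2u\|_{W^{3/2}(\Gamma_i\setminus\overline{\mathcal O_{\varkappa_2}(\mathcal K)})}\le c_2\|u\|_{W^2(G_\rho)}$$ where $G_\rho=\{y\in G:\operatorname{dist}(y,\partial G)>\rho\}$; here $\mathbf B_i^2$ is defined on $W^2(G\setminus\overline{\mathcal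 O_{\varkappa_1}(\mathcal K)})$, the first estimate holds for all $u$ in this space, and the second for those $u$ in it that also belong to $W^2(G_\rho)$. A *generalized solution* of $$\mathbf Pu=f_0\ \text{ in }G,\qquad u|_{\Gamma_i}+\mathbf B_i^1u+\mathbf B_i^2u=f_i\ \text{ on }\Gamma_i\quad(i=1,\dots,N)\tag{1}$$ is a function $u\in W^1(G)\cap W^2(G\setminus\overline{\mathcal O_{\varkappa_1}(\mathcal K)})$ which satisfies the equation in the sense of distributions and the conditions on $\Gamma_i$ in the sense of traces. **Model operator.** Let $r^{-2}\tilde{\mathcal P}_j(\omega,\partial_\omega,r\partial_r)$ be the principal part of $\mathbf P$ at $g_j$ with coefficients frozen at $g_j$, written in the coordinates $Y_j$ and then in polar coordinates. For $\lambda\in\mathbb C$ and $\varphi=(\varphi_1,\dots,\varphi_N)\in\prod_jW^2(-\omega_j,\omega_j)$ let $\tilde{\mathcal L}(\lambda)\varphi$ have the components $\tilde{\mathcal P}_j(\omega,\partial_\omega,i\lambda)\varphi_j\in L_2(-\omega_j,\omega_j)$ and, for $\sigma=1,2$ and $i=i(j,\sigma)$, $$\varphi_j((-1)^\sigma\omega_j)+\sum_{s=1}^{S_i}\chi_{j\sigma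 is}^{\,i\lambda}\,b_{is}(g_j)\,\varphi_{k}\big((-1)^\sigma\omega_j+\omega_{j\sigma is}\big)\in\mathbb C,\qquad g_k=\Omega_{is}(g_j)$$ (in the exponent $i$ is the imaginary unit). A number $\lambda_0$ is an eigenvalue if $\tilde{\mathcal L}(\lambda_0)\varphi=0$ for some $\varphi\ne0$ (an eigenvector); a vector $\varphi^1$ is associated with $\varphi$ if $\tilde{\mathcal L}(\lambda_0)\varphi^1+\tilde{\mathcal L}'(\lambda_0)\varphi=0$. The eigenvalue is *proper* if no corresponding eigenvector has an associated vector and for every corresponding eigenvector $\varphi$ the functions $r^{i\lambda_0}\varphi_j(\omega)$ are polynomials in $y_1,y_2$; otherwise it is *improper*. **Theorem.** Suppose that the band $-1\le\operatorname{Im}\lambda<0$ contains an improper eigenvalue of $\tilde{\mathcal L}(\lambda)$. Then for any operators $\mathbf B_i^2$ as above there exist $f_0\in L_2(G)$ and a generalized solution $u\in W^1(G)$ of problem (1) with right-hand side $\{f_0,0\}$ (that is, $f_i=0$ for all $i$) such that $u\notin W^2(G)$. -/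

import Mathlib

noncomputable section

open MeasureTheory Filter Topology Set
open scoped ContDiff ENNReal NNReal

/-! The plane is `ℂ` with its Euclidean norm; `y₁ = re y`, `y₂ = im y`. -/

namespace NonlocalElliptic

/-! ### Sobolev spaces and traces in the plane -/

/-- The partial derivative `∂φ/∂y₁` (index `0`) or `∂φ/∂y₂` (index `1`). -/
def pd (i : Fin 2) (φ : ℂ → ℂ) : ℂ → ℂ :=
  fun y => fderiv ℝ φ y (if i = 0 then 1 else Complex.I)

/-- `D^α φ = ∂₁^{α₁} ∂₂^{α₂} φ`. -/
def mixedPd (α : ℕ × ℕ) (φ : ℂ → ℂ) : ℂ → ℂ :=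
  (pd 0)^[α.1] ((pd 1)^[α.2] φ)

/-- `φ ∈ C₀^∞(U)`. -/
structure IsTest (U : Set ℂ) (φ : ℂ → ℂ) : Prop where
  smooth : ContDiff ℝ ∞ φ
  compact : HasCompactSupport φ
  supp : tsupport φ ⊆ U

/-- `g ∈ L₂(U)` is the weak derivative `D^α u` in `U`. -/
def IsWeakDeriv (U : Set ℂ) (α : ℕ × ℕ) (u g : ℂ → ℂ) : Prop :=
  MemLp g 2 (volume.restrict U) ∧
    ∀ φ, IsTest U φ →
      ∫ y in U, u y * mixedPd α φ y = (-1) ^ (α.1 + α.2) * ∫ y in U, g y * φ y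

theorem pd_smooth (i : Fin 2) {φ : ℂ → ℂ} (h : ContDiff ℝ ∞ φ) : ContDiff ℝ ∞ (pd i φ) :=
  (h.fderiv_right (m := ∞) le_rfl).clm_apply contDiff_const

theorem pd_compact (i : Fin 2) {φ : ℂ → ℂ} (h : HasCompactSupport φ) :
    HasCompactSupport (pd i φ) :=
  h.fderiv_apply (𝕜 := ℝ) _

theorem mixedPd_nice (α : ℕ × ℕ) {φ : ℂ → ℂ} (h : ContDiff ℝ ∞ φ) (hc : HasCompactSupport φ) :
    ContDiff ℝ ∞ (mixedPd α φ) ∧ HasCompactSupport (mixedPd α φ) := by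
  have key : ∀ (i : Fin 2) (n : ℕ) (f : ℂ → ℂ), ContDiff ℝ ∞ f ∧ HasCompactSupport f →
      ContDiff ℝ ∞ ((pd i)^[n] f) ∧ HasCompactSupport ((pd i)^[n] f) := by
    intro i n
    induction n with
    | zero => intro f hf; exact hf
    | succ n ih => intro f hf; exact ih _ ⟨pd_smooth i hf.1, pd_compact i hf.2⟩
  exact key 0 _ _ (key 1 _ _ ⟨h, hc⟩)

theorem integrable_mul_nice {U : Set ℂ} {u φ : ℂ → ℂ} (hu : MemLp u 2 (volume.restrict U))
    (h : ContDiff ℝ ∞ φ) (hc : HasCompactSupport φ) :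
    Integrable (fun y => u y * φ y) (volume.restrict U) :=
  hu.integrable_mul ((h.continuous.memLp_of_hasCompactSupport (p := 2) hc).restrict U)

/-- The Sobolev space `W^k(U) = W^k_2(U)` of functions on `U` having all weak derivatives
of order at most `k` in `L₂(U)` (only the values in `U` matter). -/
def sobolev (k : ℕ) (U : Set ℂ) : Submodule ℂ (ℂ → ℂ) where
  carrier := {u | MemLp u 2 (volume.restrict U) ∧
    ∀ α : ℕ × ℕ, α.1 + α.2 ≤ k → ∃ g, IsWeakDeriv U α u g}
  zero_mem' := ⟨MemLp.zero, fun _ _ => ⟨0, MemLp.zero, fun φ _ => by simp⟩⟩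
  add_mem' := by
    rintro u v ⟨hu, hu'⟩ ⟨hv, hv'⟩
    refine ⟨hu.add hv, fun α hα => ?_⟩
    obtain ⟨a, ha, ha'⟩ := hu' α hα
    obtain ⟨b, hb, hb'⟩ := hv' α hα
    refine ⟨a + b, ha.add hb, fun φ hφ => ?_⟩
    have hn := mixedPd_nice α hφ.smooth hφ.compact
    simp only [Pi.add_apply, add_mul]
    rw [integral_add (integrable_mul_nice hu hn.1 hn.2) (integrable_mul_nice hv hn.1 hn.2),
      integral_add (integrable_mul_nice ha hφ.smooth hφ.compact)
        (integrable_mul_nice hb hφ.smooth hφ.compact), ha' φ hφ, hb' φ hφ, mul_add]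
  smul_mem' := by
    rintro c u ⟨hu, hu'⟩
    refine ⟨hu.const_smul c, fun α hα => ?_⟩
    obtain ⟨a, ha, ha'⟩ := hu' α hα
    refine ⟨c • a, ha.const_smul c, fun φ hφ => ?_⟩
    simp only [Pi.smul_apply, smul_eq_mul, mul_assoc]
    rw [integral_const_mul, integral_const_mul, ha' φ hφ]
    ring

open scoped Classical in
/-- The weak derivative `D^α u` in `U` (unique almost everywhere in an open set `U`;
zero if there is none in `L₂(U)`). -/
def weakDeriv (U : Set ℂ) (α : ℕ × ℕ) (u : ℂ → ℂ) : ℂ → ℂ :=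
  if h : ∃ g, IsWeakDeriv U α u g then h.choose else 0

/-- `‖u‖_{W^k(U)} = (∑_{|α| ≤ k} ∫_U |D^α u|²)^{1/2}`, used for `u ∈ W^k(U)` only. -/
def sobolevNorm (k : ℕ) (U : Set ℂ) (u : ℂ → ℂ) : ℝ≥0∞ :=
  (∑ α ∈ (Finset.range (k + 1)).biUnion Finset.HasAntidiagonal.antidiagonal,
    ∫⁻ y in U, ‖weakDeriv U α u y‖ₑ ^ 2) ^ (1 / 2 : ℝ)

/-- Arc length on a curve `Γ` in the plane. -/
def arcLength (Γ : Set ℂ) : Measure ℂ := (μH[1] : Measure ℂ).restrict Γ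

/-- `u|_Γ = ψ` in the sense of traces, for `u ∈ W¹(G)` and a curve `Γ` in the closure of `G`:
the trace operator is the continuous extension of the restriction to `Γ` from the functions
in `W¹(G)` that are continuous on the closure of `G`. -/
def IsTrace (G Γ : Set ℂ) (u ψ : ℂ → ℂ) : Prop :=
  MemLp ψ 2 (arcLength Γ) ∧
    ∃ v : ℕ → ℂ → ℂ,
      (∀ n, v n ∈ sobolev 1 G ∧ ContinuousOn (v n) (closure G)) ∧
      Tendsto (fun n => sobolevNorm 1 G (v n - u)) atTop (𝓝 0) ∧
      Tendsto (fun n => eLpNorm (v n - ψ) 2 (arcLength Γ)) atTop (𝓝 0)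

/-- `‖ψ‖_{W^{k-1/2}(Γ)} = inf {‖u‖_{W^k(G)} : u ∈ W^k(G), u|_Γ = ψ}` for `k ≥ 1`; it is `∞`
exactly when `ψ` is not the trace of a function in `W^k(G)`. -/
def traceNorm (k : ℕ) (G Γ : Set ℂ) (ψ : ℂ → ℂ) : ℝ≥0∞ :=
  ⨅ u ∈ {u : ℂ → ℂ | u ∈ sobolev k G ∧ IsTrace G Γ u ψ}, sobolevNorm k G u

/-! ### The nonlocal problem -/

/-- `(-1)^σ` for `σ = 1, 2`, the two values being numbered `0, 1` here. -/
def sgn (σ : Fin 2) : ℝ := if σ = 0 then -1 else 1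

/-- The open angle `{r > 0, |ω| < a}`. -/
def sector (a : ℝ) : Set ℂ := {z | z ≠ 0 ∧ |z.arg| < a}

/-- The open ray `{r > 0, ω = t}`. -/
def ray (t : ℝ) : Set ℂ := {z | ∃ r : ℝ, 0 < r ∧ z = r * Complex.exp (t * Complex.I)}

/-- The form `∑ a_{ik} ξ_i η_k`. -/
def form (a : Fin 2 → Fin 2 → ℂ) (ξ η : Fin 2 → ℂ) : ℂ := ∑ i, ∑ k, a i k * ξ i * η k

/-- Proper ellipticity of a second-order operator with leading coefficients `a`: the
characteristic form has no nonzero real zeros, and for linearly independent real `ξ, η` the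
quadratic polynomial `τ ↦ form a (ξ + τη) (ξ + τη)` has exactly one root in the open upper
half-plane, counted with multiplicity (hence one in the open lower half-plane). -/
def ProperlyElliptic (a : Fin 2 → Fin 2 → ℂ) : Prop :=
  (∀ ξ : Fin 2 → ℝ, ξ ≠ 0 → form a (fun i => ξ i) (fun i => ξ i) ≠ 0) ∧
  ∀ ξ η : Fin 2 → ℝ, LinearIndependent ℝ ![ξ, η] →
    ∃ τ₁ τ₂ : ℂ, 0 < τ₁.im ∧ τ₂.im < 0 ∧
      ∀ τ : ℂ, form a (fun i => ξ i + τ * η i) (fun i => ξ i + τ * η i)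
        = form a (fun i => η i) (fun i => η i) * ((τ - τ₁) * (τ - τ₂))

/-- The differential operator
`P u = ∑ p_{ik} u_{y_i y_k} + ∑ p_k u_{y_k} + p₀ u`, the domain `G`, the conjugation points
`g_j` (forming the set `𝒦`), the boundary curves `Γ_i`, and the nonlocal terms supported near
`𝒦`, that is, the transformations `Ω_{is}` and the coefficients `b_{is}`. -/
structure Problem (N : ℕ) where
  /-- the domain -/
  G : Set ℂ
  isOpen_G : IsOpen G
  isConnected_G : IsConnected G
  isBounded_G : Bornology.IsBounded G
  /-- the conjugation points -/
  g : Fin N → ℂ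
  g_injective : Function.Injective g
  g_mem : ∀ j, g j ∈ frontier G
  /-- the curves forming the rest of the boundary -/
  Γ : Fin N → Set ℂ
  Γ_connected : ∀ i, IsConnected (Γ i)
  Γ_disjoint : Pairwise fun i i' => Disjoint (Γ i) (Γ i')
  iUnion_Γ : ⋃ i, Γ i = frontier G \ range g
  Γ_relOpen : ∀ i, ∃ V : Set ℂ, IsOpen V ∧ Γ i = V ∩ frontier G
  /-- each `Γ_i` is a `C^∞`-curve, with `G` locally on one side of it -/
  Γ_smooth : ∀ i, ∀ y ∈ Γ i, ∃ V : Set ℂ, IsOpen V ∧ y ∈ V ∧ ∃ h : ℂ → ℝ,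
    ContDiffOn ℝ ∞ h V ∧ (∀ z ∈ V, fderiv ℝ h z ≠ 0) ∧ G ∩ V = {z ∈ V | h z < 0}
  /-- the leading coefficients of `P` -/
  p₂ : Fin 2 → Fin 2 → ℂ → ℂ
  /-- the first-order coefficients of `P` -/
  p₁ : Fin 2 → ℂ → ℂ
  /-- the zero-order coefficient of `P` -/
  p₀ : ℂ → ℂ
  p₂_smooth : ∀ i k, ContDiff ℝ ∞ (p₂ i k)
  p₁_smooth : ∀ k, ContDiff ℝ ∞ (p₁ k)
  p₀_smooth : ContDiff ℝ ∞ p₀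
  elliptic : ∀ y ∈ closure G, ProperlyElliptic fun i k => p₂ i k y
  ε : ℝ
  ε₁ : ℝ
  ε_pos : 0 < ε
  ε_le : ε ≤ ε₁
  balls_disjoint : ∀ j k, j ≠ k →
    Disjoint (Metric.closedBall (g j) ε₁) (Metric.closedBall (g k) ε₁)
  /-- the half-opening of the angle at `g_j` -/
  halfAngle : Fin N → ℝ
  halfAngle_pos : ∀ j, 0 < halfAngle j
  halfAngle_lt : ∀ j, halfAngle j < Real.pi
  /-- the direction of the bisector of the angle at `g_j`: the inverse of the change of
  variables `Y_j` is `z ↦ g_j + e^{iθ_j} z` -/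
  θ : Fin N → ℝ
  G_angle : ∀ j, ∀ z ∈ Metric.ball (0 : ℂ) ε₁,
    g j + Complex.exp (θ j * Complex.I) * z ∈ G ↔ z ∈ sector (halfAngle j)
  /-- the index `i` of the curve `Γ_i` that `Y_j` takes to the side `γ_{jσ}` near `g_j` -/
  side : Fin N → Fin 2 → Fin N
  Γ_side : ∀ j σ, ∀ z ∈ Metric.ball (0 : ℂ) ε₁,
    g j + Complex.exp (θ j * Complex.I) * z ∈ Γ (side j σ) ↔ z ∈ ray (sgn σ * halfAngle j)
  /-- the number `S_i` of transformations `Ω_{is}` -/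
  S : Fin N → ℕ
  /-- the neighbourhood of the closure of `Γ_i ∩ O_ε(𝒦)` on which `Ω_{is}` is defined -/
  O : Fin N → Set ℂ
  Ω : ∀ i, Fin (S i) → OpenPartialHomeomorph ℂ ℂ
  Ω_source : ∀ i s, (Ω i s).source = O i
  subset_O : ∀ i, closure (Γ i ∩ Metric.thickening ε (range g)) ⊆ O i
  Ω_smooth : ∀ i s, ContDiffOn ℝ ∞ (Ω i s) (Ω i s).source
  Ω_symm_smooth : ∀ i s, ContDiffOn ℝ ∞ (Ω i s).symm (Ω i s).target
  Ω_inside : ∀ i s, Ω i s '' (Γ i ∩ Metric.thickening ε (range g)) ⊆ G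
  /-- `Ω_{is}(g_j) = g_k` with `k = tgt j σ s`, for the curve `Γ_i` forming the side `σ`
  at `g_j` -/
  tgt : ∀ j σ, Fin (S (side j σ)) → Fin N
  Ω_g : ∀ j σ s, Ω (side j σ) s (g j) = g (tgt j σ s)
  ball_subset_O : ∀ j σ, Fin (S (side j σ)) → Metric.ball (g j) ε ⊆ O (side j σ)
  Ω_ball : ∀ j σ s,
    Ω (side j σ) s '' Metric.ball (g j) ε ⊆ Metric.ball (g (tgt j σ s)) ε₁
  /-- in the variables `Y_j`, `Y_k` the transformation `Ω_{is}` is, near `g_j`, multiplication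
  by the nonzero number `rot j σ s`: a rotation composed with a homothety -/
  rot : ∀ j σ, Fin (S (side j σ)) → ℂ
  rot_ne : ∀ j σ s, rot j σ s ≠ 0
  Ω_rot : ∀ j σ s, ∀ z ∈ Metric.ball (0 : ℂ) ε,
    Ω (side j σ) s (g j + Complex.exp (θ j * Complex.I) * z)
      = g (tgt j σ s) + Complex.exp (θ (tgt j σ s) * Complex.I) * (rot j σ s * z)
  /-- the conjugation points form one orbit of the transformations `Ω_{is}^{±1}` -/
  one_orbit : ∀ j k, Relation.EqvGen (fun j k => ∃ σ s, tgt j σ s = k) j k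
  b : ∀ i, Fin (S i) → ℂ → ℂ
  b_smooth : ∀ i s, ContDiff ℝ ∞ (b i s)
  b_supp : ∀ i s, tsupport (b i s) ⊆ Metric.thickening ε (range g)

namespace Problem

variable {N : ℕ} (D : Problem N)

/-- `O_r(𝒦)`, the open `r`-neighbourhood of the set of conjugation points. -/
def nhdK (r : ℝ) : Set ℂ := Metric.thickening r (range D.g)

/-- `G_ρ = {y ∈ G : dist(y, ∂G) > ρ}`. -/
def core (ρ : ℝ) : Set ℂ := {y ∈ D.G | ρ < Metric.infDist y (frontier D.G)}

/-- Operators `B_i²` corresponding to nonlocal terms supported outside `𝒦`. They are linear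
operators on `W²(G ∖ closure O_{κ₁}(𝒦))`; the values are functions on `Γ_i`, up to equality
almost everywhere. -/
structure FarOperators where
  κ₁ : ℝ
  κ₂ : ℝ
  ρ : ℝ
  κ₂_pos : 0 < κ₂
  κ₂_lt : κ₂ < κ₁
  ρ_pos : 0 < ρ
  op : Fin N → sobolev 2 (D.G \ closure (D.nhdK κ₁)) →ₗ[ℂ] (ℂ → ℂ)
  c₁ : ℝ≥0
  bound₁ : ∀ (i : Fin N) (u : sobolev 2 (D.G \ closure (D.nhdK κ₁))), traceNorm 2 D.G (D.Γ i) (op i u)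
    ≤ c₁ * sobolevNorm 2 (D.G \ closure (D.nhdK κ₁)) u
  c₂ : ℝ≥0
  bound₂ : ∀ (i : Fin N) (u : sobolev 2 (D.G \ closure (D.nhdK κ₁))), (u : ℂ → ℂ) ∈ sobolev 2 (D.core ρ) →
    traceNorm 2 D.G (D.Γ i \ closure (D.nhdK κ₂)) (op i u)
      ≤ c₂ * sobolevNorm 2 (D.core ρ) u

/-- `P u = f₀` in `G` in the sense of distributions, for `u ∈ W¹(G)`. -/
def SolvesEquation (f₀ u : ℂ → ℂ) : Prop :=
  ∀ w, IsTest D.G w →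
    -(∫ y in D.G, ∑ i, ∑ k,
        weakDeriv D.G (if i = 0 then (1, 0) else (0, 1)) u y
          * pd k (fun z => D.p₂ i k z * w z) y)
      + (∫ y in D.G,
          ((∑ k, D.p₁ k y * weakDeriv D.G (if k = 0 then (1, 0) else (0, 1)) u y)
            + D.p₀ y * u y) * w y)
      = ∫ y in D.G, f₀ y * w y

/-- `u ∈ W¹(G)` is a generalized solution of
`P u = f₀` in `G`, `u|_{Γ_i} + B_i¹ u + B_i² u = f_i` on `Γ_i`, where
`B_i¹ u = ∑_s b_{is} u(Ω_{is}(y))` on `Γ_i ∩ O_ε(𝒦)` and `B_i¹ u = 0` on the rest of `Γ_i`;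
`ψ` is the trace of `u` on `Γ_i`, and `τ s` its trace on `Ω_{is}(Γ_i ∩ O_ε(𝒦))`. -/
structure IsGeneralizedSolution (B : D.FarOperators) (f₀ : ℂ → ℂ) (f : Fin N → ℂ → ℂ)
    (u : ℂ → ℂ) : Prop where
  mem : u ∈ sobolev 1 D.G
  equation : D.SolvesEquation f₀ u
  conditions : ∃ hu : u ∈ sobolev 2 (D.G \ closure (D.nhdK B.κ₁)),
    ∀ i, ∃ (ψ : ℂ → ℂ) (τ : Fin (D.S i) → ℂ → ℂ),
      IsTrace D.G (D.Γ i) u ψ ∧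
      (∀ s, IsTrace D.G (D.Ω i s '' (D.Γ i ∩ D.nhdK D.ε)) u (τ s)) ∧
      ∀ᵐ y ∂(arcLength (D.Γ i)),
        ψ y + (D.nhdK D.ε).indicator (fun y => ∑ s, D.b i s y * τ s (D.Ω i s y)) y
          + B.op i ⟨u, hu⟩ y = f i y

end Problem

/-! ### The model problem with a parameter -/

/-- The Sobolev space `W²(-a, a)`: a function `toFun` on `[-a, a]` with absolutely continuous
derivative `d1` and second derivative `d2 ∈ L₂(-a, a)`. -/
structure IntervalW2 (a : ℝ) where
  toFun : ℝ → ℂ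
  d1 : ℝ → ℂ
  d2 : ℝ → ℂ
  d2_mem : MemLp d2 2 (volume.restrict (Ioo (-a) a))
  d1_eq : ∀ t ∈ Icc (-a) a, d1 t = d1 0 + ∫ s in (0 : ℝ)..t, d2 s
  toFun_eq : ∀ t ∈ Icc (-a) a, toFun t = toFun 0 + ∫ s in (0 : ℝ)..t, d1 s

namespace Problem

variable {N : ℕ} (D : Problem N)

/-- `∏_j W²(-ω_j, ω_j)`. -/
abbrev Angular : Type := ∀ j, IntervalW2 (D.halfAngle j)

/-- The first component `P̃_j(ω, ∂/∂ω, iλ) φ_j` of `L̃(λ)φ` at the angle `t`. Here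
`P̃_j(ω, ∂/∂ω, iλ) φ = r^{2 - iλ} ∑ p_{jik}(0) ∂_i ∂_k (r^{iλ} φ(ω))`, where `p_{jik}(0)` are the
leading coefficients of `P` at `g_j` in the variables `Y_j`. With the radial unit vector `e` and
the angular unit vector `n` (in the original variables), the second derivatives of `r^μ φ(ω)`
along `ee`, `en`, `nn` are `r^{μ-2}` times `μ(μ-1)φ`, `(μ-1)φ'`, `φ'' + μφ`. -/
def angularOp (lam : ℂ) (Φ : D.Angular) (j : Fin N) (t : ℝ) : ℂ :=
  let a : Fin 2 → Fin 2 → ℂ := fun i k => D.p₂ i k (D.g j)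
  let e : Fin 2 → ℂ := ![(Real.cos (t + D.θ j) : ℂ), (Real.sin (t + D.θ j) : ℂ)]
  let n : Fin 2 → ℂ := ![(-Real.sin (t + D.θ j) : ℂ), (Real.cos (t + D.θ j) : ℂ)]
  let μ : ℂ := Complex.I * lam
  form a e e * (μ * (μ - 1) * (Φ j).toFun t)
    + (form a e n + form a n e) * ((μ - 1) * (Φ j).d1 t)
    + form a n n * ((Φ j).d2 t + μ * (Φ j).toFun t)

/-- The component
`φ_j((-1)^σ ω_j) + ∑_{k,s} χ_{jσks}^{iλ} b_{jσks}(0) φ_k((-1)^σ ω_j + ω_{jσks})` of `L̃(λ)φ`;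
`χ_{jσks}` is the modulus of `rot j σ s`, and the argument of `φ_k`, an angle of absolute value
less than `ω_k`, is the polar angle of the image of the ray `γ_{jσ}`. -/
def angularBC (lam : ℂ) (Φ : D.Angular) (j : Fin N) (σ : Fin 2) : ℂ :=
  (Φ j).toFun (sgn σ * D.halfAngle j)
    + ∑ s, (‖D.rot j σ s‖ : ℂ) ^ (Complex.I * lam) * D.b (D.side j σ) s (D.g j)
        * (Φ (D.tgt j σ s)).toFun
            (D.rot j σ s * Complex.exp ((sgn σ * D.halfAngle j : ℝ) * Complex.I)).arg

/-- `φ` is an eigenvector of `L̃` for `λ`: `φ ≠ 0` and `L̃(λ)φ = 0`. -/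
def IsEigenvector (lam : ℂ) (Φ : D.Angular) : Prop :=
  (∃ j, ∃ t ∈ Ioo (-D.halfAngle j) (D.halfAngle j), (Φ j).toFun t ≠ 0) ∧
  (∀ j, ∀ᵐ t ∂(volume.restrict (Ioo (-D.halfAngle j) (D.halfAngle j))), D.angularOp lam Φ j t = 0) ∧
  ∀ j σ, D.angularBC lam Φ j σ = 0

/-- `φ¹` is associated with the eigenvector `φ⁰`: `L̃(λ)φ¹ + (dL̃/dλ)(λ)φ⁰ = 0`. -/
def IsAssociated (lam : ℂ) (Φ₀ Φ₁ : D.Angular) : Prop :=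
  (∀ j, ∀ᵐ t ∂(volume.restrict (Ioo (-D.halfAngle j) (D.halfAngle j))),
    D.angularOp lam Φ₁ j t + deriv (fun z => D.angularOp z Φ₀ j t) lam = 0) ∧
  ∀ j σ, D.angularBC lam Φ₁ j σ + deriv (fun z => D.angularBC z Φ₀ j σ) lam = 0

/-- `λ` is an eigenvalue of `L̃`. -/
def IsEigenvalue (lam : ℂ) : Prop := ∃ Φ, D.IsEigenvector lam Φ

/-- The functions `r^{iλ} φ_j(ω)` are polynomials in `y₁, y₂` (in the angles). -/
def IsPolynomialVector (lam : ℂ) (Φ : D.Angular) : Prop :=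
  ∀ j, ∃ q : MvPolynomial (Fin 2) ℂ, ∀ r : ℝ, 0 < r → ∀ t ∈ Ioo (-D.halfAngle j) (D.halfAngle j),
    (r : ℂ) ^ (Complex.I * lam) * (Φ j).toFun t
      = MvPolynomial.eval ![((r * Real.cos t : ℝ) : ℂ), ((r * Real.sin t : ℝ) : ℂ)] q

/-- `λ` is a proper eigenvalue: no eigenvector has an associated vector, and `r^{iλ} φ_j(ω)` are
polynomials for every eigenvector `φ`. -/
def IsProperEigenvalue (lam : ℂ) : Prop :=
  D.IsEigenvalue lam ∧ ∀ Φ, D.IsEigenvector lam Φ →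
    (¬ ∃ Φ₁, D.IsAssociated lam Φ Φ₁) ∧ D.IsPolynomialVector lam Φ

/-- An eigenvalue is improper if it is not proper. -/
def IsImproperEigenvalue (lam : ℂ) : Prop :=
  D.IsEigenvalue lam ∧ ¬ D.IsProperEigenvalue lam

end Problem

end NonlocalElliptic

end

noncomputable section

open MeasureTheory Filter Topology Set
open scoped ContDiff ENNReal NNReal

namespace NonlocalElliptic

/-! ### Weak derivatives of classically differentiable functions -/

/-! Put `μ = iλ`, so that `0 < Re μ ≤ 1`. If an eigenvector `φ` has an associated vector `φ¹`, then
`r^μ (i log r · φ_j + φ¹_j)` solves the homogeneous model problem with frozen coefficients; an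
eigenvector alone gives the solution `r^μ φ_j`. Both have the form `r^μ (log r · f_j + h_j)`. Such a
function lies in `W¹` because `Re μ > 0`, while its second derivatives are `r^(μ-2) (log r · F + H)`
with `Re (μ - 2) ≤ -1`. These are square integrable near the vertex only if the angular functions
`F` and `H` vanish throughout the angle (`eq_zero_of_memLp_powLog`). Splitting the Hessian along `e
⊗ e`, `e ⊗ n + n ⊗ e`, `n ⊗ n` (`eq_zero_of_dir`) shows what this would mean. In the associated case
it gives first `μ = 1` and then `φ = 0`. For an eigenvector alone it gives `φ_j = 0`, or `μ = 1` and
`φ_j'' + φ_j = 0`, so that `r φ_j` is a linear polynomial. An improper eigenvalue has an eigenvector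
for which one of the two constructions escapes this.

To pass from the model problem to `G`, the functions are cut off near every `g_j`. In `P u` the
differences `p_ik(y) - p_ik(g_j) = O(r)` gain one power of `r`, which is enough for `P u ∈ L₂`. The
boundary conditions must hold exactly. The cutoff `ξ` is not invariant under the homotheties and
`b_is` is not constant, so a defect with the factor `b_is(g_j) ξ(y) - b_is(y) ξ(χ (y - g_j))`
appears; it vanishes at `g_j`. A correction with this factor and an angular factor `η` removes it.
Here `η` is `1` on the side in question and `0` on the other side and on every image of a side.
Images of sides lie strictly inside the angles, so `η` exists (`exists_separator`), the nonlocal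
terms do not see the corrections, and the vanishing factor keeps the corrections' second derivatives
in `L₂`.

The operators `B_i²` play no role once the support of `u` lies in `O_{κ₁}(𝒦)`: the first estimate
then says that `B_i² u` has zero trace norm. That such a function is zero almost everywhere
(`ae_eq_zero_of_traceNorm_eq_zero`) follows from a trace inequality, `IsStrip.exists_trace_bound`,
proved by integrating by parts in a strip below a local graph of the boundary. -/

theorem continuous_mul_of_tsupport_subset {U : Set ℂ} (hU : IsOpen U) {u φ : ℂ → ℂ}
    (hu : ContinuousOn u U) (hφ : Continuous φ) (hs : tsupport φ ⊆ U) :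
    Continuous fun y => u y * φ y := by
  rw [continuous_iff_continuousAt]
  intro y
  by_cases hy : y ∈ U
  · exact (hu.continuousAt (hU.mem_nhds hy)).mul hφ.continuousAt
  · have h0 : φ =ᶠ[𝓝 y] 0 := notMem_tsupport_iff_eventuallyEq.1 fun h => hy (hs h)
    have : (fun y => u y * φ y) =ᶠ[𝓝 y] fun _ => 0 := by
      filter_upwards [h0] with z hz
      simp [hz]
    exact continuousAt_const.congr this.symm

theorem integrable_mul_of_tsupport_subset {U : Set ℂ} (hU : IsOpen U) {u φ : ℂ → ℂ}
    (hu : ContinuousOn u U) (hφ : Continuous φ) (hc : HasCompactSupport φ) (hs : tsupport φ ⊆ U) :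
    Integrable fun y => u y * φ y :=
  (continuous_mul_of_tsupport_subset hU hu hφ hs).integrable_of_hasCompactSupport hc.mul_left

theorem tsupport_pd_subset (i : Fin 2) (φ : ℂ → ℂ) : tsupport (pd i φ) ⊆ tsupport φ := by
  refine (closure_mono ?_).trans (closure_minimal (subset_refl _) (isClosed_tsupport φ))
  intro y hy
  refine support_fderiv_subset ℝ (?_ : y ∈ Function.support (fderiv ℝ φ))
  intro h
  exact hy (by simp [pd, h])

theorem IsTest.pd {U : Set ℂ} {φ : ℂ → ℂ} (h : IsTest U φ) (i : Fin 2) : IsTest U (pd i φ) :=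
  ⟨pd_smooth i h.smooth, pd_compact i h.compact, (tsupport_pd_subset i φ).trans h.supp⟩

theorem IsTest.smooth_mul {U : Set ℂ} {φ a : ℂ → ℂ} (h : IsTest U φ) (ha : ContDiff ℝ ∞ a) :
    IsTest U fun y => a y * φ y :=
  ⟨ha.mul h.smooth, h.compact.mul_left,
    (closure_mono (Function.support_mul_subset_right _ _)).trans h.supp⟩

theorem IsTest.eq_zero {U : Set ℂ} {φ : ℂ → ℂ} (h : IsTest U φ) {y : ℂ} (hy : y ∉ U) :
    φ y = 0 :=
  image_eq_zero_of_notMem_tsupport fun h' => hy (h.supp h')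

theorem IsTest.setIntegral_mul {U : Set ℂ} {φ : ℂ → ℂ} (h : IsTest U φ) (u : ℂ → ℂ) :
    ∫ y in U, u y * φ y = ∫ y, u y * φ y :=
  setIntegral_eq_integral_of_forall_compl_eq_zero fun y hy => by simp [h.eq_zero hy]

theorem continuousOn_pd {U : Set ℂ} (hU : IsOpen U) {n : WithTop ℕ∞} {u : ℂ → ℂ}
    (hu : ContDiffOn ℝ (n + 1) u U) (i : Fin 2) : ContDiffOn ℝ n (pd i u) U :=
  (hu.fderiv_of_isOpen hU le_rfl).clm_apply contDiffOn_const

/-- Integration by parts against a test function. -/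
theorem setIntegral_mul_pd {U : Set ℂ} (hU : IsOpen U) {u φ : ℂ → ℂ}
    (hu : ContDiffOn ℝ 1 u U) (hφ : IsTest U φ) (i : Fin 2) :
    ∫ y in U, u y * pd i φ y = -∫ y in U, pd i u y * φ y := by
  rw [(hφ.pd i).setIntegral_mul, hφ.setIntegral_mul]
  have hpd : ContinuousOn (pd i u) U :=
    (continuousOn_pd (n := 0) hU (by simpa using hu) i).continuousOn
  refine integral_mul_fderiv_eq_neg_fderiv_mul_of_integrable ?_ ?_ ?_ ?_ ?_
  · exact integrable_mul_of_tsupport_subset hU hpd hφ.smooth.continuous hφ.compact hφ.supp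
  · exact integrable_mul_of_tsupport_subset hU hu.continuousOn (hφ.pd i).smooth.continuous
      (hφ.pd i).compact (hφ.pd i).supp
  · exact integrable_mul_of_tsupport_subset hU hu.continuousOn hφ.smooth.continuous hφ.compact
      hφ.supp
  · intro x hx
    exact (hu.differentiableOn one_ne_zero).differentiableAt (hU.mem_nhds (hφ.supp hx))
  · intro x _
    exact hφ.smooth.differentiable (by simp) x

/-- Weak derivatives are unique almost everywhere. -/
theorem ae_eq_of_forall_integral_eq {U : Set ℂ} (hU : IsOpen U) {f g : ℂ → ℂ}
    (hf : LocallyIntegrableOn f U) (hg : LocallyIntegrableOn g U)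
    (h : ∀ φ, IsTest U φ → ∫ y in U, f y * φ y = ∫ y in U, g y * φ y) :
    f =ᵐ[volume.restrict U] g := by
  have key := hU.ae_eq_zero_of_integral_contDiff_smul_eq_zero (μ := volume) (f := f - g)
    (hf.sub hg) ?_
  · rw [Filter.EventuallyEq, ae_restrict_iff' hU.measurableSet]
    filter_upwards [key] with y hy hyU
    exact sub_eq_zero.1 (hy hyU)
  · intro η hη hc hs
    -- Real-valued test functions suffice for the vanishing criterion; they are admitted here as
    -- complex ones.
    have hT : IsTest U fun y => (η y : ℂ) := by
      refine ⟨Complex.ofRealCLM.contDiff.comp hη, hc.comp_left Complex.ofReal_zero, ?_⟩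
      refine (closure_mono ?_).trans hs
      intro y hy h0
      exact hy (by simp [h0])
    have hK : ∀ w : ℂ → ℂ, LocallyIntegrableOn w U → Integrable fun y => w y * (η y : ℂ) := by
      intro w hw
      have h1 : IntegrableOn w (tsupport η) := hw.integrableOn_compact_subset hs hc
      have h2 : IntegrableOn (fun y => w y * (η y : ℂ)) (tsupport η) :=
        h1.mul_continuousOn (Complex.continuous_ofReal.comp hη.continuous).continuousOn hc
      refine (integrableOn_iff_integrable_of_support_subset ?_).1 h2
      intro y hy
      by_contra hy'
      exact hy (by simp [image_eq_zero_of_notMem_tsupport hy'])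
    have e := h _ hT
    rw [hT.setIntegral_mul, hT.setIntegral_mul] at e
    calc ∫ x, η x • (f - g) x = ∫ x, (f x * (η x : ℂ) - g x * (η x : ℂ)) := by
          congr 1
          ext x
          simp only [Pi.sub_apply, Complex.real_smul]
          ring
      _ = 0 := by rw [integral_sub (hK f hf) (hK g hg), e, sub_self]

theorem locallyIntegrableOn_of_memLp {U : Set ℂ} {f : ℂ → ℂ}
    (hf : MemLp f 2 (volume.restrict U)) : LocallyIntegrableOn f U := by
  intro x _
  refine ⟨U ∩ Metric.ball x 1, inter_mem_nhdsWithin U (Metric.ball_mem_nhds x one_pos), ?_⟩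
  have h : MemLp f 2 (volume.restrict (U ∩ Metric.ball x 1)) :=
    hf.mono_measure (Measure.restrict_mono inter_subset_left le_rfl)
  have : IsFiniteMeasure (volume.restrict (U ∩ Metric.ball x 1)) :=
    ⟨by
      rw [Measure.restrict_apply_univ]
      exact (measure_mono inter_subset_right).trans_lt measure_ball_lt_top⟩
  exact h.integrable one_le_two

theorem IsWeakDeriv.ae_eq {U : Set ℂ} (hU : IsOpen U) {α : ℕ × ℕ} {u f g : ℂ → ℂ}
    (hf : IsWeakDeriv U α u f) (hg : IsWeakDeriv U α u g) : f =ᵐ[volume.restrict U] g := by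
  refine ae_eq_of_forall_integral_eq hU (locallyIntegrableOn_of_memLp hf.1)
    (locallyIntegrableOn_of_memLp hg.1) fun φ hφ => ?_
  have h := (hf.2 φ hφ).symm.trans (hg.2 φ hφ)
  exact mul_left_cancel₀ (pow_ne_zero _ (by norm_num)) h

theorem IsWeakDeriv.ae_eq_weakDeriv {U : Set ℂ} (hU : IsOpen U) {α : ℕ × ℕ} {u g : ℂ → ℂ}
    (hg : IsWeakDeriv U α u g) : weakDeriv U α u =ᵐ[volume.restrict U] g := by
  have h : ∃ g, IsWeakDeriv U α u g := ⟨g, hg⟩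
  rw [weakDeriv, dif_pos h]
  exact h.choose_spec.ae_eq hU hg

theorem isWeakDeriv_weakDeriv {U : Set ℂ} {α : ℕ × ℕ} {u : ℂ → ℂ}
    (h : ∃ g, IsWeakDeriv U α u g) : IsWeakDeriv U α u (weakDeriv U α u) := by
  rw [weakDeriv, dif_pos h]
  exact h.choose_spec

/-- A function vanishing on `U` has vanishing Sobolev norm over `U`. -/
theorem isWeakDeriv_zero_of_eqOn {U : Set ℂ} (hU : MeasurableSet U) {u : ℂ → ℂ}
    (hu : ∀ y ∈ U, u y = 0) (α : ℕ × ℕ) : IsWeakDeriv U α u 0 := by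
  refine ⟨MemLp.zero, fun φ _ => ?_⟩
  rw [setIntegral_congr_fun (g := fun _ => 0) hU fun y hy => by simp [hu y hy]]
  simp

theorem mem_sobolev_of_eqOn_zero {U : Set ℂ} (hU : MeasurableSet U) {u : ℂ → ℂ}
    (hu : ∀ y ∈ U, u y = 0) (k : ℕ) : u ∈ sobolev k U := by
  refine ⟨?_, fun α _ => ⟨0, isWeakDeriv_zero_of_eqOn hU hu α⟩⟩
  refine MemLp.ae_eq ?_ (MemLp.zero (ε := ℂ))
  filter_upwards [ae_restrict_mem hU] with y hy
  simp [hu y hy]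

theorem sobolevNorm_of_eqOn_zero {U : Set ℂ} (hU : IsOpen U) {u : ℂ → ℂ}
    (hu : ∀ y ∈ U, u y = 0) (k : ℕ) : sobolevNorm k U u = 0 := by
  rw [sobolevNorm, Finset.sum_eq_zero, ENNReal.zero_rpow_of_pos (by norm_num)]
  intro α _
  have h := (isWeakDeriv_zero_of_eqOn hU.measurableSet hu α).ae_eq_weakDeriv hU
  rw [lintegral_congr_ae (g := fun _ => 0)]
  · simp
  · filter_upwards [h] with y hy
    simp [hy]

theorem isWeakDeriv_zero_zero {U : Set ℂ} {u : ℂ → ℂ} (h0 : MemLp u 2 (volume.restrict U)) :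
    IsWeakDeriv U (0, 0) u u :=
  ⟨h0, fun φ _ => by simp [mixedPd]⟩

theorem isWeakDeriv_pd {U : Set ℂ} (hU : IsOpen U) {u : ℂ → ℂ} (i : Fin 2)
    (hu : ContDiffOn ℝ 1 u U) (h1 : MemLp (pd i u) 2 (volume.restrict U)) :
    IsWeakDeriv U (if i = 0 then (1, 0) else (0, 1)) u (pd i u) := by
  refine ⟨h1, fun φ hφ => ?_⟩
  fin_cases i
  · simpa [mixedPd] using setIntegral_mul_pd hU hu hφ 0
  · simpa [mixedPd] using setIntegral_mul_pd hU hu hφ 1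

/-- Two integrations by parts reverse the order of differentiation. The order is kept explicit so
that symmetry of second derivatives is needed only for test functions. -/
theorem setIntegral_mul_pd_pd {U : Set ℂ} (hU : IsOpen U) {u : ℂ → ℂ}
    (hu : ContDiffOn ℝ 2 u U) {φ : ℂ → ℂ} (hφ : IsTest U φ) (i k : Fin 2) :
    ∫ y in U, u y * pd i (pd k φ) y = ∫ y in U, pd k (pd i u) y * φ y := by
  rw [setIntegral_mul_pd hU (hu.of_le one_le_two) (hφ.pd k) i,
    setIntegral_mul_pd hU (continuousOn_pd (n := 1) hU (by simpa [one_add_one_eq_two] using hu) i)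
      hφ k, neg_neg]

theorem mem_sobolev_one {U : Set ℂ} (hU : IsOpen U) {u : ℂ → ℂ} (hu : ContDiffOn ℝ 1 u U)
    (h0 : MemLp u 2 (volume.restrict U)) (h1 : ∀ i, MemLp (pd i u) 2 (volume.restrict U)) :
    u ∈ sobolev 1 U := by
  refine ⟨h0, ?_⟩
  rintro ⟨a, b⟩ hab
  have : (a = 0 ∧ b = 0) ∨ (a = 1 ∧ b = 0) ∨ (a = 0 ∧ b = 1) := by simp at hab; omega
  rcases this with ⟨rfl, rfl⟩ | ⟨rfl, rfl⟩ | ⟨rfl, rfl⟩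
  · exact ⟨u, isWeakDeriv_zero_zero h0⟩
  · exact ⟨_, by simpa using isWeakDeriv_pd hU 0 hu (h1 0)⟩
  · exact ⟨_, by simpa using isWeakDeriv_pd hU 1 hu (h1 1)⟩

/-- The classical second derivatives of a function in `W²` are square integrable. -/
theorem memLp_pd_pd_of_mem_sobolev {U : Set ℂ} (hU : IsOpen U) {u : ℂ → ℂ}
    (hu : ContDiffOn ℝ 2 u U) (h : u ∈ sobolev 2 U) (i k : Fin 2) :
    MemLp (pd k (pd i u)) 2 (volume.restrict U) := by
  have hc : ContinuousOn (pd k (pd i u)) U :=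
    (continuousOn_pd (n := 0) hU (by
      simpa using continuousOn_pd (n := 1) hU (by simpa [one_add_one_eq_two] using hu) i)
        k).continuousOn
  have key : ∀ (α : ℕ × ℕ) (i k : Fin 2), α.1 + α.2 = 2 →
      (∀ φ : ℂ → ℂ, IsTest U φ → mixedPd α φ = pd i (pd k φ)) →
      ∀ hc : ContinuousOn (pd k (pd i u)) U, MemLp (pd k (pd i u)) 2 (volume.restrict U) := by
    intro α i k hα hm hc
    obtain ⟨g, hg, hg'⟩ := h.2 α hα.le
    refine hg.ae_eq (ae_eq_of_forall_integral_eq hU (locallyIntegrableOn_of_memLp hg)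
      (hc.locallyIntegrableOn hU.measurableSet) fun φ hφ => ?_)
    have := hg' φ hφ
    rw [hm φ hφ, setIntegral_mul_pd_pd hU hu hφ, hα] at this
    simpa using this.symm
  -- `mixedPd (1, 1)` applies `∂₂` first and then `∂₁`, so only the derivative `∂₁ ∂₂ u` requires
  -- the test function's derivatives to be interchanged.
  have hsymm : ∀ φ : ℂ → ℂ, IsTest U φ → pd 0 (pd 1 φ) = pd 1 (pd 0 φ) := by
    intro φ hφ
    ext y
    have hd : DifferentiableAt ℝ (fderiv ℝ φ) y :=
      (hφ.smooth.fderiv_right (m := 1) (by norm_cast)).differentiable one_ne_zero y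
    have hs := (hφ.smooth.contDiffAt (x := y)).isSymmSndFDerivAt
      (by simp only [minSmoothness_of_isRCLikeNormedField]; norm_cast)
    have e : ∀ (i : Fin 2) (v : ℂ), fderiv ℝ (pd i φ) y v
        = fderiv ℝ (fderiv ℝ φ) y v (if i = 0 then 1 else Complex.I) := by
      intro i v
      unfold pd
      rw [fderiv_clm_apply hd (differentiableAt_const _)]
      simp
    change fderiv ℝ (pd 1 φ) y _ = fderiv ℝ (pd 0 φ) y _
    rw [e, e]
    exact hs.eq _ _
  fin_cases i <;> fin_cases k
  · exact key (2, 0) 0 0 rfl (fun φ _ => rfl) hc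
  · exact key (1, 1) 0 1 rfl (fun φ _ => rfl) hc
  · exact key (1, 1) 1 0 rfl (fun φ hφ => hsymm φ hφ) hc
  · exact key (0, 2) 1 1 rfl (fun φ _ => rfl) hc
/-! ### Local graphs of smooth boundaries -/

/-- The point at depth `t` below the graph of `g` over `s`, in the orthonormal frame with origin
`y₀` and vertical direction `e`. -/
def graphPt (y₀ e : ℂ) (g : ℝ → ℝ) (s t : ℝ) : ℂ := y₀ + e * ((g s - t : ℝ) + (s : ℝ) * Complex.I)

theorem exists_unit_fderiv_pos {ℓ : ℂ →L[ℝ] ℝ} (hℓ : ℓ ≠ 0) : ∃ e : ℂ, ‖e‖ = 1 ∧ 0 < ℓ e := by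
  obtain ⟨v, hv⟩ : ∃ v, 0 < ℓ v := by
    obtain ⟨v, hv⟩ : ∃ v, ℓ v ≠ 0 := by
      by_contra! h
      exact hℓ (ContinuousLinearMap.ext h)
    rcases lt_or_gt_of_ne hv with h | h
    · exact ⟨-v, by simpa using h⟩
    · exact ⟨v, h⟩
  have hv0 : v ≠ 0 := by
    rintro rfl
    simp at hv
  have hn : 0 < ‖v‖ := norm_pos_iff.2 hv0
  refine ⟨(‖v‖⁻¹ : ℝ) • v, ?_, ?_⟩
  · rw [norm_smul, norm_inv, norm_norm, inv_mul_cancel₀ hn.ne']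
  · rw [map_smul, smul_eq_mul]
    positivity

/-- Near a regular boundary point, a domain `{h < 0}` lies below a smooth graph. -/
theorem exists_local_graph {V : Set ℂ} (hV : IsOpen V) {h : ℂ → ℝ} (hh : ContDiffOn ℝ ∞ h V)
    {y₀ : ℂ} (hy₀ : y₀ ∈ V) (h0 : h y₀ = 0) (hd : fderiv ℝ h y₀ ≠ 0) :
    ∃ (e : ℂ) (g : ℝ → ℝ) (a T : ℝ) (K : ℝ≥0), ‖e‖ = 1 ∧ 0 < a ∧ 0 < T ∧
      ContDiffOn ℝ ∞ g (Ioo (-a) a) ∧ LipschitzOnWith K g (Ioo (-a) a) ∧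
      (∀ s ∈ Ioo (-a) a, ∀ t ∈ Ico 0 T, graphPt y₀ e g s t ∈ V) ∧
      (∀ s ∈ Ioo (-a) a, ∀ t ∈ Ioo 0 T, h (graphPt y₀ e g s t) < 0) ∧
      (∀ s ∈ Ioo (-a) a, h (graphPt y₀ e g s 0) = 0) ∧
      ∃ W ∈ 𝓝 y₀, ∀ z ∈ W, h z = 0 → ∃ s ∈ Ioo (-a) a, z = graphPt y₀ e g s 0 := by
  obtain ⟨e, he, hpos⟩ := exists_unit_fderiv_pos hd
  -- Orthonormal coordinates `(s, x)` at `y₀` in which `h` increases along the `x`-axis; the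
  -- boundary is solved for `x`.
  let P : ℝ × ℝ → ℂ := fun v => y₀ + e * ((v.2 : ℝ) + (v.1 : ℝ) * Complex.I)
  have hPc : ContDiff ℝ ∞ P := by
    have h1 : ContDiff ℝ ∞ fun v : ℝ × ℝ => ((v.1 : ℝ) : ℂ) := Complex.ofRealCLM.contDiff.comp contDiff_fst
    have h2 : ContDiff ℝ ∞ fun v : ℝ × ℝ => ((v.2 : ℝ) : ℂ) := Complex.ofRealCLM.contDiff.comp contDiff_snd
    exact contDiff_const.add (contDiff_const.mul (h2.add (h1.mul contDiff_const)))
  have hPd : ∀ s x : ℝ, HasDerivAt (fun x : ℝ => P (s, x)) e x := by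
    intro s x
    have h1 : HasDerivAt (fun x : ℝ => (x : ℂ)) 1 x := Complex.ofRealCLM.hasDerivAt
    simpa [P] using ((h1.add_const ((s : ℂ) * Complex.I)).const_mul e).const_add y₀
  have hP0 : P (0, 0) = y₀ := by simp [P]
  let f : ℝ × ℝ → ℝ := fun v => h (P v)
  have hfP : ∀ v, P v ∈ V → ContDiffAt ℝ ∞ f v := fun v hv =>
    (hh.contDiffAt (hV.mem_nhds hv)).comp v hPc.contDiffAt
  have hfd : ∀ v, P v ∈ V → fderiv ℝ f v (0, 1) = fderiv ℝ h (P v) e := by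
    intro v hv
    have h1 : HasFDerivAt h (fderiv ℝ h (P v)) (P v) :=
      ((hh.contDiffAt (hV.mem_nhds hv)).differentiableAt (by simp)).hasFDerivAt
    have h2 : HasFDerivAt P (fderiv ℝ P v) v := (hPc.differentiable (by simp) v).hasFDerivAt
    have h3 : fderiv ℝ P v (0, 1) = e := by
      have h4 : HasDerivAt (fun x : ℝ => ((v.1, x) : ℝ × ℝ)) (0, 1) v.2 :=
        (hasDerivAt_const _ _).prodMk (hasDerivAt_id _)
      have h5 : HasDerivAt (fun x : ℝ => P (v.1, x)) (fderiv ℝ P v (0, 1)) v.2 :=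
        h2.comp_hasDerivAt v.2 h4
      exact h5.unique (hPd v.1 v.2)
    rw [show fderiv ℝ f v = _ from (h1.comp v h2).fderiv]
    simp [h3]
  have hinv : ∀ v, P v ∈ V → 0 < fderiv ℝ h (P v) e →
      (fderiv ℝ f v ∘L .inr ℝ ℝ ℝ).IsInvertible := by
    intro v hv hp
    have : fderiv ℝ f v ∘L .inr ℝ ℝ ℝ
        = (ContinuousLinearEquiv.unitsEquivAut ℝ (Units.mk0 _ hp.ne') : ℝ →L[ℝ] ℝ) := by
      ext
      simp [hfd v hv]
    rw [this]
    exact ContinuousLinearMap.isInvertible_equiv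
  have hmem : ∀ᶠ v in 𝓝 ((0, 0) : ℝ × ℝ), P v ∈ V ∧ 0 < fderiv ℝ h (P v) e := by
    have hPt : Tendsto P (𝓝 (0, 0)) (𝓝 y₀) := hP0 ▸ hPc.continuous.continuousAt.tendsto
    refine (hPt.eventually (hV.mem_nhds hy₀)).and ?_
    have hc : ContinuousAt (fun z => fderiv ℝ h z e) y₀ :=
      (((hh.contDiffAt (hV.mem_nhds hy₀)).fderiv_right (m := 0) (by norm_cast)).continuousAt).clm_apply
        continuousAt_const
    exact hPt.eventually (hc.eventually (lt_mem_nhds hpos))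
  have hPV : P (0, 0) ∈ V := hP0.symm ▸ hy₀
  have hc0 : ContDiffAt ℝ ∞ f (0, 0) := hfP _ hPV
  have hi0 := hinv (0, 0) hPV (hP0.symm ▸ hpos)
  have hinf : (∞ : WithTop ℕ∞) ≠ 0 := by simp
  set g : ℝ → ℝ := hc0.implicitFunction hinf hi0 with hg
  have hf0 : f (0, 0) = 0 := by simp [f, hP0, h0]
  have hg0 : g 0 = 0 := hc0.implicitFunction_apply_self hinf hi0
  have hiff := hc0.eventually_apply_eq_iff_implicitFunction hinf hi0
  rw [hf0] at hiff
  -- In one square about the origin both facts hold: `h` increases in `x`, and the zeros of `h` are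
  -- exactly the points `x = g s`.
  obtain ⟨r, hr, hbox⟩ := Metric.eventually_nhds_iff.1 (hmem.and hiff)
  have hbox' : ∀ s x : ℝ, |s| < r → |x| < r → (P (s, x) ∈ V ∧ 0 < fderiv ℝ h (P (s, x)) e) ∧
      (f (s, x) = 0 ↔ g s = x) := by
    intro s x hs hx
    refine hbox ?_
    rw [Prod.dist_eq]
    simpa using ⟨hs, hx⟩
  have hgA : ContDiffAt ℝ ∞ g 0 := hc0.contDiffAt_implicitFunction hinf hi0
  obtain ⟨K, t, ht, hLip⟩ := (hgA.of_le (m := 1) (by norm_cast)).exists_lipschitzOnWith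
  have hgc : ∀ᶠ s in 𝓝 (0 : ℝ), |g s| < r / 2 := by
    have : Tendsto (fun s => |g s|) (𝓝 0) (𝓝 0) := by
      simpa [hg0] using hgA.continuousAt.abs.tendsto
    exact this.eventually (gt_mem_nhds (half_pos hr))
  obtain ⟨a₀, ha₀, hball⟩ := Metric.eventually_nhds_iff.1 (hgc.and ht)
  set a := min a₀ r with ha
  have hapos : 0 < a := lt_min ha₀ hr
  have hI : ∀ s ∈ Ioo (-a) a, |s| < r ∧ |g s| < r / 2 ∧ s ∈ t := by
    intro s hs
    have hsa : |s| < a := abs_lt.2 hs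
    have := hball (y := s) (by simpa using hsa.trans_le (min_le_left _ _))
    exact ⟨hsa.trans_le (min_le_right _ _), this.1, this.2⟩
  have hgP : ∀ s u : ℝ, graphPt y₀ e g s u = P (s, g s - u) := fun s u => rfl
  have hLipI : LipschitzOnWith K g (Ioo (-a) a) := hLip.mono fun s hs => (hI s hs).2.2
  have hxr : ∀ s ∈ Ioo (-a) a, ∀ u ∈ Ico 0 (r / 2), |g s - u| < r := by
    intro s hs u hu
    have := abs_lt.1 (hI s hs).2.1
    rw [abs_lt]
    constructor <;> linarith [hu.1, hu.2, this.1, this.2]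
  have hzero : ∀ s ∈ Ioo (-a) a, h (graphPt y₀ e g s 0) = 0 := by
    intro s hs
    rw [hgP]
    exact (hbox' s _ (hI s hs).1 (hxr s hs 0 ⟨le_rfl, half_pos hr⟩)).2.2 (by simp)
  refine ⟨e, g, a, r / 2, K, he, hapos, half_pos hr, ?_, hLipI, ?_, ?_, hzero, ?_⟩
  · intro s hs
    -- The implicit function theorem at the origin gives smoothness at `0` only. Applied again at
    -- `(s, g s)`, it yields a smooth local solution, which agrees with `g` by uniqueness in the
    -- square.
    have hb := hbox' s (g s) (hI s hs).1 (by linarith [(hI s hs).2.1])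
    have hcs := hfP _ hb.1.1
    have his := hinv _ hb.1.1 hb.1.2
    have hfs : f (s, g s) = 0 := hb.2.2 rfl
    have hev := hcs.eventually_apply_eq_iff_implicitFunction hinf his
    rw [hfs] at hev
    have hgs : ContinuousAt g s :=
      hLipI.continuousOn.continuousAt (Ioo_mem_nhds hs.1 hs.2)
    have hT : Tendsto (fun x => (x, g x)) (𝓝 s) (𝓝 (s, g s)) := (continuousAt_id.prodMk hgs).tendsto
    have heq : g =ᶠ[𝓝 s] hcs.implicitFunction hinf his := by
      filter_upwards [hT.eventually hev, Ioo_mem_nhds hs.1 hs.2] with x hx hxI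
      refine (hx.1 ?_).symm
      exact (hbox' x (g x) (hI x hxI).1 (by linarith [(hI x hxI).2.1])).2.2 rfl
    exact ((hcs.contDiffAt_implicitFunction hinf his).congr_of_eventuallyEq heq).contDiffWithinAt
  · intro s hs u hu
    rw [hgP]
    exact (hbox' s _ (hI s hs).1 (hxr s hs u hu)).1.1
  · intro s hs u hu
    -- Strict monotonicity along vertical lines turns `h = 0` on the graph into `h < 0` below it.
    have hmono : StrictMonoOn (fun x => f (s, x)) (Ioo (-r) r) := by
      have hder : ∀ x ∈ Ioo (-r) r, HasDerivAt (fun x => f (s, x)) (fderiv ℝ h (P (s, x)) e) x := by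
        intro x hx
        have hb := (hbox' s x (hI s hs).1 (abs_lt.2 hx)).1.1
        exact (((hh.contDiffAt (hV.mem_nhds hb)).differentiableAt
          (by simp)).hasFDerivAt).comp_hasDerivAt x (hPd s x)
      refine strictMonoOn_of_deriv_pos (convex_Ioo _ _)
        (fun x hx => (hder x hx).continuousAt.continuousWithinAt) ?_
      intro x hx
      rw [interior_Ioo] at hx
      rw [(hder x hx).deriv]
      exact (hbox' s x (hI s hs).1 (abs_lt.2 hx)).1.2
    have h1 := abs_lt.1 (hxr s hs u ⟨hu.1.le, hu.2⟩)
    have h2 := abs_lt.1 (hxr s hs 0 ⟨le_rfl, half_pos hr⟩)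
    have := hmono h1 h2 (by linarith [hu.1])
    have hz := hzero s hs
    rw [hgP] at hz ⊢
    exact this.trans_eq hz
  -- The inverse of `P`; multiplication by the conjugate of `e` undoes the rotation because `‖e‖ =
  -- 1`.
  · let Q : ℂ → ℝ × ℝ := fun z => ((starRingEnd ℂ e * (z - y₀)).im, (starRingEnd ℂ e * (z - y₀)).re)
    have hQc : Continuous Q := by fun_prop
    have hee : e * starRingEnd ℂ e = 1 := by
      rw [Complex.mul_conj, Complex.normSq_eq_norm_sq, he]
      simp
    have hPQ : ∀ z, P (Q z) = z := by
      intro z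
      simp only [P, Q]
      rw [Complex.re_add_im, ← mul_assoc, hee]
      ring
    have hQ0 : Q y₀ = (0, 0) := by simp [Q]
    refine ⟨Q ⁻¹' (Ioo (-a) a ×ˢ Ioo (-r) r), ?_, ?_⟩
    · refine hQc.continuousAt.preimage_mem_nhds ?_
      rw [hQ0]
      exact prod_mem_nhds (Ioo_mem_nhds (by linarith) hapos) (Ioo_mem_nhds (by linarith) hr)
    · rintro z ⟨hz1, hz2⟩ hz
      refine ⟨(Q z).1, hz1, ?_⟩
      have hb := (hbox' (Q z).1 (Q z).2 (hI _ hz1).1 (abs_lt.2 hz2)).2.1 (by simp [f, hPQ, hz])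
      rw [hgP, hb, sub_zero]
      exact (hPQ z).symm
/-! ### Traces of functions with small `W¹`-norm -/

/-- The coordinate along the graph in the frame of `graphPt`. -/
def frameS (y₀ e z : ℂ) : ℝ := (starRingEnd ℂ e * (z - y₀)).im

/-- The vertical coordinate in the frame of `graphPt`. -/
def frameX (y₀ e z : ℂ) : ℝ := (starRingEnd ℂ e * (z - y₀)).re

theorem frameS_graphPt {y₀ e : ℂ} (he : ‖e‖ = 1) (g : ℝ → ℝ) (s t : ℝ) :
    frameS y₀ e (graphPt y₀ e g s t) = s := by
  have hee : starRingEnd ℂ e * e = 1 := by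
    rw [mul_comm, Complex.mul_conj, Complex.normSq_eq_norm_sq, he]
    simp
  simp [frameS, graphPt, ← mul_assoc, hee, -Complex.ofReal_sub]

theorem frameX_graphPt {y₀ e : ℂ} (he : ‖e‖ = 1) (g : ℝ → ℝ) (s t : ℝ) :
    frameX y₀ e (graphPt y₀ e g s t) = g s - t := by
  have hee : starRingEnd ℂ e * e = 1 := by
    rw [mul_comm, Complex.mul_conj, Complex.normSq_eq_norm_sq, he]
    simp
  simp [frameX, graphPt, ← mul_assoc, hee, -Complex.ofReal_sub]

theorem graphPt_frame {y₀ e : ℂ} (he : ‖e‖ = 1) (g : ℝ → ℝ) (z : ℂ) :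
    graphPt y₀ e g (frameS y₀ e z) (g (frameS y₀ e z) - frameX y₀ e z) = z := by
  have hee : e * starRingEnd ℂ e = 1 := by
    rw [Complex.mul_conj, Complex.normSq_eq_norm_sq, he]
    simp
  rw [graphPt, sub_sub_cancel, frameS, frameX, Complex.re_add_im, ← mul_assoc, hee]
  ring

theorem contDiff_frameS (y₀ e : ℂ) : ContDiff ℝ ∞ (frameS y₀ e) :=
  Complex.imCLM.contDiff.comp (contDiff_const.mul (contDiff_id.sub contDiff_const))

theorem contDiff_frameX (y₀ e : ℂ) : ContDiff ℝ ∞ (frameX y₀ e) :=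
  Complex.reCLM.contDiff.comp (contDiff_const.mul (contDiff_id.sub contDiff_const))

/-- The function `φ(s) ϑ(t)` in the coordinates of `graphPt`. -/
def stripFun (y₀ e : ℂ) (g φ ϑ : ℝ → ℝ) (z : ℂ) : ℂ :=
  ((φ (frameS y₀ e z) * ϑ (g (frameS y₀ e z) - frameX y₀ e z) : ℝ) : ℂ)

theorem stripFun_graphPt {y₀ e : ℂ} (he : ‖e‖ = 1) (g φ ϑ : ℝ → ℝ) (s t : ℝ) :
    stripFun y₀ e g φ ϑ (graphPt y₀ e g s t) = ((φ s * ϑ t : ℝ) : ℂ) := by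
  rw [stripFun, frameS_graphPt he, frameX_graphPt he, sub_sub_cancel]

theorem continuousOn_graphPt (y₀ e : ℂ) {g : ℝ → ℝ} {I : Set ℝ} (hg : ContinuousOn g I)
    (J : Set ℝ) : ContinuousOn (fun p : ℝ × ℝ => graphPt y₀ e g p.1 p.2) (I ×ˢ J) := by
  have h1 : ContinuousOn (fun p : ℝ × ℝ => g p.1) (I ×ˢ J) :=
    hg.comp continuousOn_fst fun p hp => hp.1
  refine continuousOn_const.add (continuousOn_const.mul ?_)
  exact (Complex.continuous_ofReal.comp_continuousOn (h1.sub continuousOn_snd)).add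
    ((Complex.continuous_ofReal.comp_continuousOn continuousOn_fst).mul continuousOn_const)

/-- A strip below a smooth graph, lying in the open set `G`. -/
structure IsStrip (G : Set ℂ) (y₀ e : ℂ) (g : ℝ → ℝ) (a T : ℝ) : Prop where
  norm_e : ‖e‖ = 1
  smooth : ContDiffOn ℝ ∞ g (Ioo (-a) a)
  mem : ∀ s ∈ Ioo (-a) a, ∀ t ∈ Ioo 0 T, graphPt y₀ e g s t ∈ G

namespace IsStrip

variable {G : Set ℂ} {y₀ e : ℂ} {g φ ϑ : ℝ → ℝ} {a T : ℝ}

theorem contDiff_stripFun (hS : IsStrip G y₀ e g a T)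
    (hφ : ContDiff ℝ ∞ φ) (hφs : tsupport φ ⊆ Ioo (-a) a) (hϑ : ContDiff ℝ ∞ ϑ) :
    ContDiff ℝ ∞ (stripFun y₀ e g φ ϑ) := by
  rw [contDiff_iff_contDiffAt]
  intro z
  have hs := (contDiff_frameS y₀ e).contDiffAt (x := z)
  refine Complex.ofRealCLM.contDiff.contDiffAt.comp z ?_
  by_cases hz : frameS y₀ e z ∈ tsupport φ
  · have hgz : ContDiffAt ℝ ∞ g (frameS y₀ e z) :=
      hS.smooth.contDiffAt (Ioo_mem_nhds (hφs hz).1 (hφs hz).2)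
    exact (hφ.contDiffAt.comp z hs).mul
      (hϑ.contDiffAt.comp z ((hgz.comp z hs).sub (contDiff_frameX y₀ e).contDiffAt))
  · have h0 : φ =ᶠ[𝓝 (frameS y₀ e z)] 0 := notMem_tsupport_iff_eventuallyEq.1 hz
    refine (contDiffAt_const (c := (0 : ℝ))).congr_of_eventuallyEq ?_
    filter_upwards [hs.continuousAt.eventually h0] with w hw
    simp only [Pi.zero_apply] at hw
    change φ (frameS y₀ e w) * ϑ (g (frameS y₀ e w) - frameX y₀ e w) = 0
    rw [hw, zero_mul]

/-- The support lies in the image of the compact set `tsupport φ ×ˢ tsupport ϑ` under the continuous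
map `graphPt`, and this image stays inside the open strip. -/
theorem isTest_stripFun (hS : IsStrip G y₀ e g a T)
    (hφ : ContDiff ℝ ∞ φ) (hφs : tsupport φ ⊆ Ioo (-a) a) (hϑ : ContDiff ℝ ∞ ϑ)
    (hφc : HasCompactSupport φ) (hϑc : HasCompactSupport ϑ) (hϑs : tsupport ϑ ⊆ Ioo 0 T) :
    IsTest G (stripFun y₀ e g φ ϑ) := by
  have hcont := (continuousOn_graphPt y₀ e hS.smooth.continuousOn (tsupport ϑ)).mono
    (prod_mono hφs (subset_refl _))
  have hK := (hφc.prod hϑc).image_of_continuousOn hcont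
  have hsub : Function.support (stripFun y₀ e g φ ϑ)
      ⊆ (fun p : ℝ × ℝ => graphPt y₀ e g p.1 p.2) '' (tsupport φ ×ˢ tsupport ϑ) := by
    intro z hz
    have hz' : φ (frameS y₀ e z) * ϑ (g (frameS y₀ e z) - frameX y₀ e z) ≠ 0 := by
      intro h
      exact hz (by simp only [stripFun, h, Complex.ofReal_zero])
    exact ⟨(_, _), ⟨subset_tsupport _ (left_ne_zero_of_mul hz'),
      subset_tsupport _ (right_ne_zero_of_mul hz')⟩, graphPt_frame hS.norm_e g z⟩
  have hts := closure_minimal hsub hK.isClosed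
  refine ⟨hS.contDiff_stripFun hφ hφs hϑ, hK.of_isClosed_subset (isClosed_tsupport _) hts,
    hts.trans ?_⟩
  rintro _ ⟨p, hp, rfl⟩
  exact hS.mem _ (hφs hp.1) _ (hϑs hp.2)

/-- Moving along `e` fixes `s` and raises the height `x`, hence lowers the depth `t = g s - x`; this
is the source of the minus sign. No derivative of `φ` or `g` appears. -/
theorem fderiv_stripFun (hS : IsStrip G y₀ e g a T)
    (hφ : ContDiff ℝ ∞ φ) (hφs : tsupport φ ⊆ Ioo (-a) a) (hϑ : ContDiff ℝ ∞ ϑ) (z : ℂ) :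
    fderiv ℝ (stripFun y₀ e g φ ϑ) z e = -stripFun y₀ e g φ (deriv ϑ) z := by
  have hd : DifferentiableAt ℝ (stripFun y₀ e g φ ϑ) z :=
    (hS.contDiff_stripFun hφ hφs hϑ).differentiable (by simp) z
  have hee : starRingEnd ℂ e * e = 1 := by
    rw [mul_comm, Complex.mul_conj, Complex.normSq_eq_norm_sq, hS.norm_e]
    simp
  have h1 : HasDerivAt (fun τ : ℝ => z + τ • e) e 0 := by
    simpa using ((hasDerivAt_id (0 : ℝ)).smul_const e).const_add z
  have h2 : HasDerivAt (fun τ : ℝ => stripFun y₀ e g φ ϑ (z + τ • e))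
      (fderiv ℝ (stripFun y₀ e g φ ϑ) z e) 0 := by
    have hd' : HasFDerivAt (stripFun y₀ e g φ ϑ) (fderiv ℝ (stripFun y₀ e g φ ϑ) z)
      (z + (0 : ℝ) • e) := by simpa using hd.hasFDerivAt
    exact hd'.comp_hasDerivAt 0 h1
  refine h2.unique ?_
  have hs : ∀ τ : ℝ, frameS y₀ e (z + τ • e) = frameS y₀ e z := by
    intro τ
    have : starRingEnd ℂ e * (z + τ • e - y₀) = starRingEnd ℂ e * (z - y₀) + τ := by
      rw [Complex.real_smul]
      linear_combination (τ : ℂ) * hee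
    rw [frameS, this, Complex.add_im, Complex.ofReal_im, add_zero, frameS]
  have hx : ∀ τ : ℝ, frameX y₀ e (z + τ • e) = frameX y₀ e z + τ := by
    intro τ
    have : starRingEnd ℂ e * (z + τ • e - y₀) = starRingEnd ℂ e * (z - y₀) + τ := by
      rw [Complex.real_smul]
      linear_combination (τ : ℂ) * hee
    rw [frameX, this, Complex.add_re, Complex.ofReal_re, frameX]
  set c := frameS y₀ e z
  set x := frameX y₀ e z
  have h3 : HasDerivAt (fun τ : ℝ => g c - (x + τ)) (-1) 0 := by
    simpa using ((hasDerivAt_id (0 : ℝ)).const_add x).const_sub (g c)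
  have h4 : HasDerivAt (fun τ : ℝ => φ c * ϑ (g c - (x + τ))) (φ c * (deriv ϑ (g c - x) * -1)) 0 := by
    have h5 : HasDerivAt ϑ (deriv ϑ (g c - x)) (g c - (x + 0)) := by
      simpa using (hϑ.differentiable (by simp) (g c - x)).hasDerivAt
    exact (h5.comp 0 h3).const_mul (φ c)
  have h6 := h4.ofReal_comp
  simp only [stripFun, hs, hx]
  have h7 : -((φ c * deriv ϑ (g c - x) : ℝ) : ℂ) = ((φ c * (deriv ϑ (g c - x) * -1) : ℝ) : ℂ) := by
    push_cast
    ring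
  change HasDerivAt _ (-((φ c * deriv ϑ (g c - x) : ℝ) : ℂ)) 0
  rw [h7]
  exact h6

/-- After a rigid motion this is Fubini's theorem; on each vertical line the change from height to
depth is a reflection and a translation, so the Jacobian is `1` whatever `g` is. -/
theorem integral_eq_integral_integral_graphPt (he : ‖e‖ = 1) {F : ℂ → ℂ} (hF : Integrable F) :
    (∫ z, F z = ∫ s : ℝ, ∫ t : ℝ, F (graphPt y₀ e g s t)) ∧
      Integrable (fun s : ℝ => ∫ t : ℝ, F (graphPt y₀ e g s t)) := by
  have he0 : e ∈ Submonoid.unitSphere ℂ := by simp [Submonoid.unitSphere, he]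
  let R := rotation (⟨e, he0⟩ : Circle)
  have h1 : MeasurePreserving R := R.measurePreserving
  have h2 : MeasurePreserving (fun z : ℂ => y₀ + z) := measurePreserving_add_left volume y₀
  have h3 := Complex.volume_preserving_equiv_real_prod.symm
  have h4 : MeasurePreserving (fun p : ℝ × ℝ => y₀ + e * ((p.1 : ℂ) + p.2 * Complex.I)) := by
    have := h2.comp (h1.comp h3)
    convert this using 1
    ext p
    change _ = y₀ + (e * (⟨p.1, p.2⟩ : ℂ))
    rw [Complex.mk_eq_add_mul_I]
  have hemb : MeasurableEmbedding (fun p : ℝ × ℝ => y₀ + e * ((p.1 : ℂ) + p.2 * Complex.I)) := by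
    have := (measurableEmbedding_addLeft y₀).comp
      ((R.toHomeomorph.measurableEmbedding).comp Complex.measurableEquivRealProd.symm.measurableEmbedding)
    convert this using 1
    ext p
    change _ = y₀ + (e * (⟨p.1, p.2⟩ : ℂ))
    rw [Complex.mk_eq_add_mul_I]
  have hint : Integrable (fun p : ℝ × ℝ => F (y₀ + e * ((p.1 : ℂ) + p.2 * Complex.I)))
      (volume.prod volume) := (h4.integrable_comp_emb hemb).2 hF
  have hin : ∀ s : ℝ, ∫ t : ℝ, F (graphPt y₀ e g s t)
      = ∫ x : ℝ, F (y₀ + e * ((x : ℂ) + s * Complex.I)) := by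
    intro s
    exact integral_sub_left_eq_self (fun x : ℝ => F (y₀ + e * ((x : ℂ) + s * Complex.I))) volume
      (g s)
  simp only [hin]
  refine ⟨?_, hint.integral_prod_right⟩
  rw [← h4.integral_comp hemb, Measure.volume_eq_prod, integral_prod_symm _ hint]

end IsStrip
/-- Smooth functions on `(0, T)` descending from a bump near zero to a fixed bump. -/
theorem exists_ramp {T : ℝ} (hT : 0 < T) :
    ∃ (ρ₁ : ℝ → ℝ) (C₁ : ℝ), ContDiff ℝ ∞ ρ₁ ∧ HasCompactSupport ρ₁ ∧ tsupport ρ₁ ⊆ Ioo 0 T ∧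
      (∀ t, |ρ₁ t| ≤ C₁) ∧
      ∀ δ, 0 < δ → δ < T → ∃ ρ θ : ℝ → ℝ, ContDiff ℝ ∞ ρ ∧ HasCompactSupport ρ ∧
        tsupport ρ ⊆ Ioo 0 δ ∧ (∀ t, 0 ≤ ρ t) ∧ ∫ t, ρ t = 1 ∧
        ContDiff ℝ ∞ θ ∧ HasCompactSupport θ ∧ tsupport θ ⊆ Ioo 0 T ∧
        (∀ t, deriv θ t = ρ t - ρ₁ t) ∧ ∀ t, |θ t| ≤ 2 := by
  have bump : ∀ δ : ℝ, 0 < δ → ∃ ρ : ℝ → ℝ, ContDiff ℝ ∞ ρ ∧ HasCompactSupport ρ ∧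
      tsupport ρ = Icc (δ / 4) (3 * δ / 4) ∧ (∀ t, 0 ≤ ρ t) ∧ ∫ t, ρ t = 1 := by
    intro δ hδ
    let f : ContDiffBump (δ / 2) := ⟨δ / 8, δ / 4, by linarith, by linarith⟩
    refine ⟨f.normed volume, f.contDiff_normed, f.hasCompactSupport_normed, ?_,
      f.nonneg_normed, f.integral_normed⟩
    rw [f.tsupport_normed_eq, Real.closedBall_eq_Icc]
    congr 1 <;> simp only [f] <;> ring
  obtain ⟨ρ₁, h1, h2, h3, h4, h5⟩ := bump T hT
  obtain ⟨C₁, hC₁⟩ := h2.exists_bound_of_continuous h1.continuous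
  refine ⟨ρ₁, C₁, h1, h2, ?_, hC₁, ?_⟩
  · rw [h3]
    exact Icc_subset_Ioo (by linarith) (by linarith)
  intro δ hδ hδT
  obtain ⟨ρ, k1, k2, k3, k4, k5⟩ := bump δ hδ
  have i1 : Integrable ρ₁ := h1.continuous.integrable_of_hasCompactSupport h2
  have i2 : Integrable ρ := k1.continuous.integrable_of_hasCompactSupport k2
  have hcd : ContDiff ℝ ∞ fun x => ρ x - ρ₁ x := k1.sub h1
  -- The difference of two bumps of equal mass has a compactly supported primitive: it is zero
  -- before both bumps, and after both of them the masses cancel.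
  set θ : ℝ → ℝ := fun t => ∫ x in (0 : ℝ)..t, (ρ x - ρ₁ x) with hθ
  have hder : ∀ t, HasDerivAt θ (ρ t - ρ₁ t) t := fun t =>
    intervalIntegral.integral_hasDerivAt_right (hcd.continuous.intervalIntegrable _ _)
      (hcd.continuous.stronglyMeasurableAtFilter _ _) hcd.continuous.continuousAt
  have hz1 : ∀ t, t ∉ Icc (T / 4) (3 * T / 4) → ρ₁ t = 0 := fun t ht =>
    image_eq_zero_of_notMem_tsupport (h3 ▸ ht)
  have hz2 : ∀ t, t ∉ Icc (δ / 4) (3 * δ / 4) → ρ t = 0 := fun t ht =>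
    image_eq_zero_of_notMem_tsupport (k3 ▸ ht)
  have hsupp : Function.support θ ⊆ Icc (δ / 4) (3 * T / 4) := by
    intro t ht
    by_contra hcon
    apply ht
    rcases not_and_or.1 hcon with h | h
    · push Not at h
      have : EqOn (fun x => ρ x - ρ₁ x) (fun _ => 0) (uIcc 0 t) := by
        intro x hx
        have hx' : x < δ / 4 := hx.2.trans_lt (max_lt (by linarith) h)
        change ρ x - ρ₁ x = 0
        rw [hz1 x fun hh => by linarith [hh.1], hz2 x fun hh => by linarith [hh.1], sub_zero]
      rw [hθ]
      simp only
      rw [intervalIntegral.integral_congr this]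
      simp
    · push Not at h
      have ht0 : 0 ≤ t := by linarith
      have e : ∀ f : ℝ → ℝ, (∀ x, x ∉ Ioc 0 t → f x = 0) → ∫ x in (0 : ℝ)..t, f x = ∫ x, f x := by
        intro f hf
        rw [intervalIntegral.integral_of_le ht0]
        exact setIntegral_eq_integral_of_forall_compl_eq_zero hf
      rw [hθ]
      simp only
      rw [e _ ?_, integral_sub i2 i1, h5, k5, sub_self]
      intro x hx
      have hx' : ∀ y, 0 < y → ∀ z, z < t → x ∉ Icc y z := fun y hy z hz hh =>
        hx ⟨hy.trans_le hh.1, hh.2.trans hz.le⟩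
      rw [hz1 x (hx' _ (by linarith) _ h), hz2 x (hx' _ (by linarith) _ (by linarith)), sub_zero]
  have hts : tsupport θ ⊆ Icc (δ / 4) (3 * T / 4) := closure_minimal hsupp isClosed_Icc
  refine ⟨ρ, θ, k1, k2, ?_, k4, k5, ?_, ?_, hts.trans (Icc_subset_Ioo (by linarith) (by linarith)),
    fun t => (hder t).deriv, ?_⟩
  · rw [k3]
    exact Icc_subset_Ioo (by linarith) (by linarith)
  · rw [contDiff_infty_iff_deriv]
    refine ⟨fun t => (hder t).differentiableAt, ?_⟩
    rwa [show deriv θ = fun x => ρ x - ρ₁ x from funext fun t => (hder t).deriv]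
  · exact isCompact_Icc.of_isClosed_subset (isClosed_tsupport _) hts
  · intro t
    -- Each of the two primitives is bounded by the total mass `1`, whence the bound `2`, which does
    -- not depend on `δ`.
    have hb : ∀ f : ℝ → ℝ, Integrable f → (∀ x, 0 ≤ f x) → ∫ x, f x = 1 →
        |∫ x in (0 : ℝ)..t, f x| ≤ 1 := by
      intro f hf hf0 hf1
      calc |∫ x in (0 : ℝ)..t, f x| ≤ ∫ x in uIoc 0 t, ‖f x‖ :=
            intervalIntegral.norm_integral_le_integral_norm_uIoc (f := f)
        _ ≤ ∫ x, ‖f x‖ := setIntegral_le_integral hf.norm (ae_of_all _ fun x => norm_nonneg _)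
        _ = 1 := by
            rw [← hf1]
            congr 1
            ext x
            exact Real.norm_of_nonneg (hf0 x)
    rw [hθ]
    simp only
    rw [intervalIntegral.integral_sub i2.intervalIntegrable i1.intervalIntegrable]
    refine (abs_sub _ _).trans ?_
    linarith [hb ρ i2 k4 k5, hb ρ₁ i1 h4 h5]

theorem fderiv_eq_pd {φ : ℂ → ℂ} (y e : ℂ) :
    fderiv ℝ φ y e = e.re * pd 0 φ y + e.im * pd 1 φ y := by
  conv_lhs => rw [← Complex.re_add_im e]
  have : (e.re : ℂ) + e.im * Complex.I = e.re • (1 : ℂ) + e.im • Complex.I := by simp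
  rw [this, map_add, map_smul, map_smul]
  simp [pd]

theorem IsStrip.graphPt_zero_mem {G : Set ℂ} {y₀ e : ℂ} {g : ℝ → ℝ} {a T : ℝ}
    (hS : IsStrip G y₀ e g a T) (hT : 0 < T) {s : ℝ} (hs : s ∈ Ioo (-a) a) :
    graphPt y₀ e g s 0 ∈ closure G := by
  have hc : Continuous fun t => graphPt y₀ e g s t := by
    unfold graphPt
    fun_prop
  refine mem_closure_of_tendsto (b := 𝓝[>] (0 : ℝ))
    ((hc.tendsto 0).mono_left nhdsWithin_le_nhds) ?_
  filter_upwards [Ioo_mem_nhdsGT hT] with t ht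
  exact hS.mem s hs t ht

theorem setIntegral_norm_mul_le {G : Set ℂ} {k Φ : ℂ → ℂ} {C : ℝ}
    (hk : Integrable k (volume.restrict G)) (hΦ : ∀ y, ‖Φ y‖ ≤ C) :
    ‖∫ y in G, k y * Φ y‖ ≤ C * ∫ y in G, ‖k y‖ := by
  rw [← integral_const_mul]
  refine norm_integral_le_of_norm_le (hk.norm.const_mul C) (ae_of_all _ fun y => ?_)
  rw [norm_mul, mul_comm]
  gcongr
  exact hΦ y

theorem norm_stripFun_le {y₀ e : ℂ} {g φ ϑ : ℝ → ℝ} {C M : ℝ} (hC : ∀ s, |φ s| ≤ C)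
    (hM : ∀ t, |ϑ t| ≤ M) (z : ℂ) : ‖stripFun y₀ e g φ ϑ z‖ ≤ C * M := by
  rw [stripFun, Complex.norm_real, Real.norm_eq_abs, abs_mul]
  exact mul_le_mul (hC _) (hM _) (abs_nonneg _) ((abs_nonneg _).trans (hC 0))

/-- The integral of a `W¹`-function along the graph bounding a strip is controlled by its
`W^{1,1}`-norm. -/
theorem IsStrip.exists_trace_bound {G : Set ℂ} {y₀ e : ℂ} {g φ : ℝ → ℝ} {a T : ℝ}
    (hS : IsStrip G y₀ e g a T) (hG : IsOpen G) (hT : 0 < T)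
    (hφ : ContDiff ℝ ∞ φ) (hφc : HasCompactSupport φ) (hφs : tsupport φ ⊆ Ioo (-a) a) :
    ∃ C : ℝ, ∀ w g₁ g₂ : ℂ → ℂ, ContinuousOn w (closure G) →
      IsWeakDeriv G (1, 0) w g₁ → IsWeakDeriv G (0, 1) w g₂ →
      Integrable w (volume.restrict G) → Integrable g₁ (volume.restrict G) →
      Integrable g₂ (volume.restrict G) →
      ‖∫ s, (φ s : ℂ) * w (graphPt y₀ e g s 0)‖
        ≤ C * (∫ y in G, ‖w y‖) + C * (∫ y in G, ‖g₁ y‖) + C * ∫ y in G, ‖g₂ y‖ := by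
  obtain ⟨Cφ, hCφ⟩ := hφc.exists_bound_of_continuous hφ.continuous
  obtain ⟨ρ₁, C₁, hρ₁, hρ₁c, hρ₁s, hC₁, hramp⟩ := exists_ramp hT
  have hCφ0 : 0 ≤ Cφ := (norm_nonneg _).trans (hCφ 0)
  -- `Cφ * C₁` bounds the fixed weight `φ(s) ρ₁(t)` multiplying `w`, and `Cφ * 2` bounds the weight
  -- `φ(s) θ(t)` multiplying the derivatives. Neither depends on the width `δ` of the thin strip.
  refine ⟨max (Cφ * C₁) (Cφ * 2), fun w g₁ g₂ hw hg₁ hg₂ iw i₁ i₂ => ?_⟩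
  set M := max (Cφ * C₁) (Cφ * 2)
  set R := M * (∫ y in G, ‖w y‖) + M * (∫ y in G, ‖g₁ y‖) + M * ∫ y in G, ‖g₂ y‖
  have hφi : Integrable φ := hφ.continuous.integrable_of_hasCompactSupport hφc
  -- The integral along the graph is compared with an average over a thin strip; `η` is the
  -- oscillation of `w` across that strip.
  suffices h : ∀ η : ℝ, 0 < η → ‖∫ s, (φ s : ℂ) * w (graphPt y₀ e g s 0)‖ ≤ R + η * ∫ s, |φ s| by
    have hnn : 0 ≤ ∫ s, |φ s| := integral_nonneg fun s => abs_nonneg _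
    refine le_of_forall_pos_le_add fun η hη => (h (η / (1 + ∫ s, |φ s|)) (by positivity)).trans ?_
    gcongr
    rw [div_mul_eq_mul_div, div_le_iff₀ (by positivity)]
    nlinarith
  intro η hη
  have hmemcl : ∀ p ∈ tsupport φ ×ˢ Icc 0 (T / 2), graphPt y₀ e g p.1 p.2 ∈ closure G := by
    rintro ⟨s, t⟩ ⟨hs, ht⟩
    rcases ht.1.eq_or_lt with h0 | h0
    · simp only at h0
      subst h0
      exact hS.graphPt_zero_mem hT (hφs hs)
    · exact subset_closure (hS.mem s (hφs hs) t ⟨h0, by simp only at ht; linarith [ht.2]⟩)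
  have hwc : ContinuousOn (fun p : ℝ × ℝ => w (graphPt y₀ e g p.1 p.2))
      (tsupport φ ×ˢ Icc 0 (T / 2)) :=
    hw.comp (continuousOn_graphPt y₀ e (hS.smooth.continuousOn.mono hφs) _) hmemcl
  have huc := (hφc.prod isCompact_Icc).uniformContinuousOn_of_continuous hwc
  -- `w` is uniformly continuous on a compact strip reaching the graph, so a bump `ρ` supported in
  -- depths below `δ₀` averages values within `η` of the boundary value.
  obtain ⟨δ₀, hδ₀, hunif⟩ := Metric.uniformContinuousOn_iff.1 huc η hη
  obtain ⟨ρ, θ, hρ, hρc, hρs, hρ0, hρ1, hθ, hθc, hθs, hθd, hθb⟩ :=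
    hramp (min δ₀ (T / 2)) (lt_min hδ₀ (by linarith)) ((min_le_right _ _).trans_lt (by linarith))
  have hρs' : tsupport ρ ⊆ Ioo 0 T := hρs.trans
    (Ioo_subset_Ioo le_rfl ((min_le_right _ _).trans (by linarith)))
  have hGw : ContinuousOn w G := hw.mono subset_closure
  have T₁ := hS.isTest_stripFun hφ hφs hρ₁ hφc hρ₁c hρ₁s
  have Tρ := hS.isTest_stripFun hφ hφs hρ hφc hρc hρs'
  have Tθ := hS.isTest_stripFun hφ hφs hθ hφc hθc hθs
  -- Since `θ' = ρ - ρ₁`, integration by parts along `e` transfers the average near the boundary to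
  -- a fixed average in the interior plus an integral of the derivative of `w` in the direction `e`.
  have hsplit : ∫ y in G, w y * stripFun y₀ e g φ ρ y
      = (∫ y in G, w y * stripFun y₀ e g φ ρ₁ y)
        + (e.re * ∫ y in G, g₁ y * stripFun y₀ e g φ θ y)
        + e.im * ∫ y in G, g₂ y * stripFun y₀ e g φ θ y := by
    have d1 := hg₁.2 _ Tθ
    have d2 := hg₂.2 _ Tθ
    have e1 : mixedPd (1, 0) (stripFun y₀ e g φ θ) = pd 0 (stripFun y₀ e g φ θ) := rfl
    have e2 : mixedPd (0, 1) (stripFun y₀ e g φ θ) = pd 1 (stripFun y₀ e g φ θ) := rfl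
    rw [e1] at d1
    rw [e2] at d2
    have hpt : ∀ y, w y * stripFun y₀ e g φ ρ y = w y * stripFun y₀ e g φ ρ₁ y
        - (e.re * (w y * pd 0 (stripFun y₀ e g φ θ) y)
          + e.im * (w y * pd 1 (stripFun y₀ e g φ θ) y)) := by
      intro y
      have := hS.fderiv_stripFun hφ hφs hθ y
      rw [fderiv_eq_pd] at this
      have h2 : stripFun y₀ e g φ (deriv θ) y
          = stripFun y₀ e g φ ρ y - stripFun y₀ e g φ ρ₁ y := by
        simp only [stripFun, hθd]
        push_cast
        ring
      rw [h2] at this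
      linear_combination w y * this
    have hI : ∀ {Φ : ℂ → ℂ}, IsTest G Φ →
        Integrable (fun y => w y * Φ y) (volume.restrict G) := fun hΦ =>
      (integrable_mul_of_tsupport_subset hG hGw hΦ.smooth.continuous hΦ.compact
        hΦ.supp).integrableOn
    have hadd : Integrable (fun y => e.re * (w y * pd 0 (stripFun y₀ e g φ θ) y)
        + e.im * (w y * pd 1 (stripFun y₀ e g φ θ) y)) (volume.restrict G) :=
      ((hI (Tθ.pd 0)).const_mul _).add ((hI (Tθ.pd 1)).const_mul _)
    simp only [hpt]
    rw [integral_sub (hI T₁) hadd, integral_add ((hI (Tθ.pd 0)).const_mul _) ((hI (Tθ.pd 1)).const_mul _),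
      integral_const_mul, integral_const_mul, d1, d2]
    norm_num
    ring
  have hre : ‖(e.re : ℂ)‖ ≤ 1 := by
    rw [Complex.norm_real, ← hS.norm_e]
    exact Complex.abs_re_le_norm e
  have him : ‖(e.im : ℂ)‖ ≤ 1 := by
    rw [Complex.norm_real, ← hS.norm_e]
    exact Complex.abs_im_le_norm e
  have hR : ‖∫ y in G, w y * stripFun y₀ e g φ ρ y‖ ≤ R := by
    rw [hsplit]
    refine (norm_add₃_le).trans ?_
    rw [norm_mul, norm_mul]
    have n1 := setIntegral_norm_mul_le iw (norm_stripFun_le (y₀ := y₀) (e := e) (g := g) hCφ hC₁)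
    have n2 := setIntegral_norm_mul_le i₁ (norm_stripFun_le (y₀ := y₀) (e := e) (g := g) hCφ hθb)
    have n3 := setIntegral_norm_mul_le i₂ (norm_stripFun_le (y₀ := y₀) (e := e) (g := g) hCφ hθb)
    refine add_le_add (add_le_add (n1.trans ?_) ?_) ?_
    · exact mul_le_mul_of_nonneg_right (le_max_left _ _) (integral_nonneg fun _ => norm_nonneg _)
    · refine (mul_le_of_le_one_left (norm_nonneg _) hre).trans (n2.trans ?_)
      exact mul_le_mul_of_nonneg_right (le_max_right _ _) (integral_nonneg fun _ => norm_nonneg _)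
    · refine (mul_le_of_le_one_left (norm_nonneg _) him).trans (n3.trans ?_)
      exact mul_le_mul_of_nonneg_right (le_max_right _ _) (integral_nonneg fun _ => norm_nonneg _)
  obtain ⟨hfub, hint⟩ := integral_eq_integral_integral_graphPt (y₀ := y₀) (g := g) hS.norm_e
    (integrable_mul_of_tsupport_subset hG hGw Tρ.smooth.continuous Tρ.compact Tρ.supp)
  rw [Tρ.setIntegral_mul, hfub] at hR
  have hz : ∀ s, s ∉ tsupport φ → φ s = 0 := fun s hs => image_eq_zero_of_notMem_tsupport hs
  have hint0 : Integrable fun s => (φ s : ℂ) * w (graphPt y₀ e g s 0) := by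
    have hc : ContinuousOn (fun s => (φ s : ℂ) * w (graphPt y₀ e g s 0)) (tsupport φ) := by
      refine (Complex.continuous_ofReal.comp hφ.continuous).continuousOn.mul ?_
      exact hwc.comp (f := fun s : ℝ => ((s, 0) : ℝ × ℝ)) (by fun_prop)
        fun s hs => ⟨hs, le_rfl, by linarith⟩
    refine (integrableOn_iff_integrable_of_support_subset ?_).1 (hc.integrableOn_compact hφc)
    intro s hs
    by_contra h
    exact hs (by simp [hz s h])
  -- On each vertical segment the boundary value is written as its own average against `ρ`, which
  -- has integral `1`; only the oscillation of `w` is left.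
  have hdiff : ∀ s, ‖(φ s : ℂ) * w (graphPt y₀ e g s 0)
      - ∫ t, w (graphPt y₀ e g s t) * stripFun y₀ e g φ ρ (graphPt y₀ e g s t)‖ ≤ η * |φ s| := by
    intro s
    simp only [stripFun_graphPt hS.norm_e]
    by_cases hs : s ∈ tsupport φ
    · have hρi : Integrable ρ := hρ.continuous.integrable_of_hasCompactSupport hρc
      have hcw : ContinuousOn (fun t => w (graphPt y₀ e g s t)) (tsupport ρ) :=
        hwc.comp (f := fun t : ℝ => ((s, t) : ℝ × ℝ)) (by fun_prop) fun t ht =>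
          ⟨hs, (hρs ht).1.le, ((hρs ht).2.trans_le (min_le_right _ _)).le⟩
      have i3 : Integrable fun t => w (graphPt y₀ e g s t) * ((φ s * ρ t : ℝ) : ℂ) := by
        refine (integrableOn_iff_integrable_of_support_subset (s := tsupport ρ) ?_).1
          ((hcw.mul (Continuous.continuousOn ?_)).integrableOn_compact hρc)
        · intro t ht
          by_contra h
          exact ht (by simp [image_eq_zero_of_notMem_tsupport h])
        · have := hρ.continuous
          fun_prop
      have i4 : Integrable fun t => (φ s : ℂ) * w (graphPt y₀ e g s 0) * (ρ t : ℂ) :=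
        hρi.ofReal.const_mul _
      have e4 : (φ s : ℂ) * w (graphPt y₀ e g s 0)
          = ∫ t, (φ s : ℂ) * w (graphPt y₀ e g s 0) * (ρ t : ℂ) := by
        rw [integral_const_mul, integral_complex_ofReal, hρ1]
        simp
      rw [e4, ← integral_sub i4 i3]
      have e5 : η * |φ s| = ∫ t, η * |φ s| * ρ t := by rw [integral_const_mul, hρ1, mul_one]
      rw [e5]
      refine norm_integral_le_of_norm_le (hρi.const_mul _) (ae_of_all _ fun t => ?_)
      have e6 : (φ s : ℂ) * w (graphPt y₀ e g s 0) * (ρ t : ℂ)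
          - w (graphPt y₀ e g s t) * ((φ s * ρ t : ℝ) : ℂ)
          = ((φ s * ρ t : ℝ) : ℂ) * (w (graphPt y₀ e g s 0) - w (graphPt y₀ e g s t)) := by
        push_cast
        ring
      rw [e6, norm_mul, Complex.norm_real, Real.norm_eq_abs, abs_mul, abs_of_nonneg (hρ0 t)]
      by_cases ht : t ∈ tsupport ρ
      · have h0 := (hρs ht).1
        have h1 := (hρs ht).2.trans_le (min_le_left _ _)
        have h2 := (hρs ht).2.trans_le (min_le_right _ _)
        have := hunif (s, 0) ⟨hs, le_rfl, by linarith⟩ (s, t) ⟨hs, h0.le, h2.le⟩ (by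
          rw [Prod.dist_eq]
          simpa [abs_of_pos h0] using ⟨hδ₀, h1⟩)
        rw [dist_eq_norm] at this
        calc |φ s| * ρ t * ‖w (graphPt y₀ e g s 0) - w (graphPt y₀ e g s t)‖
            ≤ |φ s| * ρ t * η :=
              mul_le_mul_of_nonneg_left this.le (mul_nonneg (abs_nonneg _) (hρ0 t))
          _ = η * |φ s| * ρ t := by ring
      · simp [image_eq_zero_of_notMem_tsupport ht]
    · simp [hz s hs]
  have hfin := norm_integral_le_of_norm_le (hφi.abs.const_mul η) (ae_of_all _ hdiff)
  rw [integral_sub hint0 hint, integral_const_mul] at hfin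
  have := norm_le_norm_add_norm_sub' (∫ s, (φ s : ℂ) * w (graphPt y₀ e g s 0))
    (∫ s, ∫ t, w (graphPt y₀ e g s t) * stripFun y₀ e g φ ρ (graphPt y₀ e g s t))
  linarith
-- Vanishing of functions of zero trace norm
theorem IsWeakDeriv.add {U : Set ℂ} {α : ℕ × ℕ} {u v a b : ℂ → ℂ}
    (hu : MemLp u 2 (volume.restrict U)) (hv : MemLp v 2 (volume.restrict U))
    (ha : IsWeakDeriv U α u a) (hb : IsWeakDeriv U α v b) :
    IsWeakDeriv U α (u + v) (a + b) := by
  refine ⟨ha.1.add hb.1, fun φ hφ => ?_⟩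
  have hn := mixedPd_nice α hφ.smooth hφ.compact
  simp only [Pi.add_apply, add_mul]
  rw [integral_add (integrable_mul_nice hu hn.1 hn.2) (integrable_mul_nice hv hn.1 hn.2),
    integral_add (integrable_mul_nice ha.1 hφ.smooth hφ.compact)
      (integrable_mul_nice hb.1 hφ.smooth hφ.compact), ha.2 φ hφ, hb.2 φ hφ, mul_add]

theorem eLpNorm_weakDeriv_le (k : ℕ) (U : Set ℂ) (u : ℂ → ℂ) {α : ℕ × ℕ} (hα : α.1 + α.2 ≤ k) :
    eLpNorm (weakDeriv U α u) 2 (volume.restrict U) ≤ sobolevNorm k U u := by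
  rw [eLpNorm_eq_lintegral_rpow_enorm_toReal (by norm_num) (by norm_num), sobolevNorm]
  simp only [ENNReal.toReal_ofNat, ENNReal.rpow_ofNat]
  refine ENNReal.rpow_le_rpow ?_ (by norm_num)
  refine Finset.single_le_sum (f := fun α => ∫⁻ y in U, ‖weakDeriv U α u y‖ₑ ^ 2)
    (fun _ _ => zero_le) ?_
  rw [Finset.mem_biUnion]
  exact ⟨α.1 + α.2, Finset.mem_range.2 (by omega), Finset.HasAntidiagonal.mem_antidiagonal.2 rfl⟩

/-- A function of zero trace norm is the limit of the restrictions of continuous functions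
that tend to zero in `W¹`. -/
theorem exists_seq_of_traceNorm_eq_zero {G Γ : Set ℂ} (hG : IsOpen G) {ψ : ℂ → ℂ}
    (h : traceNorm 2 G Γ ψ = 0) :
    MemLp ψ 2 (arcLength Γ) ∧ ∃ (w : ℕ → ℂ → ℂ) (g : Fin 2 → ℕ → ℂ → ℂ),
      (∀ n, ContinuousOn (w n) (closure G)) ∧ (∀ n, MemLp (w n) 2 (volume.restrict G)) ∧
      (∀ i n, IsWeakDeriv G (if i = 0 then (1, 0) else (0, 1)) (w n) (g i n)) ∧
      Tendsto (fun n => eLpNorm (w n - ψ) 2 (arcLength Γ)) atTop (𝓝 0) ∧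
      Tendsto (fun n => eLpNorm (w n) 2 (volume.restrict G)) atTop (𝓝 0) ∧
      ∀ i, Tendsto (fun n => eLpNorm (g i n) 2 (volume.restrict G)) atTop (𝓝 0) := by
  have step : ∀ ε : ℝ≥0∞, 0 < ε → MemLp ψ 2 (arcLength Γ) ∧ ∃ (w : ℂ → ℂ) (g : Fin 2 → ℂ → ℂ),
      ContinuousOn w (closure G) ∧ MemLp w 2 (volume.restrict G) ∧
      (∀ i : Fin 2, IsWeakDeriv G (if i = 0 then (1, 0) else (0, 1)) w (g i)) ∧
      eLpNorm (w - ψ) 2 (arcLength Γ) ≤ ε ∧ eLpNorm w 2 (volume.restrict G) ≤ ε + ε ∧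
      ∀ i, eLpNorm (g i) 2 (volume.restrict G) ≤ ε + ε := by
    intro ε hε
    -- The zero in `0 < ε` is replaced by the infimum, which yields an extension `u` of `ψ` with
    -- `W²`-norm below `ε`.
    rw [← h, traceNorm] at hε
    simp only [iInf_lt_iff] at hε
    obtain ⟨u, ⟨hu, hψ, v, hv, hv1, hv2⟩, hlt⟩ := hε
    have hε : 0 < ε := (zero_le).trans_lt hlt
    obtain ⟨m, hm1, hm2⟩ := ((hv1.eventually (ge_mem_nhds hε)).and
      (hv2.eventually (ge_mem_nhds hε))).exists
    have hd : v m - u ∈ sobolev 1 G := by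
      refine (sobolev 1 G).sub_mem (hv m).1 ⟨hu.1, fun α hα => hu.2 α (hα.trans one_le_two)⟩
    -- `v m` is within `ε` of `u` in `W¹` and `u` has norm below `ε`; hence the bound `ε + ε`. Index
    -- `(0, 0)` covers the function itself.
    have key : ∀ α : ℕ × ℕ, α.1 + α.2 ≤ 1 →
        IsWeakDeriv G α (v m) (weakDeriv G α (v m - u) + weakDeriv G α u) ∧
        eLpNorm (weakDeriv G α (v m - u) + weakDeriv G α u) 2 (volume.restrict G) ≤ ε + ε := by
      intro α hα
      have w1 := isWeakDeriv_weakDeriv (hd.2 α hα)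
      have w2 := isWeakDeriv_weakDeriv (hu.2 α (hα.trans one_le_two))
      have := IsWeakDeriv.add hd.1 hu.1 w1 w2
      rw [sub_add_cancel] at this
      refine ⟨this, (eLpNorm_add_le w1.1.1 w2.1.1 one_le_two).trans (add_le_add ?_ ?_)⟩
      · exact (eLpNorm_weakDeriv_le 1 G _ hα).trans hm1
      · exact (eLpNorm_weakDeriv_le 2 G _ (hα.trans one_le_two)).trans hlt.le
    refine ⟨hψ, v m, fun i => weakDeriv G (if i = 0 then (1, 0) else (0, 1)) (v m - u)
      + weakDeriv G (if i = 0 then (1, 0) else (0, 1)) u, (hv m).2, (hv m).1.1, ?_, hm2, ?_, ?_⟩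
    · intro i
      exact (key _ (by split_ifs <;> simp)).1
    · have h0 := key (0, 0) (by simp)
      have hae := (isWeakDeriv_zero_zero (hv m).1.1).ae_eq hG h0.1
      rw [eLpNorm_congr_ae hae]
      exact h0.2
    · intro i
      exact (key _ (by split_ifs <;> simp)).2
  refine ⟨(step 1 one_pos).1, ?_⟩
  have hpos : ∀ n : ℕ, (0 : ℝ≥0∞) < (n + 1 : ℝ≥0∞)⁻¹ := fun n =>
    ENNReal.inv_pos.2 (by simp)
  choose _ w g h1 h2 h3 h4 h5 h6 using fun n : ℕ => step _ (hpos n)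
  have ht : Tendsto (fun n : ℕ => (n + 1 : ℝ≥0∞)⁻¹) atTop (𝓝 0) := by
    have := (tendsto_add_atTop_iff_nat 1).2 ENNReal.tendsto_inv_nat_nhds_zero
    simpa using this
  have ht2 : Tendsto (fun n : ℕ => (n + 1 : ℝ≥0∞)⁻¹ + (n + 1 : ℝ≥0∞)⁻¹) atTop (𝓝 0) := by
    simpa using ht.add ht
  exact ⟨w, fun i n => g n i, h1, h2, fun i n => h3 n i,
    tendsto_of_tendsto_of_tendsto_of_le_of_le tendsto_const_nhds ht (fun _ => zero_le) h4,
    tendsto_of_tendsto_of_tendsto_of_le_of_le tendsto_const_nhds ht2 (fun _ => zero_le) h5,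
    fun i => tendsto_of_tendsto_of_tendsto_of_le_of_le tendsto_const_nhds ht2
      (fun _ => zero_le) fun n => h6 n i⟩

theorem tendsto_integral_norm_of_eLpNorm {α : Type*} [MeasurableSpace α] {μ : Measure α}
    [IsFiniteMeasure μ] {f : ℕ → α → ℂ} (hf : ∀ n, MemLp (f n) 2 μ)
    (h : Tendsto (fun n => eLpNorm (f n) 2 μ) atTop (𝓝 0)) :
    Tendsto (fun n => ∫ y, ‖f n y‖ ∂μ) atTop (𝓝 0) := by
  have h1 : Tendsto (fun n => eLpNorm (f n) 1 μ) atTop (𝓝 0) := by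
    have hb : ∀ n, eLpNorm (f n) 1 μ
        ≤ eLpNorm (f n) 2 μ * μ univ ^ (1 / (1 : ℝ≥0∞).toReal - 1 / (2 : ℝ≥0∞).toReal) := fun n =>
      eLpNorm_le_eLpNorm_mul_rpow_measure_univ one_le_two (hf n).1
    have hlim := ENNReal.Tendsto.mul_const (b := μ univ ^ (1 / (1 : ℝ≥0∞).toReal
      - 1 / (2 : ℝ≥0∞).toReal)) h (Or.inr (ENNReal.rpow_ne_top_of_nonneg (by norm_num)
        (measure_ne_top _ _)))
    rw [zero_mul] at hlim
    exact tendsto_of_tendsto_of_tendsto_of_le_of_le tendsto_const_nhds hlim (fun _ => zero_le) hb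
  have h2 := (ENNReal.tendsto_toReal ENNReal.zero_ne_top).comp h1
  rw [ENNReal.toReal_zero] at h2
  refine h2.congr fun n => ?_
  rw [Function.comp_apply, eLpNorm_one_eq_lintegral_enorm,
    integral_norm_eq_lintegral_enorm (hf n).1]

/-- The projection `frameS` is 1-Lipschitz and inverts the parametrization, so arc length dominates
the parameter measure. Convergence in `L₂` on the curve therefore pulls back to the parameter
interval. -/
theorem map_graphPt_le {G Γ : Set ℂ} {y₀ e : ℂ} {g : ℝ → ℝ} {a T : ℝ}
    (hS : IsStrip G y₀ e g a T) (hΓ : ∀ s ∈ Ioo (-a) a, graphPt y₀ e g s 0 ∈ Γ)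
    (hm : AEMeasurable (fun s => graphPt y₀ e g s 0) (volume.restrict (Ioo (-a) a))) :
    (volume.restrict (Ioo (-a) a)).map (fun s => graphPt y₀ e g s 0) ≤ arcLength Γ := by
  refine Measure.le_iff.2 fun B hB => ?_
  rw [Measure.map_apply_of_aemeasurable hm hB, Measure.restrict_apply' measurableSet_Ioo,
    arcLength, Measure.restrict_apply hB]
  set A := (fun s => graphPt y₀ e g s 0) ⁻¹' B ∩ Ioo (-a) a
  have hL : LipschitzWith 1 (frameS y₀ e) := by
    refine LipschitzWith.of_dist_le_mul fun x y => ?_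
    rw [NNReal.coe_one, one_mul, Real.dist_eq, frameS, frameS, ← Complex.sub_im, ← mul_sub,
      sub_sub_sub_cancel_right, dist_eq_norm]
    refine (Complex.abs_im_le_norm _).trans ?_
    rw [norm_mul, RCLike.norm_conj, hS.norm_e, one_mul]
  calc volume A = μH[1] A := by rw [hausdorffMeasure_real]
    _ ≤ μH[1] (frameS y₀ e '' ((fun s => graphPt y₀ e g s 0) '' A)) := by
        refine measure_mono fun s hs => ⟨_, ⟨s, hs, rfl⟩, frameS_graphPt hS.norm_e g s 0⟩
    _ ≤ μH[1] ((fun s => graphPt y₀ e g s 0) '' A) := by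
        simpa using hL.hausdorffMeasure_image_le zero_le_one _
    _ ≤ μH[1] (B ∩ Γ) := by
        refine measure_mono ?_
        rintro _ ⟨s, hs, rfl⟩
        exact ⟨hs.1, hΓ s hs.2⟩

/-- The converse comparison, needed only for null sets: the parametrization of a Lipschitz graph is
Lipschitz. -/
theorem hausdorff_image_graphPt_eq_zero {y₀ e : ℂ} (he : ‖e‖ = 1) {g : ℝ → ℝ} {I A : Set ℝ}
    {K : ℝ≥0} (hg : LipschitzOnWith K g I) (hA : A ⊆ I) (h0 : volume A = 0) :
    μH[1] ((fun s => graphPt y₀ e g s 0) '' A) = 0 := by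
  have hL : LipschitzOnWith (K + 1) (fun s => graphPt y₀ e g s 0) A := by
    refine LipschitzOnWith.of_dist_le_mul fun x hx y hy => ?_
    have h1 := hg.dist_le_mul x (hA hx) y (hA hy)
    have h2 : graphPt y₀ e g x 0 - graphPt y₀ e g y 0
        = e * ((g x - g y : ℝ) + (x - y : ℝ) * Complex.I) := by
      simp only [graphPt]
      push_cast
      ring
    rw [dist_eq_norm, h2, norm_mul, he, one_mul]
    refine (norm_add_le _ _).trans ?_
    rw [norm_mul, Complex.norm_I, mul_one, Complex.norm_real, Complex.norm_real]
    rw [Real.dist_eq (x := g x)] at h1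
    rw [Real.dist_eq]
    push_cast
    simp only [Real.norm_eq_abs]
    rw [Real.dist_eq] at h1
    linarith
  refine le_antisymm ((hL.hausdorffMeasure_image_le zero_le_one).trans ?_) zero_le
  rw [hausdorffMeasure_real, h0, mul_zero]

/-- A function of zero trace norm vanishes almost everywhere on a smooth boundary curve. -/
theorem ae_eq_zero_of_traceNorm_eq_zero {G Γ : Set ℂ} (hG : IsOpen G)
    (hGb : Bornology.IsBounded G) (hΓo : ∃ V : Set ℂ, IsOpen V ∧ Γ = V ∩ frontier G)
    (hΓs : ∀ y ∈ Γ, ∃ V : Set ℂ, IsOpen V ∧ y ∈ V ∧ ∃ h : ℂ → ℝ,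
      ContDiffOn ℝ ∞ h V ∧ (∀ z ∈ V, fderiv ℝ h z ≠ 0) ∧ G ∩ V = {z ∈ V | h z < 0})
    {ψ : ℂ → ℂ} (hψ0 : traceNorm 2 G Γ ψ = 0) : ∀ᵐ y ∂(arcLength Γ), ψ y = 0 := by
  obtain ⟨hψ, w, k, hwc, hw2, hk, hwψ, hw0, hk0⟩ := exists_seq_of_traceNorm_eq_zero hG hψ0
  have hfin : IsFiniteMeasure (volume.restrict G) :=
    ⟨by rw [Measure.restrict_apply_univ]; exact hGb.measure_lt_top⟩
  obtain ⟨V₁, hV₁, rfl⟩ := hΓo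
  have hΓm : MeasurableSet (V₁ ∩ frontier G) :=
    hV₁.measurableSet.inter isClosed_frontier.measurableSet
  rw [arcLength, ae_restrict_iff' hΓm, ae_iff]
  have hset : {y | ¬(y ∈ V₁ ∩ frontier G → ψ y = 0)} = V₁ ∩ frontier G ∩ {y | ψ y ≠ 0} := by
    ext y
    simp only [mem_ofPred_eq, mem_inter_iff, Classical.not_imp, ne_eq]
  rw [hset]
  -- The curve may require infinitely many graphs; the plane is second countable, so a neighbourhood
  -- of each point suffices.
  refine measure_null_of_locally_null _ ?_
  rintro y ⟨hyΓ, -⟩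
  obtain ⟨V, hV, hyV, h, hh, hd, hGV⟩ := hΓs y hyΓ
  have hmemG : ∀ z ∈ V, z ∈ G ↔ h z < 0 := by
    intro z hz
    constructor
    · intro hzG
      have : z ∈ G ∩ V := ⟨hzG, hz⟩
      rw [hGV] at this
      exact this.2
    · intro hzh
      have : z ∈ {z ∈ V | h z < 0} := ⟨hz, hzh⟩
      rw [← hGV] at this
      exact this.1
  -- A frontier point is not in the open set `G`, so `h ≥ 0` there; `h > 0` would keep a whole
  -- neighbourhood away from `G`.
  have hyfr : ∀ z ∈ V, z ∈ frontier G → h z = 0 := by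
    intro z hz hzf
    rw [hG.frontier_eq] at hzf
    refine le_antisymm ?_ (not_lt.1 fun hlt => hzf.2 ((hmemG z hz).2 hlt))
    by_contra! hpos
    have hc : ContinuousAt h z := hh.continuousOn.continuousAt (hV.mem_nhds hz)
    obtain ⟨x, ⟨hx1, hx2⟩, hx3⟩ := mem_closure_iff_nhds.1 hzf.1 _
      (inter_mem (hV.mem_nhds hz) (hc.eventually (lt_mem_nhds hpos)))
    exact lt_asymm hx2 ((hmemG x hx1).1 hx3)
  obtain ⟨e, g, a, T, K, he, ha, hT, hgs, hgL, hqV, hqneg, hq0, W, hW, hWq⟩ :=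
    exists_local_graph (hV.inter hV₁) (hh.mono inter_subset_left) ⟨hyV, hyΓ.1⟩
      (hyfr y hyV hyΓ.2) (hd y hyV)
  have hS : IsStrip G y e g a T :=
    ⟨he, hgs, fun s hs t ht => (hmemG _ (hqV s hs t ⟨ht.1.le, ht.2⟩).1).2 (hqneg s hs t ht)⟩
  have hγΓ : ∀ s ∈ Ioo (-a) a, graphPt y e g s 0 ∈ V₁ ∩ frontier G := by
    intro s hs
    have hv := hqV s hs 0 ⟨le_rfl, hT⟩
    refine ⟨hv.2, ?_⟩
    rw [hG.frontier_eq]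
    exact ⟨hS.graphPt_zero_mem hT hs, fun hmem => by
      have := (hmemG _ hv.1).1 hmem
      rw [hq0 s hs] at this
      exact lt_irrefl _ this⟩
  set γ : ℝ → ℂ := fun s => graphPt y e g s 0 with hγ
  set ν : Measure ℝ := volume.restrict (Ioo (-a) a) with hν
  have hγc : ContinuousOn γ (Ioo (-a) a) :=
    (continuousOn_graphPt y e hgs.continuousOn {0}).comp (f := fun s : ℝ => ((s, 0) : ℝ × ℝ))
      (by fun_prop) fun s hs => ⟨hs, rfl⟩
  have hγm : AEMeasurable γ ν := hγc.aemeasurable measurableSet_Ioo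
  have hmap : ν.map γ ≤ arcLength (V₁ ∩ frontier G) := map_graphPt_le hS hγΓ hγm
  have hψmap : MemLp ψ 2 (ν.map γ) := hψ.mono_measure hmap
  have hψγ : MemLp (ψ ∘ γ) 2 ν := (memLp_map_measure_iff hψmap.1 hγm).1 hψmap
  have hwm : ∀ n, AEStronglyMeasurable (w n) (ν.map γ) := by
    intro n
    have h1 : AEStronglyMeasurable (w n) ((μH[1] : Measure ℂ).restrict (closure G)) :=
      (hwc n).aestronglyMeasurable isClosed_closure.measurableSet
    refine AEStronglyMeasurable.mono_measure (h1.mono_set ?_) hmap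
    exact inter_subset_right.trans frontier_subset_closure
  have hdiff : ∀ n, eLpNorm (w n ∘ γ - ψ ∘ γ) 2 ν ≤ eLpNorm (w n - ψ) 2 (arcLength (V₁ ∩ frontier G)) := by
    intro n
    have : w n ∘ γ - ψ ∘ γ = (w n - ψ) ∘ γ := rfl
    rw [this, ← eLpNorm_map_measure ((hwm n).sub hψmap.1) hγm]
    exact eLpNorm_mono_measure _ hmap
  have hνfin : IsFiniteMeasure ν := ⟨by simp [hν]⟩
  have hd0 : Tendsto (fun n => eLpNorm (w n ∘ γ - ψ ∘ γ) 2 ν) atTop (𝓝 0) :=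
    tendsto_of_tendsto_of_tendsto_of_le_of_le tendsto_const_nhds hwψ (fun _ => zero_le) hdiff
  -- The first norms of `w n - ψ` along the curve may be infinite; the sequence is used from an
  -- index after which they are finite.
  obtain ⟨n₀, hn₀⟩ := eventually_atTop.1 (hd0.eventually (gt_mem_nhds ENNReal.zero_lt_top))
  have hdm : ∀ n, MemLp (w (n + n₀) ∘ γ - ψ ∘ γ) 2 ν := fun n =>
    ⟨((hwm _).comp_aemeasurable hγm).sub hψγ.1, hn₀ _ (by omega)⟩
  have hd1 := tendsto_integral_norm_of_eLpNorm hdm ((tendsto_add_atTop_iff_nat n₀).2 hd0)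
  have hI : ∀ {f : ℂ → ℂ}, MemLp f 2 (volume.restrict G) → Integrable f (volume.restrict G) :=
    fun hf => hf.integrable one_le_two
  -- The integral of `φ ψ` is that of `φ w_n`, which tends to zero by the trace bound, minus that of
  -- `φ (w_n - ψ)`, which tends to zero by convergence on the curve.
  have hL : ∀ φ : ℝ → ℝ, ContDiff ℝ ∞ φ → HasCompactSupport φ → tsupport φ ⊆ Ioo (-a) a →
      ∫ s, φ s • (ψ ∘ γ) s = 0 := by
    intro φ hφ hφc hφs
    obtain ⟨C, hC⟩ := hS.exists_trace_bound hG hT hφ hφc hφs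
    obtain ⟨M, hM⟩ := hφc.exists_bound_of_continuous hφ.continuous
    have hM0 : 0 ≤ M := (norm_nonneg _).trans (hM 0)
    have hset : ∀ f : ℝ → ℂ, ∫ s, (φ s : ℂ) * f s = ∫ s, (φ s : ℂ) * f s ∂ν := fun f =>
      (setIntegral_eq_integral_of_forall_compl_eq_zero fun s hs => by
        simp [image_eq_zero_of_notMem_tsupport fun hh => hs (hφs hh)]).symm
    have hφb : ∀ {f : ℝ → ℂ}, Integrable f ν → Integrable (fun s => (φ s : ℂ) * f s) ν := by
      intro f hf
      refine hf.bdd_mul (c := M) ?_ (ae_of_all _ fun s => by simpa using hM s)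
      exact (Complex.continuous_ofReal.comp hφ.continuous).aestronglyMeasurable
    have hbound : ∀ n, ‖∫ s, (φ s : ℂ) * ψ (γ s)‖
        ≤ (C * (∫ y in G, ‖w (n + n₀) y‖) + C * (∫ y in G, ‖k 0 (n + n₀) y‖)
          + C * ∫ y in G, ‖k 1 (n + n₀) y‖) + M * ∫ s, ‖(w (n + n₀) ∘ γ - ψ ∘ γ) s‖ ∂ν := by
      intro n
      have b1 := hC (w (n + n₀)) (k 0 (n + n₀)) (k 1 (n + n₀)) (hwc _)
        (by simpa using hk 0 (n + n₀)) (by simpa using hk 1 (n + n₀)) (hI (hw2 _))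
        (hI (hk 0 _).1) (hI (hk 1 _).1)
      have b2 : ‖∫ s, (φ s : ℂ) * (w (n + n₀) ∘ γ - ψ ∘ γ) s ∂ν‖
          ≤ M * ∫ s, ‖(w (n + n₀) ∘ γ - ψ ∘ γ) s‖ ∂ν := by
        rw [← integral_const_mul]
        refine norm_integral_le_of_norm_le (((hdm n).integrable one_le_two).norm.const_mul M)
          (ae_of_all _ fun s => ?_)
        rw [norm_mul]
        gcongr
        simpa using hM s
      have iψ := hψγ.integrable one_le_two
      have id := (hdm n).integrable one_le_two
      have e1 : ∫ s, (φ s : ℂ) * ψ (γ s) = (∫ s, (φ s : ℂ) * w (n + n₀) (graphPt y e g s 0))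
          - ∫ s, (φ s : ℂ) * (w (n + n₀) ∘ γ - ψ ∘ γ) s ∂ν := by
        rw [hset, hset]
        have e2 : ∀ s, (φ s : ℂ) * w (n + n₀) (graphPt y e g s 0)
            = (φ s : ℂ) * (w (n + n₀) ∘ γ - ψ ∘ γ) s + (φ s : ℂ) * (ψ ∘ γ) s := by
          intro s
          simp only [Pi.sub_apply, Function.comp_apply, hγ]
          ring
        simp only [e2]
        rw [integral_add (hφb id) (hφb iψ), add_sub_cancel_left]
        rfl
      rw [e1]
      exact (norm_sub_le _ _).trans (add_le_add b1 b2)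
    have hlim : ∀ {f : ℕ → ℂ → ℂ}, (∀ n, MemLp (f n) 2 (volume.restrict G)) →
        Tendsto (fun n => eLpNorm (f n) 2 (volume.restrict G)) atTop (𝓝 0) →
        Tendsto (fun n => C * ∫ y in G, ‖f (n + n₀) y‖) atTop (𝓝 0) := by
      intro f hf hf0
      simpa using ((tendsto_add_atTop_iff_nat n₀).2
        (tendsto_integral_norm_of_eLpNorm hf hf0)).const_mul C
    have hR := (((hlim hw2 hw0).add (hlim (fun n => (hk 0 n).1) (hk0 0))).add
      (hlim (fun n => (hk 1 n).1) (hk0 1))).add (hd1.const_mul M)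
    simp only [add_zero, mul_zero] at hR
    have hle := ge_of_tendsto' hR hbound
    have := norm_le_zero_iff.1 hle
    simpa only [Complex.real_smul, Function.comp_apply] using this
  have hae := isOpen_Ioo.ae_eq_zero_of_integral_contDiff_smul_eq_zero (μ := volume)
    (f := ψ ∘ γ) (U := Ioo (-a) a)
    (IntegrableOn.locallyIntegrableOn (hψγ.integrable one_le_two)) hL
  refine ⟨W ∩ V ∩ (V₁ ∩ frontier G ∩ {y | ψ y ≠ 0}), ?_, ?_⟩
  · exact inter_mem (mem_nhdsWithin_of_mem_nhds (inter_mem hW (hV.mem_nhds hyV))) self_mem_nhdsWithin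
  -- In the neighbourhood `W ∩ V` every frontier point is on the graph, so the bad points form the
  -- image of a null set of parameters.
  · refine measure_mono_null ?_ (hausdorff_image_graphPt_eq_zero (y₀ := y) he hgL
      (A := {s ∈ Ioo (-a) a | ψ (γ s) ≠ 0}) (fun s hs => hs.1) ?_)
    · rintro z ⟨⟨hzW, hzV⟩, ⟨hz1, hz2⟩, hz3⟩
      obtain ⟨s, hs, rfl⟩ := hWq z hzW (hyfr z hzV hz2)
      exact ⟨s, ⟨hs, hz3⟩, rfl⟩
    · rw [ae_iff] at hae
      convert hae using 2
      ext s
      simp [and_assoc]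
/-! ### Power-logarithmic functions at a corner -/

/-- The function `r^a (log r f(ω) + h(ω))` in the logarithmic variable `ζ = log r + i ω`. -/
def powLog (a : ℂ) (f h : ℝ → ℂ) (ζ : ℂ) : ℂ :=
  Complex.exp (a * ζ.re) * (ζ.re * f ζ.im + h ζ.im)

/-- The logarithmic variable at the corner `c` whose bisector has direction `θ`. -/
def cornerLog (c : ℂ) (θ : ℝ) (y : ℂ) : ℂ := Complex.log (Complex.exp (-(θ * Complex.I)) * (y - c))

/-- The plane slit along the ray opposite to the bisector. -/
def cornerSlit (c : ℂ) (θ : ℝ) : Set ℂ :=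
  {y | Complex.exp (-(θ * Complex.I)) * (y - c) ∈ Complex.slitPlane}

/-- The function `r^a (log r f(ω) + h(ω))` in polar coordinates at the corner `c`. -/
def cornerFun (c : ℂ) (θ : ℝ) (a : ℂ) (f h : ℝ → ℂ) (y : ℂ) : ℂ := powLog a f h (cornerLog c θ y)

/-- The radial unit vector. -/
def dirE (θ t : ℝ) : Fin 2 → ℂ := ![(Real.cos (t + θ) : ℂ), (Real.sin (t + θ) : ℂ)]

/-- The angular unit vector. -/
def dirN (θ t : ℝ) : Fin 2 → ℂ := ![(-Real.sin (t + θ) : ℂ), (Real.cos (t + θ) : ℂ)]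

/-- Differentiating `r^a f(ω)` along the `i`-th axis gives `r^{a-1}` times `stepF θ a i f`. -/
def stepF (θ : ℝ) (a : ℂ) (i : Fin 2) (f : ℝ → ℂ) (t : ℝ) : ℂ :=
  dirE θ t i * (a * f t) + dirN θ t i * deriv f t

/-- The part without logarithm of `r^{1-a} ∂_i (r^a (log r f + h))`. -/
def stepH (θ : ℝ) (a : ℂ) (i : Fin 2) (f h : ℝ → ℂ) (t : ℝ) : ℂ :=
  dirE θ t i * (f t + a * h t) + dirN θ t i * deriv h t

theorem contDiff_dirE (θ : ℝ) (i : Fin 2) : ContDiff ℝ ∞ fun t => dirE θ t i := by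
  have h1 : ContDiff ℝ ∞ fun t : ℝ => t + θ := contDiff_id.add contDiff_const
  fin_cases i
  · exact Complex.ofRealCLM.contDiff.comp (Real.contDiff_cos.comp h1)
  · exact Complex.ofRealCLM.contDiff.comp (Real.contDiff_sin.comp h1)

theorem hasDerivAt_dirE (θ t : ℝ) (i : Fin 2) :
    HasDerivAt (fun t => dirE θ t i) (dirN θ t i) t := by
  have h1 : HasDerivAt (fun t : ℝ => t + θ) 1 t := (hasDerivAt_id t).add_const θ
  fin_cases i
  · simpa [dirE, dirN] using h1.cos.ofReal_comp
  · simpa [dirE, dirN] using h1.sin.ofReal_comp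

theorem hasDerivAt_dirN (θ t : ℝ) (i : Fin 2) :
    HasDerivAt (fun t => dirN θ t i) (-dirE θ t i) t := by
  have h1 : HasDerivAt (fun t : ℝ => t + θ) 1 t := (hasDerivAt_id t).add_const θ
  fin_cases i
  · simpa [dirE, dirN] using h1.sin.ofReal_comp.fun_neg
  · simpa [dirE, dirN] using h1.cos.ofReal_comp

theorem contDiff_dirN (θ : ℝ) (i : Fin 2) : ContDiff ℝ ∞ fun t => dirN θ t i := by
  have h1 : ContDiff ℝ ∞ fun t : ℝ => t + θ := contDiff_id.add contDiff_const
  fin_cases i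
  · exact (Complex.ofRealCLM.contDiff.comp (Real.contDiff_sin.comp h1)).neg
  · exact Complex.ofRealCLM.contDiff.comp (Real.contDiff_cos.comp h1)

theorem contDiff_stepF (θ : ℝ) (a : ℂ) (i : Fin 2) {n : ℕ} {f : ℝ → ℂ}
    (hf : ContDiff ℝ (n + 1) f) : ContDiff ℝ n (stepF θ a i f) := by
  have hn : (n : WithTop ℕ∞) ≤ (∞ : WithTop ℕ∞) := by norm_cast; exact le_top
  exact (((contDiff_dirE θ i).of_le hn).mul (contDiff_const.mul (hf.of_le (by norm_cast; omega)))).add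
    (((contDiff_dirN θ i).of_le hn).mul ((contDiff_succ_iff_deriv.1 hf).2.2))

theorem contDiff_stepH (θ : ℝ) (a : ℂ) (i : Fin 2) {n : ℕ} {f h : ℝ → ℂ}
    (hf : ContDiff ℝ n f) (hh : ContDiff ℝ (n + 1) h) : ContDiff ℝ n (stepH θ a i f h) := by
  have hn : (n : WithTop ℕ∞) ≤ (∞ : WithTop ℕ∞) := by norm_cast; exact le_top
  exact (((contDiff_dirE θ i).of_le hn).mul
    (hf.add (contDiff_const.mul (hh.of_le (by norm_cast; omega))))).add
    (((contDiff_dirN θ i).of_le hn).mul ((contDiff_succ_iff_deriv.1 hh).2.2))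

/-- The symbol of `∂_k ∂_i` on `r^a f(ω)`. -/
theorem stepF_stepF (θ : ℝ) (a : ℂ) (i k : Fin 2) {f : ℝ → ℂ} (hf : ContDiff ℝ 2 f) (t : ℝ) :
    stepF θ (a - 1) k (stepF θ a i f) t
      = dirE θ t k * dirE θ t i * (a * (a - 1) * f t)
        + (dirE θ t k * dirN θ t i + dirN θ t k * dirE θ t i) * ((a - 1) * deriv f t)
        + dirN θ t k * dirN θ t i * (deriv (deriv f) t + a * f t) := by
  have h1 : HasDerivAt f (deriv f t) t := (hf.differentiable two_ne_zero t).hasDerivAt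
  have h2 : HasDerivAt (deriv f) (deriv (deriv f) t) t :=
    ((contDiff_succ_iff_deriv (n := 1)).1 (by simpa [one_add_one_eq_two] using hf)).2.2.differentiable
      one_ne_zero t |>.hasDerivAt
  have h3 := ((hasDerivAt_dirE θ t i).mul (h1.const_mul a)).add ((hasDerivAt_dirN θ t i).mul h2)
  have h4 : deriv (stepF θ a i f) t = _ := h3.deriv
  rw [stepF, h4, stepF]
  ring

/-- Since `r^a log r` is the derivative of `r^a` in `a`, the terms with `f` are the `a`-derivatives
of the coefficients in `stepF_stepF`: `2a - 1`, `1` and `1`. -/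
theorem stepH_stepH (θ : ℝ) (a : ℂ) (i k : Fin 2) {f h : ℝ → ℂ} (hf : ContDiff ℝ 2 f)
    (hh : ContDiff ℝ 2 h) (t : ℝ) :
    stepH θ (a - 1) k (stepF θ a i f) (stepH θ a i f h) t
      = dirE θ t k * dirE θ t i * (a * (a - 1) * h t + (2 * a - 1) * f t)
        + (dirE θ t k * dirN θ t i + dirN θ t k * dirE θ t i) * ((a - 1) * deriv h t + deriv f t)
        + dirN θ t k * dirN θ t i * (deriv (deriv h) t + a * h t + f t) := by
  have h0 : HasDerivAt f (deriv f t) t := (hf.differentiable two_ne_zero t).hasDerivAt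
  have h1 : HasDerivAt h (deriv h t) t := (hh.differentiable two_ne_zero t).hasDerivAt
  have h2 : HasDerivAt (deriv h) (deriv (deriv h) t) t :=
    ((contDiff_succ_iff_deriv (n := 1)).1 (by simpa [one_add_one_eq_two] using hh)).2.2.differentiable
      one_ne_zero t |>.hasDerivAt
  have h3 := ((hasDerivAt_dirE θ t i).mul (h0.add (h1.const_mul a))).add
    ((hasDerivAt_dirN θ t i).mul h2)
  have h4 : deriv (stepH θ a i f h) t = _ := h3.deriv
  rw [stepH, h4, stepF, stepH]
  simp only [Pi.add_apply]
  ring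

theorem contDiff_powLog (a : ℂ) {n : ℕ} {f h : ℝ → ℂ} (hf : ContDiff ℝ n f)
    (hh : ContDiff ℝ n h) : ContDiff ℝ n (powLog a f h) := by
  have hre : ContDiff ℝ n fun ζ : ℂ => (ζ.re : ℂ) :=
    Complex.ofRealCLM.contDiff.comp Complex.reCLM.contDiff
  exact (Complex.contDiff_exp.comp (contDiff_const.mul hre)).mul
    ((hre.mul (hf.comp Complex.imCLM.contDiff)).add (hh.comp Complex.imCLM.contDiff))

/-- In the variable `log r + iω` the real direction differentiates in `log r` and produces `a` and
the term `f`; the imaginary one differentiates the angular functions. -/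
theorem fderiv_powLog (a : ℂ) {f h : ℝ → ℂ} (hf : ContDiff ℝ 1 f) (hh : ContDiff ℝ 1 h)
    (ζ v : ℂ) :
    fderiv ℝ (powLog a f h) ζ v
      = v.re * powLog a (fun t => a * f t) (fun t => f t + a * h t) ζ
        + v.im * powLog a (deriv f) (deriv h) ζ := by
  have hd : HasFDerivAt (powLog a f h) (fderiv ℝ (powLog a f h) ζ) ζ :=
    ((contDiff_powLog (n := 1) a hf hh).differentiable (by simp) ζ).hasFDerivAt
  rw [fderiv_eq_pd]
  have hline : ∀ w : ℂ, HasDerivAt (fun τ : ℝ => powLog a f h (ζ + τ * w))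
      (fderiv ℝ (powLog a f h) ζ w) 0 := by
    intro w
    have h1 : HasDerivAt (fun τ : ℝ => ζ + τ * w) w 0 := by
      simpa using ((Complex.ofRealCLM.hasDerivAt (x := (0 : ℝ))).mul_const w).const_add ζ
    have hd' : HasFDerivAt (powLog a f h) (fderiv ℝ (powLog a f h) ζ) (ζ + ((0 : ℝ) : ℂ) * w) := by
      simpa using hd
    exact hd'.comp_hasDerivAt 0 h1
  have e0 : pd 0 (powLog a f h) ζ = powLog a (fun t => a * f t) (fun t => f t + a * h t) ζ := by
    refine (hline 1).unique ?_
    have h1 : HasDerivAt (fun τ : ℝ => ((ζ.re + τ : ℝ) : ℂ)) 1 0 := by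
      simpa using ((hasDerivAt_id (0 : ℝ)).const_add ζ.re).ofReal_comp
    have h2 := ((h1.const_mul a).cexp).mul ((h1.mul_const (f ζ.im)).add_const (h ζ.im))
    have e : (fun τ : ℝ => powLog a f h (ζ + τ * 1)) = fun τ : ℝ =>
        Complex.exp (a * ((ζ.re + τ : ℝ) : ℂ)) * (((ζ.re + τ : ℝ) : ℂ) * f ζ.im + h ζ.im) := by
      ext τ
      simp [powLog]
    rw [e]
    refine h2.congr_deriv ?_
    simp only [powLog, add_zero]
    ring
  have e1 : pd 1 (powLog a f h) ζ = powLog a (deriv f) (deriv h) ζ := by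
    refine (hline Complex.I).unique ?_
    have h1 : HasDerivAt (fun τ : ℝ => ζ.im + τ) 1 0 := (hasDerivAt_id (0 : ℝ)).const_add ζ.im
    have hf' : HasDerivAt f (deriv f ζ.im) (ζ.im + 0) := by
      simpa using (hf.differentiable one_ne_zero ζ.im).hasDerivAt
    have hh' : HasDerivAt h (deriv h ζ.im) (ζ.im + 0) := by
      simpa using (hh.differentiable one_ne_zero ζ.im).hasDerivAt
    have h2 := ((((hf'.scomp 0 h1).const_mul (ζ.re : ℂ)).add (hh'.scomp 0 h1)).const_mul
      (Complex.exp (a * ζ.re)))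
    have e : (fun τ : ℝ => powLog a f h (ζ + τ * Complex.I)) = fun τ : ℝ =>
        Complex.exp (a * ζ.re) * ((ζ.re : ℂ) * f (ζ.im + τ) + h (ζ.im + τ)) := by
      ext τ
      simp [powLog]
    rw [e]
    refine h2.congr_deriv ?_
    simp [powLog]
  rw [e0, e1]

theorem contDiffAt_cornerLog {c : ℂ} {θ : ℝ} {n : WithTop ℕ∞} {y : ℂ} (hy : y ∈ cornerSlit c θ) :
    ContDiffAt ℝ n (cornerLog c θ) y := by
  have h1 : ContDiffAt ℝ n Complex.log (Complex.exp (-(θ * Complex.I)) * (y - c)) :=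
    (Complex.contDiffAt_log hy).restrict_scalars ℝ
  exact h1.comp (f := fun y => Complex.exp (-(θ * Complex.I)) * (y - c)) y (by fun_prop)

theorem cornerSlit_ne {c : ℂ} {θ : ℝ} {y : ℂ} (hy : y ∈ cornerSlit c θ) : y - c ≠ 0 := by
  intro h
  have := Complex.slitPlane_ne_zero hy
  simp [h] at this

theorem fderiv_cornerLog {c : ℂ} {θ : ℝ} {y : ℂ} (hy : y ∈ cornerSlit c θ) (v : ℂ) :
    fderiv ℝ (cornerLog c θ) y v = v / (y - c) := by
  have h1 : HasDerivAt (fun y => Complex.exp (-(θ * Complex.I)) * (y - c))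
      (Complex.exp (-(θ * Complex.I)) * 1) y :=
    ((hasDerivAt_id y).sub_const c).const_mul _
  have h2 := (h1.clog hy).hasFDerivAt.restrictScalars ℝ
  have h3 : fderiv ℝ (cornerLog c θ) y = _ := h2.fderiv
  rw [h3]
  have := cornerSlit_ne hy
  have he := Complex.exp_ne_zero (-(θ * Complex.I))
  simp
  field_simp

theorem contDiffAt_cornerFun {c : ℂ} {θ : ℝ} (a : ℂ) {n : ℕ} {f h : ℝ → ℂ}
    (hf : ContDiff ℝ n f) (hh : ContDiff ℝ n h) {y : ℂ} (hy : y ∈ cornerSlit c θ) :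
    ContDiffAt ℝ n (cornerFun c θ a f h) y :=
  (contDiff_powLog a hf hh).contDiffAt.comp y (contDiffAt_cornerLog hy)

/-- The factor `1 / (y - c)` from the logarithm lowers the exponent by one. Its unit part,
multiplied by `1` or `I`, has as real and imaginary parts the matching components of `dirE` and
`dirN`. -/
theorem inv_sub_eq {c : ℂ} {θ : ℝ} {y : ℂ} (hy : y - c ≠ 0) :
    (y - c)⁻¹ = (Real.exp (-(cornerLog c θ y).re) : ℂ)
      * Complex.exp (-(((cornerLog c θ y).im + θ : ℝ) * Complex.I)) := by
  have he := Complex.exp_ne_zero (-(θ * Complex.I))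
  have h1 : Complex.exp (cornerLog c θ y) = Complex.exp (-(θ * Complex.I)) * (y - c) :=
    Complex.exp_log (mul_ne_zero he hy)
  rw [Complex.ofReal_exp, ← Complex.exp_add, eq_comm, ← mul_eq_one_iff_eq_inv₀ hy]
  have h2 : y - c = Complex.exp (θ * Complex.I) * Complex.exp (cornerLog c θ y) := by
    rw [h1, ← mul_assoc, ← Complex.exp_add]
    simp
  conv_lhs => rw [h2]
  rw [← Complex.exp_add, ← Complex.exp_add, Complex.exp_eq_one_iff]
  refine ⟨0, ?_⟩
  have h3 := Complex.re_add_im (cornerLog c θ y)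
  push_cast
  linear_combination -h3

/-- The class of power-logarithmic functions is closed under differentiation. -/
theorem pd_cornerFun {c : ℂ} {θ : ℝ} (a : ℂ) {f h : ℝ → ℂ} (hf : ContDiff ℝ 1 f)
    (hh : ContDiff ℝ 1 h) (i : Fin 2) {y : ℂ} (hy : y ∈ cornerSlit c θ) :
    pd i (cornerFun c θ a f h) y
      = cornerFun c θ (a - 1) (stepF θ a i f) (stepH θ a i f h) y := by
  have hL : HasFDerivAt (cornerLog c θ) (fderiv ℝ (cornerLog c θ) y) y :=
    ((contDiffAt_cornerLog (n := 1) hy).differentiableAt (by simp)).hasFDerivAt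
  have hP : HasFDerivAt (powLog a f h) (fderiv ℝ (powLog a f h) (cornerLog c θ y))
      (cornerLog c θ y) :=
    ((contDiff_powLog (n := 1) a hf hh).differentiable (by simp) _).hasFDerivAt
  have h1 : fderiv ℝ (cornerFun c θ a f h) y = _ := (hP.comp y hL).fderiv
  rw [pd, h1, ContinuousLinearMap.comp_apply, fderiv_cornerLog hy, fderiv_powLog a hf hh,
    div_eq_mul_inv, inv_sub_eq (cornerSlit_ne hy) (θ := θ)]
  have hexp : Complex.exp ((a - 1) * (cornerLog c θ y).re)
      = Complex.exp (a * (cornerLog c θ y).re) * (Real.exp (-(cornerLog c θ y).re) : ℂ) := by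
    rw [Complex.ofReal_exp, ← Complex.exp_add]
    congr 1
    push_cast
    ring
  rw [← neg_mul, ← Complex.ofReal_neg]
  simp only [cornerFun, powLog, hexp, stepF, stepH]
  set ρ := (cornerLog c θ y).re
  set t := (cornerLog c θ y).im
  fin_cases i
  · simp [Complex.exp_ofReal_mul_I_re, Complex.exp_ofReal_mul_I_im, dirE, dirN,
      -Complex.ofReal_neg, -Complex.ofReal_exp, -Complex.ofReal_add,
      -neg_add_rev]
    push_cast
    ring
  · simp [Complex.exp_ofReal_mul_I_re, Complex.exp_ofReal_mul_I_im, dirE, dirN,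
      -Complex.ofReal_neg, -Complex.ofReal_exp, -Complex.ofReal_add,
      -neg_add_rev]
    ring
-- Size and square integrability of power-logarithmic functions
theorem norm_cornerLog_re {c : ℂ} {θ : ℝ} {y : ℂ} : (cornerLog c θ y).re = Real.log ‖y - c‖ := by
  have : Complex.exp (-(θ * Complex.I)) = Complex.exp ((-θ : ℝ) * Complex.I) := by simp
  rw [cornerLog, Complex.log_re, norm_mul, this, Complex.norm_exp_ofReal_mul_I, one_mul]

/-- Power bound for power-logarithmic functions near the corner. -/
theorem exists_norm_cornerFun_le (c : ℂ) (θ : ℝ) {a : ℂ} {ν : ℝ} (hν : ν < a.re) {f h : ℝ → ℂ}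
    (hf : Continuous f) (hh : Continuous h) :
    ∃ C, 0 ≤ C ∧ ∀ y, y ≠ c → ‖y - c‖ ≤ 1 → ‖cornerFun c θ a f h y‖ ≤ C * ‖y - c‖ ^ ν := by
  obtain ⟨F, hF⟩ := (isCompact_Icc (a := -Real.pi) (b := Real.pi)).exists_bound_of_continuousOn
    hf.continuousOn
  obtain ⟨H, hH⟩ := (isCompact_Icc (a := -Real.pi) (b := Real.pi)).exists_bound_of_continuousOn
    hh.continuousOn
  have h0 : (0 : ℝ) ∈ Icc (-Real.pi) Real.pi := ⟨by linarith [Real.pi_pos], Real.pi_pos.le⟩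
  have hF0 : 0 ≤ F := (norm_nonneg _).trans (hF 0 h0)
  have hH0 : 0 ≤ H := (norm_nonneg _).trans (hH 0 h0)
  have hκ : 0 < a.re - ν := sub_pos.2 hν
  refine ⟨F / (a.re - ν) + H, by positivity, fun y hy hy1 => ?_⟩
  have hr : 0 < ‖y - c‖ := norm_pos_iff.2 (sub_ne_zero.2 hy)
  set ρ := Real.log ‖y - c‖ with hρ
  have hρ0 : ρ ≤ 0 := Real.log_nonpos hr.le hy1
  have him : (cornerLog c θ y).im ∈ Icc (-Real.pi) Real.pi := by
    rw [cornerLog, Complex.log_im]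
    exact ⟨(Complex.neg_pi_lt_arg _).le, Complex.arg_le_pi _⟩
  rw [cornerFun, powLog, norm_cornerLog_re, ← hρ, norm_mul, Complex.norm_exp]
  have hre : (a * (ρ : ℂ)).re = a.re * ρ := by simp
  have hpow : ‖y - c‖ ^ ν = Real.exp (ν * ρ) := by
    rw [Real.rpow_def_of_pos hr, mul_comm]
  have hsplit : Real.exp (a.re * ρ) = Real.exp (ν * ρ) * Real.exp ((a.re - ν) * ρ) := by
    rw [← Real.exp_add]
    congr 1
    ring
  rw [hre, hsplit, hpow, mul_comm (F / _ + H), mul_assoc]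
  refine mul_le_mul_of_nonneg_left ?_ (Real.exp_nonneg _)
  have h1 : Real.exp ((a.re - ν) * ρ) ≤ 1 := Real.exp_le_one_iff.2 (by nlinarith)
  -- The excess power `r^(Re a - ν)` absorbs the logarithm, by `x exp (-x) ≤ 1`.
  have h2 : Real.exp ((a.re - ν) * ρ) * |ρ| ≤ 1 / (a.re - ν) := by
    rw [abs_of_nonpos hρ0, le_div_iff₀ hκ]
    have h3 := Real.add_one_le_exp (-((a.re - ν) * ρ))
    have h4 : Real.exp ((a.re - ν) * ρ) * Real.exp (-((a.re - ν) * ρ)) = 1 := by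
      rw [← Real.exp_add]
      simp
    nlinarith [Real.exp_pos ((a.re - ν) * ρ)]
  calc Real.exp ((a.re - ν) * ρ) * ‖(ρ : ℂ) * f (cornerLog c θ y).im + h (cornerLog c θ y).im‖
      ≤ Real.exp ((a.re - ν) * ρ) * (|ρ| * F + H) := by
        refine mul_le_mul_of_nonneg_left ((norm_add_le _ _).trans ?_) (Real.exp_nonneg _)
        rw [norm_mul, Complex.norm_real]
        exact add_le_add (mul_le_mul_of_nonneg_left (hF _ him) (abs_nonneg _)) (hH _ him)
    _ = (Real.exp ((a.re - ν) * ρ) * |ρ|) * F + Real.exp ((a.re - ν) * ρ) * H := by ring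
    _ ≤ 1 / (a.re - ν) * F + 1 * H := by gcongr
    _ = F / (a.re - ν) + H := by ring

/-- Square integrability from a power bound near one point. -/
theorem memLp_of_norm_le_rpow {G : Set ℂ} (hG : MeasurableSet G) {c : ℂ} {F : ℂ → ℂ} {C ν : ℝ}
    (hν : -1 < ν) (hF : AEStronglyMeasurable F (volume.restrict G))
    (hb : ∀ y ∈ G, ‖y - c‖ < 1 → ‖F y‖ ≤ C * ‖y - c‖ ^ ν)
    (hz : ∀ y ∈ G, 1 ≤ ‖y - c‖ → F y = 0) : MemLp F 2 (volume.restrict G) := by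
  set p : ℝ → ℝ := (Iio (1 : ℝ)).indicator fun r => r ^ ν with hp
  have hpm : Measurable p := (measurable_id.pow_const ν).indicator measurableSet_Iio
  have h1 : Integrable fun z : ℂ => (p ‖z‖) ^ 2 := by
    have := (integrable_fun_norm_addHaar (volume : Measure ℂ) (f := fun r => p r ^ 2)).2
    refine this ?_
    -- In polar coordinates the area element adds one power of `r`, so the condition is `1 + 2ν >
    -- -1`.
    have h2 : IntegrableOn (fun r : ℝ => r ^ (1 + 2 * ν)) (Ioo 0 1) := by
      have := (intervalIntegral.intervalIntegrable_rpow' (a := 0) (b := 1) (r := 1 + 2 * ν)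
        (by linarith)).1
      exact this.mono_set Ioo_subset_Ioc_self
    have h3 := (integrable_indicator_iff measurableSet_Ioo).2 h2
    refine IntegrableOn.congr_fun (h3.integrableOn (s := Ioi 0)) ?_ measurableSet_Ioi
    intro r hr
    have hr : 0 < r := hr
    simp only [Complex.finrank_real_complex, smul_eq_mul, hp]
    by_cases h : r < 1
    · rw [indicator_of_mem (show r ∈ Ioo (0 : ℝ) 1 from ⟨hr, h⟩), indicator_of_mem (show r ∈ Iio (1 : ℝ) from h),
        ← Real.rpow_natCast (r ^ ν), ← Real.rpow_mul hr.le, ← Real.rpow_natCast r,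
        ← Real.rpow_add hr]
      congr 1
      norm_num
      ring
    · rw [indicator_of_notMem (show r ∉ Ioo (0 : ℝ) 1 from fun hh => h hh.2),
        indicator_of_notMem (show r ∉ Iio (1 : ℝ) from h)]
      simp
  have h2 : MemLp (fun z : ℂ => p ‖z‖) 2 :=
    (memLp_two_iff_integrable_sq (hpm.comp measurable_norm).aestronglyMeasurable).2 h1
  have h3 : MemLp (fun y : ℂ => C * p ‖y - c‖) 2 (volume.restrict G) :=
    ((h2.comp_measurePreserving (measurePreserving_sub_right volume c)).restrict G).const_mul C
  refine h3.mono hF ?_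
  filter_upwards [ae_restrict_mem hG] with y hy
  rcases lt_or_ge ‖y - c‖ 1 with h | h
  · have e : p ‖y - c‖ = ‖y - c‖ ^ ν := indicator_of_mem (show ‖y - c‖ ∈ Iio (1 : ℝ) from h) _
    rw [e]
    exact (hb y hy h).trans (le_abs_self _)
  · rw [hz y hy h, norm_zero]
    exact norm_nonneg _

/-- By Fubini's theorem, a finite integral would make `1/r` integrable at zero for some angle in
`J`. -/
theorem not_lintegral_inv_ne_top {r₀ c : ℝ} (hr₀ : 0 < r₀) (hc : 0 < c) {J : Set ℝ}
    (hJ : volume J ≠ 0) :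
    ∫⁻ p in Ioo 0 r₀ ×ˢ J, ENNReal.ofReal (c * p.1⁻¹) = ⊤ := by
  by_contra hne
  have hm : Measurable fun p : ℝ × ℝ => c * p.1⁻¹ := by fun_prop
  have hnn : 0 ≤ᵐ[volume.restrict (Ioo 0 r₀ ×ˢ J)] fun p : ℝ × ℝ => c * p.1⁻¹ := by
    have : volume.restrict (Ioo 0 r₀ ×ˢ J) = (volume.restrict (Ioo (0 : ℝ) r₀)).prod (volume.restrict J) := by
      rw [Measure.prod_restrict, Measure.volume_eq_prod]
    have hfst : ∀ᵐ p ∂(volume.restrict (Ioo 0 r₀ ×ˢ J)), p.1 ∈ Ioo 0 r₀ := by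
      rw [this]
      exact (Measure.quasiMeasurePreserving_fst).ae (ae_restrict_mem measurableSet_Ioo)
    filter_upwards [hfst] with p hp
    exact mul_nonneg hc.le (inv_nonneg.2 hp.1.le)
  have hint := (lintegral_ofReal_ne_top_iff_integrable hm.aestronglyMeasurable hnn).1 hne
  rw [Measure.volume_eq_prod, ← Measure.prod_restrict] at hint
  have hae := hint.prod_left_ae
  have hJ' : volume.restrict J ≠ 0 := fun h => hJ (Measure.restrict_eq_zero.1 h)
  have : NeBot (ae (volume.restrict J)) := ae_neBot.2 hJ'
  obtain ⟨t, ht⟩ := hae.exists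
  have h1 : IntegrableOn (fun r : ℝ => r⁻¹) (Ioo 0 r₀) := by
    have := ht.const_mul c⁻¹
    refine this.congr (ae_of_all _ fun r => ?_)
    simp only
    rw [← mul_assoc, inv_mul_cancel₀ hc.ne', one_mul]
  have h2 : IntervalIntegrable (fun r : ℝ => r⁻¹) volume 0 r₀ :=
    (intervalIntegrable_iff_integrableOn_Ioo_of_le hr₀.le).2 h1
  rw [intervalIntegrable_inv_iff] at h2
  rcases h2 with h2 | h2
  · exact hr₀.ne h2
  · exact h2 left_mem_uIcc

/-- A lower bound on a window of angles excludes square integrability. -/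
theorem false_of_memLp_powLog {a : ℂ} (ha : a.re ≤ -1) {f h : ℝ → ℂ} {ω₀ δ r₀ c : ℝ}
    (hω : ω₀ ≤ Real.pi) (hr₀ : 0 < r₀) (hr₁ : r₀ ≤ 1) (hrδ : r₀ ≤ δ) (hc : 0 < c) {J : Set ℝ}
    (hJm : MeasurableSet J) (hJs : J ⊆ Ioo (-ω₀) ω₀) (hJ : volume J ≠ 0)
    (hlow : ∀ t ∈ J, ∀ r ∈ Ioo 0 r₀, c ≤ ‖(Real.log r : ℂ) * f t + h t‖)
    (hL : MemLp (fun z => powLog a f h (Complex.log z)) 2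
      (volume.restrict (sector ω₀ ∩ Metric.ball 0 δ))) : False := by
  have hlt : ∫⁻ z in sector ω₀ ∩ Metric.ball 0 δ, ‖powLog a f h (Complex.log z)‖ₑ ^ 2 < ⊤ := by
    have := hL.2
    rw [eLpNorm_lt_top_iff_lintegral_rpow_enorm_lt_top (by norm_num) (by norm_num)] at this
    simpa using this
  have hsec : MeasurableSet (sector ω₀ ∩ Metric.ball (0 : ℂ) δ) := by
    refine MeasurableSet.inter ?_ Metric.isOpen_ball.measurableSet
    have h1 : MeasurableSet {z : ℂ | z ≠ 0} := (measurableSet_singleton 0).compl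
    have h2 : MeasurableSet {z : ℂ | |z.arg| < ω₀} :=
      measurableSet_lt (Complex.measurable_arg.abs) measurable_const
    exact h1.inter h2
  rw [← lintegral_indicator hsec, ← Complex.lintegral_comp_polarCoord_symm] at hlt
  have hsub : Ioo 0 r₀ ×ˢ J ⊆ polarCoord.target := by
    rintro ⟨r, t⟩ ⟨hr, ht⟩
    have := hJs ht
    exact ⟨hr.1, by linarith [this.1], by linarith [this.2]⟩
  have h2 := (lintegral_mono_set hsub).trans_lt hlt
  refine (not_lintegral_inv_ne_top hr₀ (pow_pos hc 2) hJ).not_lt (lt_of_le_of_lt ?_ h2)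
  refine setLIntegral_mono' (measurableSet_Ioo.prod hJm) ?_
  rintro ⟨r, t⟩ ⟨hr, ht⟩
  simp only at hr ht
  have htI := hJs ht
  have htπ : t ∈ Ioc (-Real.pi) Real.pi := ⟨by linarith [htI.1], by linarith [htI.2]⟩
  have hz : Complex.polarCoord.symm (r, t) = r * (Real.cos t + Real.sin t * Complex.I) :=
    Complex.polarCoord_symm_apply _
  have hz' : Complex.polarCoord.symm (r, t) = r * (Complex.cos t + Complex.sin t * Complex.I) := by
    rw [hz]
    push_cast
    rfl
  have harg : (Complex.polarCoord.symm (r, t)).arg = t := by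
    rw [hz']
    exact Complex.arg_mul_cos_add_sin_mul_I hr.1 htπ
  have hnorm : ‖Complex.polarCoord.symm (r, t)‖ = r := by
    rw [Complex.norm_polarCoord_symm]
    exact abs_of_pos hr.1
  have hmem : Complex.polarCoord.symm (r, t) ∈ sector ω₀ ∩ Metric.ball 0 δ := by
    refine ⟨⟨?_, ?_⟩, ?_⟩
    · rw [← norm_ne_zero_iff, hnorm]
      exact hr.1.ne'
    · rw [harg]
      exact abs_lt.2 htI
    · rw [mem_ball_zero_iff, hnorm]
      exact hr.2.trans_le hrδ
  rw [indicator_of_mem hmem]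
  have hlog : powLog a f h (Complex.log (Complex.polarCoord.symm (r, t)))
      = Complex.exp (a * Real.log r) * ((Real.log r : ℂ) * f t + h t) := by
    rw [powLog, Complex.log_re, Complex.log_im, hnorm, harg]
  rw [hlog, ← ofReal_norm, ← ENNReal.ofReal_pow (norm_nonneg _), smul_eq_mul,
    ← ENNReal.ofReal_mul hr.1.le]
  refine ENNReal.ofReal_le_ofReal ?_
  have hl := hlow t ht r hr
  -- Here `Re a ≤ -1` enters: for `r ≤ 1` the power is at least `1/r`, so its square times the area
  -- factor `r` is at least `1/r`.
  have hexp : r⁻¹ ≤ ‖Complex.exp (a * Real.log r)‖ := by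
    rw [Complex.norm_exp]
    have : (a * (Real.log r : ℂ)).re = a.re * Real.log r := by simp
    rw [this, ← Real.exp_log (inv_pos.2 hr.1), Real.log_inv]
    refine Real.exp_le_exp.2 ?_
    have := Real.log_nonpos hr.1.le (hr.2.le.trans hr₁)
    nlinarith
  rw [norm_mul, mul_pow]
  have hri : 0 < r⁻¹ := inv_pos.2 hr.1
  calc c ^ 2 * r⁻¹ = r * (r⁻¹ ^ 2 * c ^ 2) := by
        have := hr.1.ne'
        field_simp
    _ ≤ r * (‖Complex.exp (a * Real.log r)‖ ^ 2 * ‖(Real.log r : ℂ) * f t + h t‖ ^ 2) := by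
        have := hr.1
        gcongr

/-- If `r^a (log r f + h)` with `Re a ≤ -1` is square integrable near the vertex of an angle,
then `f` and `h` vanish in the angle. -/
theorem eq_zero_of_memLp_powLog {a : ℂ} (ha : a.re ≤ -1) {f h : ℝ → ℂ} (hf : Continuous f)
    (hh : Continuous h) {ω₀ δ : ℝ} (hω : ω₀ ≤ Real.pi) (hδ : 0 < δ)
    (hL : MemLp (fun z => powLog a f h (Complex.log z)) 2
      (volume.restrict (sector ω₀ ∩ Metric.ball 0 δ))) :
    ∀ t ∈ Ioo (-ω₀) ω₀, f t = 0 ∧ h t = 0 := by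
  have hopen : ∀ {t : ℝ} {V : Set ℝ}, t ∈ Ioo (-ω₀) ω₀ → V ∈ 𝓝 t →
      ∃ J : Set ℝ, MeasurableSet J ∧ J ⊆ Ioo (-ω₀) ω₀ ∧ J ⊆ V ∧ volume J ≠ 0 := by
    intro t V ht hV
    obtain ⟨W, hW, hWo, htW⟩ := mem_nhds_iff.1 (inter_mem hV (Ioo_mem_nhds ht.1 ht.2))
    exact ⟨W, hWo.measurableSet, fun x hx => (hW hx).2, fun x hx => (hW hx).1,
      (hWo.measure_pos volume ⟨t, htW⟩).ne'⟩
  have hf0 : ∀ t ∈ Ioo (-ω₀) ω₀, f t = 0 := by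
    intro t ht
    by_contra hne
    set m := ‖f t‖ / 2 with hm
    have hmp : 0 < m := half_pos (norm_pos_iff.2 hne)
    obtain ⟨J, hJm, hJs, hJV, hJ0⟩ := hopen ht (inter_mem
      (hf.norm.continuousAt.eventually (lt_mem_nhds (half_lt_self (norm_pos_iff.2 hne))))
      (hh.norm.continuousAt.eventually (gt_mem_nhds (lt_add_one ‖h t‖))))
    set M := ‖h t‖ + 1
    have hMp : 0 < M := by positivity
    -- Below this radius `|log r|` exceeds `(M + 1)/m`, so the logarithmic term dominates `h` by at
    -- least `1` on the window where `|f| > m` and `|h| < M`.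
    have hr₀ : 0 < min (min 1 δ) (Real.exp (-((M + 1) / m))) :=
      lt_min (lt_min one_pos hδ) (Real.exp_pos _)
    refine false_of_memLp_powLog ha hω hr₀ ((min_le_left _ _).trans (min_le_left _ _))
      ((min_le_left _ _).trans (min_le_right _ _)) one_pos hJm hJs hJ0 ?_ hL
    intro s hs r hr
    have h1 : m < ‖f s‖ := (hJV hs).1
    have h2 : ‖h s‖ < M := (hJV hs).2
    have h3 : Real.log r < -((M + 1) / m) := by
      rw [Real.log_lt_iff_lt_exp hr.1]
      exact hr.2.trans_le (min_le_right _ _)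
    have h4 : (M + 1) / m < |Real.log r| := by
      have : 0 < (M + 1) / m := by positivity
      rw [abs_of_neg (by linarith)]
      linarith
    have h5 : M + 1 ≤ |Real.log r| * ‖f s‖ := by
      rw [div_lt_iff₀ hmp] at h4
      nlinarith [abs_nonneg (Real.log r)]
    have h6 : ‖(Real.log r : ℂ) * f s‖ = |Real.log r| * ‖f s‖ := by
      rw [norm_mul, Complex.norm_real, Real.norm_eq_abs]
    have h7 := norm_sub_le_norm_add ((Real.log r : ℂ) * f s) (h s)
    rw [h6] at h7
    linarith
  intro t ht
  refine ⟨hf0 t ht, ?_⟩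
  by_contra hne
  -- With `f` already zero there is no logarithm to compensate, and `|h|` is bounded below near `t`.
  obtain ⟨J, hJm, hJs, hJV, hJ0⟩ := hopen ht
    (hh.norm.continuousAt.eventually (lt_mem_nhds (half_lt_self (norm_pos_iff.2 hne))))
  refine false_of_memLp_powLog ha hω (lt_min one_pos hδ) (min_le_left _ _) (min_le_right _ _)
    (half_pos (norm_pos_iff.2 hne)) hJm hJs hJ0 ?_ hL
  intro s hs r _
  rw [hf0 s (hJs hs), mul_zero, zero_add]
  exact le_of_lt (hJV hs)
/-! ### Regularity of angular functions -/

theorem IntervalW2.intervalIntegrable_d2 {a : ℝ} (ha : 0 < a) (Φ : IntervalW2 a) :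
    IntervalIntegrable Φ.d2 volume (-a) a := by
  have hfin : IsFiniteMeasure (volume.restrict (Ioo (-a) a)) := ⟨by simp⟩
  exact (intervalIntegrable_iff_integrableOn_Ioo_of_le (by linarith)).2
    (Φ.d2_mem.integrable one_le_two)

theorem IntervalW2.continuousOn_d1 {a : ℝ} (ha : 0 < a) (Φ : IntervalW2 a) :
    ContinuousOn Φ.d1 (Icc (-a) a) := by
  have h := intervalIntegral.continuousOn_primitive_interval' (Φ.intervalIntegrable_d2 ha)
    (a := 0) (by rw [uIcc_of_le (by linarith)]; exact ⟨by linarith, ha.le⟩)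
  rw [uIcc_of_le (by linarith)] at h
  exact (continuousOn_const.add h).congr Φ.d1_eq

theorem IntervalW2.continuousOn_toFun {a : ℝ} (ha : 0 < a) (Φ : IntervalW2 a) :
    ContinuousOn Φ.toFun (Icc (-a) a) := by
  have h1 : IntervalIntegrable Φ.d1 volume (-a) a :=
    ContinuousOn.intervalIntegrable (by
      rw [uIcc_of_le (by linarith)]
      exact Φ.continuousOn_d1 ha)
  have h := intervalIntegral.continuousOn_primitive_interval' h1
    (a := 0) (by rw [uIcc_of_le (by linarith)]; exact ⟨by linarith, ha.le⟩)
  rw [uIcc_of_le (by linarith)] at h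
  exact (continuousOn_const.add h).congr Φ.toFun_eq

theorem uIcc_zero_subset {a t : ℝ} (ha : 0 < a) (ht : t ∈ Icc (-a) a) : uIcc 0 t ⊆ Icc (-a) a :=
  uIcc_subset_Icc ⟨by linarith, ha.le⟩ ht

/-- A function in `W²(-a, a)` whose second derivative is continuous extends to a `C²` function
on the line. -/
theorem IntervalW2.exists_contDiff {a : ℝ} (ha : 0 < a) (Φ : IntervalW2 a) {Q : ℝ → ℂ}
    (hQ : ContinuousOn Q (Icc (-a) a))
    (hae : ∀ᵐ t ∂(volume.restrict (Ioo (-a) a)), Φ.d2 t = Q t) :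
    ∃ f : ℝ → ℂ, ContDiff ℝ 2 f ∧ (∀ t ∈ Icc (-a) a, f t = Φ.toFun t) ∧
      (∀ t ∈ Icc (-a) a, deriv f t = Φ.d1 t) ∧ ∀ t ∈ Icc (-a) a, deriv (deriv f) t = Q t := by
  have haa : -a ≤ a := by linarith
  -- Extension by the end values keeps the second derivative continuous; integrating it twice from
  -- zero gives a `C²` function on the line.
  set q : ℝ → ℂ := IccExtend haa ((Icc (-a) a).domRestrict Q)
  have hq : Continuous q := (continuousOn_iff_continuous_domRestrict.1 hQ).Icc_extend'
  have hqQ : ∀ t ∈ Icc (-a) a, q t = Q t := fun t ht => IccExtend_of_mem haa _ ht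
  set d : ℝ → ℂ := fun t => Φ.d1 0 + ∫ s in (0 : ℝ)..t, q s
  have hd : ∀ t, HasDerivAt d (q t) t := fun t =>
    (intervalIntegral.integral_hasDerivAt_right (hq.intervalIntegrable _ _)
      (hq.stronglyMeasurableAtFilter _ _) hq.continuousAt).const_add _
  have hdc : Continuous d := continuous_iff_continuousAt.2 fun t => (hd t).continuousAt
  set f : ℝ → ℂ := fun t => Φ.toFun 0 + ∫ s in (0 : ℝ)..t, d s
  have hf : ∀ t, HasDerivAt f (d t) t := fun t =>
    (intervalIntegral.integral_hasDerivAt_right (hdc.intervalIntegrable _ _)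
      (hdc.stronglyMeasurableAtFilter _ _) hdc.continuousAt).const_add _
  have hfd : deriv f = d := funext fun t => (hf t).deriv
  have hdd : deriv d = q := funext fun t => (hd t).deriv
  have hd1 : ∀ t ∈ Icc (-a) a, d t = Φ.d1 t := by
    intro t ht
    rw [Φ.d1_eq t ht]
    refine congrArg (fun x => Φ.d1 0 + x) (intervalIntegral.integral_congr_ae ?_)
    rw [ae_restrict_iff' measurableSet_Ioo] at hae
    have h1 : ∀ᵐ x : ℝ, x ≠ a := by simp [ae_iff]
    have h2 : ∀ᵐ x : ℝ, x ≠ -a := by simp [ae_iff]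
    filter_upwards [hae, h1, h2] with x hx hx1 hx2 hxt
    have hxI := uIcc_zero_subset ha ht (uIoc_subset_uIcc hxt)
    rw [hqQ x hxI, hx ⟨lt_of_le_of_ne hxI.1 hx2.symm, lt_of_le_of_ne hxI.2 hx1⟩]
  refine ⟨f, ?_, ?_, fun t ht => ?_, fun t ht => ?_⟩
  · have : ContDiff ℝ (1 + 1) f := by
      refine contDiff_succ_iff_deriv.2 ⟨fun t => (hf t).differentiableAt, by simp, ?_⟩
      rw [hfd]
      refine contDiff_one_iff_deriv.2 ⟨fun t => (hd t).differentiableAt, ?_⟩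
      rwa [hdd]
    simpa [one_add_one_eq_two] using this
  · intro t ht
    rw [Φ.toFun_eq t ht]
    exact congrArg (fun x => Φ.toFun 0 + x)
      (intervalIntegral.integral_congr fun x hx => hd1 x (uIcc_zero_subset ha ht hx))
  · rw [hfd, hd1 t ht]
  · rw [hfd, hdd, hqQ t ht]

/-- The operator `P̃(ω, ∂_ω, μ)` applied to the jet `(x₀, x₁, x₂)` of an angular function. -/
def symbolOp (a : Fin 2 → Fin 2 → ℂ) (θ : ℝ) (μ : ℂ) (t : ℝ) (x₀ x₁ x₂ : ℂ) : ℂ :=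
  form a (dirE θ t) (dirE θ t) * (μ * (μ - 1) * x₀)
    + (form a (dirE θ t) (dirN θ t) + form a (dirN θ t) (dirE θ t)) * ((μ - 1) * x₁)
    + form a (dirN θ t) (dirN θ t) * (x₂ + μ * x₀)

theorem continuous_form_dir (a : Fin 2 → Fin 2 → ℂ) {X Y : ℝ → Fin 2 → ℂ}
    (hX : ∀ i, Continuous fun t => X t i) (hY : ∀ i, Continuous fun t => Y t i) :
    Continuous fun t => form a (X t) (Y t) := by
  unfold form
  refine continuous_finsetSum _ fun i _ => continuous_finsetSum _ fun k _ => ?_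
  exact (continuous_const.mul (hX i)).mul (hY k)

theorem form_dirN_ne_zero {a : Fin 2 → Fin 2 → ℂ} (ha : ProperlyElliptic a) (θ t : ℝ) :
    form a (dirN θ t) (dirN θ t) ≠ 0 := by
  have h := ha.1 ![-Real.sin (t + θ), Real.cos (t + θ)] (by
    intro h0
    have h1 := congrFun h0 0
    have h2 := congrFun h0 1
    simp only [Matrix.cons_val_zero, Matrix.cons_val_one, Pi.zero_apply] at h1 h2
    have := Real.sin_sq_add_cos_sq (t + θ)
    nlinarith)
  have e : (fun i => ((![-Real.sin (t + θ), Real.cos (t + θ)] i : ℝ) : ℂ)) = dirN θ t := by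
    ext i
    fin_cases i <;> simp [dirN]
  rwa [e] at h

/-- Elliptic regularity for the angular equation `P̃ φ + R = 0` on an interval. -/
theorem IntervalW2.exists_contDiff_of_symbolOp {a : Fin 2 → Fin 2 → ℂ} (hell : ProperlyElliptic a)
    (θ : ℝ) (μ : ℂ) {ω₀ : ℝ} (hω : 0 < ω₀) (Φ : IntervalW2 ω₀) {R : ℝ → ℂ}
    (hR : ContinuousOn R (Icc (-ω₀) ω₀))
    (hae : ∀ᵐ t ∂(volume.restrict (Ioo (-ω₀) ω₀)),
      symbolOp a θ μ t (Φ.toFun t) (Φ.d1 t) (Φ.d2 t) + R t = 0) :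
    ∃ f : ℝ → ℂ, ContDiff ℝ 2 f ∧ (∀ t ∈ Icc (-ω₀) ω₀, f t = Φ.toFun t) ∧
      (∀ t ∈ Icc (-ω₀) ω₀, deriv f t = Φ.d1 t) ∧
      ∀ t ∈ Icc (-ω₀) ω₀, symbolOp a θ μ t (f t) (deriv f t) (deriv (deriv f) t) + R t = 0 := by
  have hE : ∀ i, Continuous fun t => dirE θ t i := fun i => (contDiff_dirE θ i).continuous
  have hN : ∀ i, Continuous fun t => dirN θ t i := fun i => (contDiff_dirN θ i).continuous
  have hne := form_dirN_ne_zero hell θ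
  -- The equation is solved for the second derivative: its coefficient is the form at the real
  -- vector `n`, nonzero by ellipticity, and everything else is continuous.
  obtain ⟨f, hf, hf0, hf1, hf2⟩ := Φ.exists_contDiff hω
    (Q := fun t => -(symbolOp a θ μ t (Φ.toFun t) (Φ.d1 t) 0 + R t)
      / form a (dirN θ t) (dirN θ t)) (by
      refine ContinuousOn.div ?_ (continuous_form_dir a hN hN).continuousOn fun t _ => hne t
      have h0 := Φ.continuousOn_toFun hω
      have h1 := Φ.continuousOn_d1 hω
      have e1 := (continuous_form_dir a hE hE).continuousOn (s := Icc (-ω₀) ω₀)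
      have e2 := (continuous_form_dir a hE hN).continuousOn (s := Icc (-ω₀) ω₀)
      have e3 := (continuous_form_dir a hN hE).continuousOn (s := Icc (-ω₀) ω₀)
      have e4 := (continuous_form_dir a hN hN).continuousOn (s := Icc (-ω₀) ω₀)
      unfold symbolOp
      fun_prop) (by
      filter_upwards [hae] with t ht
      rw [eq_div_iff (hne t)]
      simp only [symbolOp] at ht ⊢
      linear_combination ht)
  refine ⟨f, hf, hf0, hf1, fun t ht => ?_⟩
  rw [hf0 t ht, hf1 t ht, hf2 t ht]
  have := hne t
  simp only [symbolOp]
  field_simp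
  ring
/-! ### Functions with corner singularities -/

/-- The open set `G` lies, near its corner `c`, in the plane slit along the ray opposite
to `θ`, together with its boundary points. -/
structure IsCorner (G : Set ℂ) (c : ℂ) (θ ε : ℝ) : Prop where
  isOpen : IsOpen G
  notMem : c ∉ G
  slit : ∀ y ∈ closure G, y ≠ c → ‖y - c‖ < ε → y ∈ cornerSlit c θ

/-- A smooth function supported in a disc of radius less than `min ε 1` with centre `c`. -/
structure IsCutoff (c : ℂ) (ε : ℝ) (κ : ℂ → ℂ) : Prop where
  smooth : ContDiff ℝ ∞ κ
  supp : ∃ δ < min ε 1, ∀ y, δ ≤ ‖y - c‖ → κ y = 0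

namespace IsCutoff

variable {c : ℂ} {ε : ℝ} {κ : ℂ → ℂ}

theorem eventuallyEq_zero (hκ : IsCutoff c ε κ) {y : ℂ} (hy : min ε 1 ≤ ‖y - c‖) :
    κ =ᶠ[𝓝 y] 0 := by
  obtain ⟨δ, hδ, h⟩ := hκ.supp
  have hc : Continuous fun y : ℂ => ‖y - c‖ := by fun_prop
  filter_upwards [hc.continuousAt.eventually (lt_mem_nhds (hδ.trans_le hy))] with z hz
  exact h z hz.le

theorem hasCompactSupport (hκ : IsCutoff c ε κ) : HasCompactSupport κ := by
  refine HasCompactSupport.intro (isCompact_closedBall c (min ε 1)) fun y hy => ?_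
  rw [mem_closedBall_iff_norm, not_le] at hy
  exact (hκ.eventuallyEq_zero hy.le).self_of_nhds

theorem pd (hκ : IsCutoff c ε κ) (i : Fin 2) : IsCutoff c ε (pd i κ) := by
  obtain ⟨δ, hδ, h⟩ := hκ.supp
  refine ⟨pd_smooth i hκ.smooth, (δ + min ε 1) / 2, by linarith, fun y hy => ?_⟩
  have hc : Continuous fun y : ℂ => ‖y - c‖ := by fun_prop
  have h0 : κ =ᶠ[𝓝 y] 0 := by
    filter_upwards [hc.continuousAt.eventually (lt_mem_nhds (by linarith : δ < ‖y - c‖))] with z hz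
    exact h z hz.le
  rw [NonlocalElliptic.pd, h0.fderiv_eq]
  simp

theorem smooth_mul (hκ : IsCutoff c ε κ) {a : ℂ → ℂ} (ha : ContDiff ℝ ∞ a) :
    IsCutoff c ε fun y => a y * κ y := by
  obtain ⟨δ, hδ, h⟩ := hκ.supp
  exact ⟨ha.mul hκ.smooth, δ, hδ, fun y hy => by simp [h y hy]⟩

theorem exists_bound (hκ : IsCutoff c ε κ) : ∃ C, 0 ≤ C ∧ ∀ y, ‖κ y‖ ≤ C := by
  obtain ⟨C, hC⟩ := hκ.hasCompactSupport.exists_bound_of_continuous hκ.smooth.continuous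
  exact ⟨C, (norm_nonneg _).trans (hC 0), hC⟩

theorem exists_bound_of_eq_zero (hκ : IsCutoff c ε κ) (h0 : κ c = 0) :
    ∃ C, 0 ≤ C ∧ ∀ y, ‖κ y‖ ≤ C * ‖y - c‖ := by
  obtain ⟨C, hC⟩ := (hκ.smooth.of_le (m := 1) (by norm_cast)).lipschitzWith_of_hasCompactSupport
    hκ.hasCompactSupport (by norm_num)
  refine ⟨C, C.2, fun y => ?_⟩
  have := hC.dist_le_mul y c
  rwa [dist_eq_norm, dist_eq_norm, h0, sub_zero] at this

end IsCutoff

theorem measurable_powLog (a : ℂ) {f h : ℝ → ℂ} (hf : Continuous f) (hh : Continuous h) :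
    Measurable (powLog a f h) := by
  unfold powLog
  have := hf.measurable
  have := hh.measurable
  fun_prop

theorem measurable_cornerFun (c : ℂ) (θ : ℝ) (a : ℂ) {f h : ℝ → ℂ} (hf : Continuous f)
    (hh : Continuous h) : Measurable (cornerFun c θ a f h) :=
  (measurable_powLog a hf hh).comp (Complex.measurable_log.comp (by fun_prop))

namespace IsCorner

variable {G : Set ℂ} {c : ℂ} {θ ε : ℝ}

theorem mem_slit (hG : IsCorner G c θ ε) {y : ℂ} (hy : y ∈ G) (hε : ‖y - c‖ < min ε 1) :
    y ∈ cornerSlit c θ :=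
  hG.slit y (subset_closure hy) (fun h => hG.notMem (h ▸ hy)) (hε.trans_le (min_le_left _ _))

theorem memLp_of_bound (hG : IsCorner G c θ ε) {κ : ℂ → ℂ} (hκ : IsCutoff c ε κ) {a : ℂ}
    {m C : ℝ} (hC : 0 ≤ C) (hb : ∀ y, y ≠ c → ‖κ y‖ ≤ C * ‖y - c‖ ^ m) (ha : -1 < a.re + m)
    {f h : ℝ → ℂ} (hf : Continuous f) (hh : Continuous h) :
    MemLp (fun y => κ y * cornerFun c θ a f h y) 2 (volume.restrict G) := by
  -- The exponent is midway between `-1 - m` and `Re a`: below `Re a` to absorb the logarithm, yet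
  -- above `-1` after adding `m`.
  have hν : (a.re - m - 1) / 2 < a.re := by linarith
  obtain ⟨M, hM, hbound⟩ := exists_norm_cornerFun_le c θ hν hf hh
  refine memLp_of_norm_le_rpow hG.isOpen.measurableSet (c := c) (C := C * M)
    (ν := m + (a.re - m - 1) / 2) (by linarith) ?_ ?_ ?_
  · exact (hκ.smooth.continuous.measurable.mul
      (measurable_cornerFun c θ a hf hh)).aestronglyMeasurable
  · intro y hy hy1
    have hyc : y ≠ c := fun h => hG.notMem (h ▸ hy)
    have hr : 0 < ‖y - c‖ := norm_pos_iff.2 (sub_ne_zero.2 hyc)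
    rw [norm_mul, Real.rpow_add hr]
    calc ‖κ y‖ * ‖cornerFun c θ a f h y‖
        ≤ (C * ‖y - c‖ ^ m) * (M * ‖y - c‖ ^ ((a.re - m - 1) / 2)) :=
          mul_le_mul (hb y hyc) (hbound y hyc hy1.le) (norm_nonneg _) (by positivity)
      _ = C * M * (‖y - c‖ ^ m * ‖y - c‖ ^ ((a.re - m - 1) / 2)) := by ring
  · intro y _ hy1
    rw [(hκ.eventuallyEq_zero ((min_le_right _ _).trans hy1)).self_of_nhds]
    simp

theorem memLp_mul_cornerFun (hG : IsCorner G c θ ε) {κ : ℂ → ℂ} (hκ : IsCutoff c ε κ) {a : ℂ}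
    (ha : -1 < a.re) {f h : ℝ → ℂ} (hf : Continuous f) (hh : Continuous h) :
    MemLp (fun y => κ y * cornerFun c θ a f h y) 2 (volume.restrict G) := by
  obtain ⟨C, hC, hb⟩ := hκ.exists_bound
  exact hG.memLp_of_bound hκ (m := 0) hC (fun y _ => by simpa using hb y) (by simpa using ha) hf hh

/-- A smooth factor vanishing at the corner is `O(r)`, which shifts the admissible exponents from
`Re a > -1` to `Re a > -2`. Both the freezing of coefficients and the boundary corrections rest on
this gain. -/
theorem memLp_mul_cornerFun_of_eq_zero (hG : IsCorner G c θ ε) {κ : ℂ → ℂ}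
    (hκ : IsCutoff c ε κ) (h0 : κ c = 0) {a : ℂ} (ha : -2 < a.re) {f h : ℝ → ℂ}
    (hf : Continuous f) (hh : Continuous h) :
    MemLp (fun y => κ y * cornerFun c θ a f h y) 2 (volume.restrict G) := by
  obtain ⟨C, hC, hb⟩ := hκ.exists_bound_of_eq_zero h0
  exact hG.memLp_of_bound hκ (m := 1) hC (fun y _ => by simpa using hb y) (by linarith) hf hh

end IsCorner

/-- The function `κ(y) r^a (log r f(ω) + h(ω))`, extended by zero to the corner. -/
def cornerTerm (κ : ℂ → ℂ) (c : ℂ) (θ : ℝ) (a : ℂ) (f h : ℝ → ℂ) (y : ℂ) : ℂ :=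
  if y = c then 0 else κ y * cornerFun c θ a f h y

/-- `u` is `C²` in `G` and continuous up to the boundary, `u` and its first derivatives are square
integrable, and so are the differences of its second derivatives and the functions `P i k`. -/
structure IsSingular (G : Set ℂ) (u : ℂ → ℂ) (P : Fin 2 → Fin 2 → ℂ → ℂ) : Prop where
  contDiffOn : ContDiffOn ℝ 2 u G
  continuousOn : ContinuousOn u (closure G)
  memLp : MemLp u 2 (volume.restrict G)
  memLp_pd : ∀ i, MemLp (pd i u) 2 (volume.restrict G)
  memLp_pd_pd : ∀ i k, MemLp (fun y => pd k (pd i u) y - P i k y) 2 (volume.restrict G)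

theorem contDiffOn_pd_two {G : Set ℂ} (hG : IsOpen G) {u : ℂ → ℂ} (hu : ContDiffOn ℝ 2 u G)
    (i : Fin 2) : ContDiffOn ℝ 1 (pd i u) G :=
  continuousOn_pd (n := 1) hG (by simpa [one_add_one_eq_two] using hu) i

theorem pd_add {u v : ℂ → ℂ} {y : ℂ} (hu : DifferentiableAt ℝ u y) (hv : DifferentiableAt ℝ v y)
    (i : Fin 2) : pd i (u + v) y = pd i u y + pd i v y := by
  simp only [pd]
  rw [fderiv_add hu hv]
  rfl

theorem pd_mul {u v : ℂ → ℂ} {y : ℂ} (hu : DifferentiableAt ℝ u y) (hv : DifferentiableAt ℝ v y)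
    (i : Fin 2) : pd i (fun y => u y * v y) y = pd i u y * v y + u y * pd i v y := by
  simp only [pd]
  rw [fderiv_fun_mul hu hv]
  simp
  ring

theorem pd_congr {u v : ℂ → ℂ} {y : ℂ} (h : u =ᶠ[𝓝 y] v) (i : Fin 2) : pd i u y = pd i v y := by
  simp only [pd]
  rw [h.fderiv_eq]

namespace IsSingular

variable {G : Set ℂ} {u v : ℂ → ℂ} {P Q : Fin 2 → Fin 2 → ℂ → ℂ}

theorem zero (G : Set ℂ) : IsSingular G 0 0 := by
  have h : ∀ i, pd i (0 : ℂ → ℂ) = 0 := fun i => by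
    ext y
    simp [pd]
  refine ⟨contDiffOn_const, continuousOn_const, MemLp.zero, fun i => ?_, fun i k => ?_⟩
  · rw [h]
    exact MemLp.zero
  · simp only [h, Pi.zero_apply, sub_zero]
    exact MemLp.zero

theorem add (hG : IsOpen G) (hu : IsSingular G u P) (hv : IsSingular G v Q) :
    IsSingular G (u + v) (P + Q) := by
  have h1 : ∀ i, ∀ y ∈ G, pd i (u + v) y = pd i u y + pd i v y := fun i y hy =>
    pd_add ((hu.contDiffOn.contDiffAt (hG.mem_nhds hy)).differentiableAt (by simp))
      ((hv.contDiffOn.contDiffAt (hG.mem_nhds hy)).differentiableAt (by simp)) i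
  have h2 : ∀ i k, ∀ y ∈ G, pd k (pd i (u + v)) y = pd k (pd i u) y + pd k (pd i v) y := by
    intro i k y hy
    rw [pd_congr (v := pd i u + pd i v) (by
      filter_upwards [hG.mem_nhds hy] with z hz
      exact h1 i z hz)]
    exact pd_add
      (((contDiffOn_pd_two hG hu.contDiffOn i).contDiffAt (hG.mem_nhds hy)).differentiableAt (by simp))
      (((contDiffOn_pd_two hG hv.contDiffOn i).contDiffAt (hG.mem_nhds hy)).differentiableAt (by simp)) k
  refine ⟨hu.contDiffOn.add hv.contDiffOn, hu.continuousOn.add hv.continuousOn,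
    hu.memLp.add hv.memLp, fun i => ?_, fun i k => ?_⟩
  · refine ((hu.memLp_pd i).add (hv.memLp_pd i)).ae_eq ?_
    filter_upwards [ae_restrict_mem hG.measurableSet] with y hy
    exact (h1 i y hy).symm
  · refine ((hu.memLp_pd_pd i k).add (hv.memLp_pd_pd i k)).ae_eq ?_
    filter_upwards [ae_restrict_mem hG.measurableSet] with y hy
    rw [h2 i k y hy]
    simp only [Pi.add_apply]
    ring

theorem sum (hG : IsOpen G) {ι : Type*} (s : Finset ι) {U : ι → ℂ → ℂ}
    {R : ι → Fin 2 → Fin 2 → ℂ → ℂ} (h : ∀ j ∈ s, IsSingular G (U j) (R j)) :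
    IsSingular G (∑ j ∈ s, U j) (∑ j ∈ s, R j) := by
  classical
  induction s using Finset.induction_on with
  | empty => simpa using zero G
  | insert j s hj ih =>
    rw [Finset.sum_insert hj, Finset.sum_insert hj]
    exact (h j (Finset.mem_insert_self _ _)).add hG
      (ih fun k hk => h k (Finset.mem_insert_of_mem hk))

theorem congr_second (hu : IsSingular G u P)
    (h : ∀ i k, MemLp (fun y => P i k y - Q i k y) 2 (volume.restrict G)) : IsSingular G u Q := by
  refine ⟨hu.contDiffOn, hu.continuousOn, hu.memLp, hu.memLp_pd, fun i k => ?_⟩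
  refine ((hu.memLp_pd_pd i k).add (h i k)).ae_eq (ae_of_all _ fun y => ?_)
  simp

end IsSingular

/-- A corner term with exponent of positive real part: the only second-order singularity is the
one obtained by differentiating the power-logarithmic factor. -/
theorem IsCorner.isSingular_cornerTerm {G : Set ℂ} {c : ℂ} {θ ε : ℝ} (hG : IsCorner G c θ ε)
    {κ : ℂ → ℂ} (hκ : IsCutoff c ε κ) {a : ℂ} (ha : 0 < a.re) {f h : ℝ → ℂ}
    (hf : ContDiff ℝ 2 f) (hh : ContDiff ℝ 2 h) :
    IsSingular G (cornerTerm κ c θ a f h) fun i k y => κ y * cornerFun c θ (a - 2)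
      (stepF θ (a - 1) k (stepF θ a i f)) (stepH θ (a - 1) k (stepF θ a i f) (stepH θ a i f h)) y := by
  have h1f := hf.of_le one_le_two
  have h1h := hh.of_le one_le_two
  have hsf : ∀ i, ContDiff ℝ 1 (stepF θ a i f) := fun i =>
    contDiff_stepF θ a i (n := 1) (by simpa [one_add_one_eq_two] using hf)
  have hsh : ∀ i, ContDiff ℝ 1 (stepH θ a i f h) := fun i =>
    contDiff_stepH θ a i (n := 1) h1f (by simpa [one_add_one_eq_two] using hh)
  have hone : (a - 1).re = a.re - 1 := by simp
  set S := cornerFun c θ a f h with hS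
  set S₁ : Fin 2 → ℂ → ℂ := fun i => cornerFun c θ (a - 1) (stepF θ a i f) (stepH θ a i f h)
  set S₂ : Fin 2 → Fin 2 → ℂ → ℂ := fun i k => cornerFun c θ (a - 2)
    (stepF θ (a - 1) k (stepF θ a i f)) (stepH θ (a - 1) k (stepF θ a i f) (stepH θ a i f h))
  have hTev : ∀ y, y ≠ c → cornerTerm κ c θ a f h =ᶠ[𝓝 y] fun y => κ y * S y := by
    intro y hy
    filter_upwards [isOpen_ne.mem_nhds hy] with z hz
    simp [cornerTerm, hS, show z ≠ c from hz]
  have hzev : ∀ {κ' : ℂ → ℂ} {y : ℂ} (s : ℂ → ℂ), κ' =ᶠ[𝓝 y] 0 → (fun y => κ' y * s y) =ᶠ[𝓝 y] 0 := by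
    intro κ' y s h0
    filter_upwards [h0] with z hz
    simp [hz]
  have hne : ∀ y ∈ G, y ≠ c := fun y hy h => hG.notMem (h ▸ hy)
  have hκd : ∀ y, DifferentiableAt ℝ κ y := fun y => hκ.smooth.differentiable (by simp) y
  have hκid : ∀ i y, DifferentiableAt ℝ (pd i κ) y := fun i y =>
    (pd_smooth i hκ.smooth).differentiable (by simp) y
  have hpd : ∀ i, ∀ y ∈ G, pd i (cornerTerm κ c θ a f h) y = pd i κ y * S y + κ y * S₁ i y := by
    intro i y hy
    rw [pd_congr (hTev y (hne y hy))]
    rcases lt_or_ge ‖y - c‖ (min ε 1) with hr | hr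
    · have hsl := hG.mem_slit hy hr
      rw [pd_mul (hκd y) ((contDiffAt_cornerFun (n := 1) a h1f h1h hsl).differentiableAt (by simp)),
        pd_cornerFun a h1f h1h i hsl]
    · have h0 := hκ.eventuallyEq_zero hr
      rw [pd_congr (hzev S h0), h0.self_of_nhds, pd_congr h0]
      simp [pd]
  -- Apart from the doubly differentiated power factor, every term has exponent `a` or `a - 1`, and
  -- `Re a > 0` makes these square integrable. Away from the disc all terms vanish locally.
  have hpd2 : ∀ i k, ∀ y ∈ G, pd k (pd i (cornerTerm κ c θ a f h)) y - κ y * S₂ i k y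
      = pd k (pd i κ) y * S y + pd i κ y * S₁ k y + pd k κ y * S₁ i y := by
    intro i k y hy
    rw [pd_congr (v := (fun y => pd i κ y * S y) + fun y => κ y * S₁ i y) (by
      filter_upwards [hG.isOpen.mem_nhds hy] with z hz
      exact hpd i z hz)]
    rcases lt_or_ge ‖y - c‖ (min ε 1) with hr | hr
    · have hsl := hG.mem_slit hy hr
      have d0 := (contDiffAt_cornerFun (n := 1) a h1f h1h hsl).differentiableAt (by simp)
      have d1 : DifferentiableAt ℝ (S₁ i) y :=
        (contDiffAt_cornerFun (n := 1) (a - 1) (hsf i) (hsh i) hsl).differentiableAt (by simp)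
      rw [pd_add ((hκid i y).fun_mul d0) ((hκd y).fun_mul d1), pd_mul (hκid i y) d0,
        pd_mul (hκd y) d1, pd_cornerFun a h1f h1h k hsl,
        pd_cornerFun (a - 1) (hsf i) (hsh i) k hsl,
        show a - 1 - 1 = a - 2 by ring]
      simp only [S₁, S₂]
      ring
    · have h0 := hκ.eventuallyEq_zero hr
      have h0i := (hκ.pd i).eventuallyEq_zero hr
      have hsum : (fun y => pd i κ y * S y) + (fun y => κ y * S₁ i y) =ᶠ[𝓝 y] 0 := by
        filter_upwards [hzev S h0i, hzev (S₁ i) h0] with z hz1 hz2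
        simp only [Pi.add_apply, Pi.zero_apply] at *
        rw [hz1, hz2, add_zero]
      rw [pd_congr hsum, h0.self_of_nhds, pd_congr h0i, h0i.self_of_nhds, pd_congr h0 k]
      simp [pd]
  refine ⟨?_, ?_, ?_, fun i => ?_, fun i k => ?_⟩
  · intro y hy
    refine ContDiffAt.contDiffWithinAt (ContDiffAt.congr_of_eventuallyEq ?_ (hTev y (hne y hy)))
    rcases lt_or_ge ‖y - c‖ (min ε 1) with hr | hr
    · exact (hκ.smooth.contDiffAt.of_le (by norm_cast)).mul
        (contDiffAt_cornerFun (n := 2) a hf hh (hG.mem_slit hy hr))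
    · exact (contDiffAt_const (c := (0 : ℂ))).congr_of_eventuallyEq
        (hzev S (hκ.eventuallyEq_zero hr))
  · intro y hy
    refine ContinuousAt.continuousWithinAt ?_ |>.mono (subset_refl _)
    by_cases hyc : y = c
    -- At the corner, half of the positive exponent is spent on the logarithm and the other half
    -- gives convergence to zero.
    · subst hyc
      obtain ⟨C, hC, hb⟩ := hκ.exists_bound
      obtain ⟨M, hM, hbound⟩ := exists_norm_cornerFun_le y θ (a := a) (ν := a.re / 2) (by linarith)
        hf.continuous hh.continuous
      have h0 : cornerTerm κ y θ a f h y = 0 := by simp [cornerTerm]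
      rw [ContinuousAt, h0]
      have hlim : Tendsto (fun z => C * (M * ‖z - y‖ ^ (a.re / 2))) (𝓝 y) (𝓝 0) := by
        have hc : ContinuousAt (fun z : ℂ => C * (M * ‖z - y‖ ^ (a.re / 2))) y := by
          refine continuousAt_const.mul (continuousAt_const.mul (ContinuousAt.rpow_const ?_ ?_))
          · fun_prop
          · right
            linarith
        have := hc.tendsto
        simpa [Real.zero_rpow (by linarith : a.re / 2 ≠ 0)] using this
      refine squeeze_zero_norm' ?_ hlim
      filter_upwards [Metric.ball_mem_nhds y one_pos] with z hz
      by_cases hzy : z = y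
      · subst hzy
        rw [h0, norm_zero]
        positivity
      · have e : cornerTerm κ y θ a f h z = κ z * S z := by simp [cornerTerm, hzy, hS]
        rw [e, norm_mul]
        rw [mem_ball_iff_norm] at hz
        exact mul_le_mul (hb z) (hbound z hzy hz.le) (norm_nonneg _) hC
    · refine ContinuousAt.congr ?_ (hTev y hyc).symm
      rcases lt_or_ge ‖y - c‖ (min ε 1) with hr | hr
      · exact hκ.smooth.continuous.continuousAt.mul (contDiffAt_cornerFun (n := 0) a
          (hf.of_le (by simp)) (hh.of_le (by simp))
          (hG.slit y hy hyc (hr.trans_le (min_le_left _ _)))).continuousAt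
      · exact continuousAt_const.congr (hzev S (hκ.eventuallyEq_zero hr)).symm
  · refine (hG.memLp_mul_cornerFun hκ (a := a) (by linarith) hf.continuous hh.continuous).ae_eq ?_
    filter_upwards [ae_restrict_mem hG.isOpen.measurableSet] with y hy
    exact ((hTev y (hne y hy)).self_of_nhds).symm
  · refine ((hG.memLp_mul_cornerFun (hκ.pd i) (a := a) (by linarith) hf.continuous
      hh.continuous).add (hG.memLp_mul_cornerFun hκ (a := a - 1) (by linarith) (hsf i).continuous
      (hsh i).continuous)).ae_eq ?_
    filter_upwards [ae_restrict_mem hG.isOpen.measurableSet] with y hy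
    exact (hpd i y hy).symm
  · refine (((hG.memLp_mul_cornerFun ((hκ.pd i).pd k) (a := a) (by linarith) hf.continuous
      hh.continuous).add (hG.memLp_mul_cornerFun (hκ.pd i) (a := a - 1) (by linarith)
      (hsf k).continuous (hsh k).continuous)).add (hG.memLp_mul_cornerFun (hκ.pd k) (a := a - 1)
      (by linarith) (hsf i).continuous (hsh i).continuous)).ae_eq ?_
    filter_upwards [ae_restrict_mem hG.isOpen.measurableSet] with y hy
    exact (hpd2 i k y hy).symm
/-! ### Geometry of the domain near the conjugation points -/

namespace Problem

variable {N : ℕ} (D : Problem N)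

/-- The coordinate `Y_j`. -/
def coord (j : Fin N) (y : ℂ) : ℂ := Complex.exp (-(D.θ j * Complex.I)) * (y - D.g j)

theorem add_exp_mul_coord (j : Fin N) (y : ℂ) :
    D.g j + Complex.exp (D.θ j * Complex.I) * D.coord j y = y := by
  rw [coord, ← mul_assoc, ← Complex.exp_add]
  simp

theorem coord_add_exp_mul (j : Fin N) (z : ℂ) :
    D.coord j (D.g j + Complex.exp (D.θ j * Complex.I) * z) = z := by
  rw [coord, add_sub_cancel_left, ← mul_assoc, ← Complex.exp_add]
  simp

theorem norm_coord (j : Fin N) (y : ℂ) : ‖D.coord j y‖ = ‖y - D.g j‖ := by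
  rw [coord, norm_mul, ← neg_mul, ← Complex.ofReal_neg, Complex.norm_exp_ofReal_mul_I, one_mul]

theorem continuous_coord (j : Fin N) : Continuous (D.coord j) := by
  unfold coord
  fun_prop

variable {D}

theorem coord_ne_zero {j : Fin N} {y : ℂ} (hy : y ≠ D.g j) : D.coord j y ≠ 0 := by
  rw [← norm_ne_zero_iff, norm_coord]
  exact norm_ne_zero_iff.2 (sub_ne_zero.2 hy)

theorem mem_G_iff {j : Fin N} {y : ℂ} (hy : ‖y - D.g j‖ < D.ε₁) :
    y ∈ D.G ↔ D.coord j y ∈ sector (D.halfAngle j) := by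
  rw [← D.G_angle j (D.coord j y) (by simpa [norm_coord] using hy), add_exp_mul_coord]

theorem mem_Γ_side_iff {j : Fin N} (σ : Fin 2) {y : ℂ} (hy : ‖y - D.g j‖ < D.ε₁) :
    y ∈ D.Γ (D.side j σ) ↔ D.coord j y ∈ ray (sgn σ * D.halfAngle j) := by
  rw [← D.Γ_side j σ (D.coord j y) (by simpa [norm_coord] using hy), add_exp_mul_coord]

theorem g_notMem_G (j : Fin N) : D.g j ∉ D.G := by
  have := D.g_mem j
  rw [D.isOpen_G.frontier_eq] at this
  exact this.2

/-- `arg` jumps along the negative axis, but `|arg z|` is the unoriented angle between `1` and `z`,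
continuous away from zero. The strict inequality in `G` therefore passes to the closure as a weak
one. -/
theorem abs_arg_coord_le {j : Fin N} {y : ℂ} (hy : y ∈ closure D.G) (hne : y ≠ D.g j)
    (hε : ‖y - D.g j‖ < D.ε₁) : |(D.coord j y).arg| ≤ D.halfAngle j := by
  have hcont : ContinuousAt (fun z => InnerProductGeometry.angle 1 (D.coord j z)) y := by
    have h := InnerProductGeometry.continuousAt_angle (x := ((1 : ℂ), D.coord j y)) one_ne_zero
      (coord_ne_zero hne)
    exact h.comp (f := fun z => ((1 : ℂ), D.coord j z))
      (by have := D.continuous_coord j; fun_prop : Continuous fun z => ((1 : ℂ), D.coord j z)).continuousAt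
  rw [← Complex.angle_one_left (coord_ne_zero hne)]
  by_contra! hlt
  have hn : Continuous fun z : ℂ => ‖z - D.g j‖ := by fun_prop
  have hev : ∀ᶠ z in 𝓝 y, D.halfAngle j < InnerProductGeometry.angle 1 (D.coord j z) ∧
      z ≠ D.g j ∧ ‖z - D.g j‖ < D.ε₁ :=
    (hcont.eventually (lt_mem_nhds hlt)).and ((eventually_ne_nhds hne).and
      (hn.continuousAt.eventually (gt_mem_nhds hε)))
  obtain ⟨z, hz, h1, h2, h3⟩ := ((mem_closure_iff_frequently.1 hy).and_eventually hev).exists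
  rw [Complex.angle_one_left (coord_ne_zero h2)] at h1
  exact h1.not_gt ((mem_G_iff h3).1 hz).2

theorem isCorner (D : Problem N) (j : Fin N) : IsCorner D.G (D.g j) (D.θ j) D.ε₁ := by
  refine ⟨D.isOpen_G, g_notMem_G j, fun y hy hne hε => ?_⟩
  rw [cornerSlit, mem_ofPred_eq, Complex.mem_slitPlane_iff_arg]
  refine ⟨fun h => ?_, coord_ne_zero hne⟩
  have h1 := abs_arg_coord_le hy hne hε
  rw [coord, h, abs_of_pos Real.pi_pos] at h1
  exact h1.not_gt (D.halfAngle_lt j)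

theorem sgn_cases (t : ℝ) {a : ℝ} (h : |t| = a) : ∃ σ, t = sgn σ * a := by
  rcases abs_choice t with h1 | h1
  · exact ⟨1, by simp [sgn]; linarith⟩
  · exact ⟨0, by simp [sgn]; linarith⟩

theorem Γ_subset_frontier (D : Problem N) (i : Fin N) : D.Γ i ⊆ frontier D.G \ range D.g := by
  rw [← D.iUnion_Γ]
  exact subset_iUnion _ i

/-- Near a conjugation point every point of the curves `Γ_i` lies on a side of the angle. -/
theorem exists_side {i j : Fin N} {y : ℂ} (hy : y ∈ D.Γ i) (hε : ‖y - D.g j‖ < D.ε₁) :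
    ∃ σ, D.side j σ = i ∧ D.coord j y ∈ ray (sgn σ * D.halfAngle j) ∧
      (D.coord j y).arg = sgn σ * D.halfAngle j := by
  obtain ⟨hfr, hr⟩ := D.Γ_subset_frontier i hy
  rw [D.isOpen_G.frontier_eq] at hfr
  have hne : y ≠ D.g j := fun h => hr ⟨j, h.symm⟩
  have h1 := abs_arg_coord_le hfr.1 hne hε
  have h2 : ¬ |(D.coord j y).arg| < D.halfAngle j := fun h =>
    hfr.2 ((mem_G_iff hε).2 ⟨coord_ne_zero hne, h⟩)
  -- A boundary point is in the closure but not in `G`, so its angle is exactly `±ω_j`.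
  obtain ⟨σ, hσ⟩ := sgn_cases _ (le_antisymm h1 (not_lt.1 h2))
  have hray : D.coord j y ∈ ray (sgn σ * D.halfAngle j) := by
    refine ⟨‖D.coord j y‖, norm_pos_iff.2 (coord_ne_zero hne), ?_⟩
    rw [← hσ, Complex.norm_mul_exp_arg_mul_I]
  refine ⟨σ, ?_, hray, hσ⟩
  by_contra hij
  exact (D.Γ_disjoint hij).le_bot ⟨(mem_Γ_side_iff σ hε).2 hray, hy⟩

theorem mem_nhdK {r : ℝ} {y : ℂ} : y ∈ D.nhdK r ↔ ∃ j, ‖y - D.g j‖ < r := by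
  simp [nhdK, Metric.mem_thickening_iff, dist_eq_norm]

theorem eq_of_norm_lt {j k : Fin N} {y : ℂ} (hj : ‖y - D.g j‖ < D.ε₁) (hk : ‖y - D.g k‖ < D.ε₁) :
    j = k := by
  by_contra h
  exact (D.balls_disjoint j k h).le_bot
    ⟨mem_closedBall_iff_norm.2 hj.le, mem_closedBall_iff_norm.2 hk.le⟩

theorem hausdorffMeasure_segment_lt_top (p q : ℂ) (r : ℝ) :
    (μH[1] : Measure ℂ) ((fun s : ℝ => p + s * q) '' Ioo 0 r) < ⊤ := by
  have hl : LipschitzWith ‖q‖₊ fun s : ℝ => p + s * q := by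
    refine LipschitzWith.of_dist_le_mul fun s t => ?_
    rw [dist_eq_norm, dist_eq_norm, add_sub_add_left_eq_sub, ← sub_mul, norm_mul,
      ← Complex.ofReal_sub, Complex.norm_real, mul_comm]
    rfl
  refine (hl.hausdorffMeasure_image_le zero_le_one _).trans_lt ?_
  rw [hausdorffMeasure_real]
  exact ENNReal.mul_lt_top (by simp) (by simp)

/-- The part of `Γ_i` near `g_j` on the side `σ`. -/
def sideArc (D : Problem N) (i j : Fin N) (σ : Fin 2) : Set ℂ :=
  {y | y ∈ D.Γ i ∧ ‖y - D.g j‖ < D.ε ∧ D.side j σ = i ∧ D.coord j y ∈ ray (sgn σ * D.halfAngle j)}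

theorem Γ_inter_nhdK_subset (i : Fin N) :
    D.Γ i ∩ D.nhdK D.ε ⊆ ⋃ p : Fin N × Fin 2, D.sideArc i p.1 p.2 := by
  rintro y ⟨hy, hK⟩
  obtain ⟨j, hj⟩ := mem_nhdK.1 hK
  obtain ⟨σ, hσ, hray, -⟩ := exists_side hy (hj.trans_le D.ε_le)
  exact mem_iUnion.2 ⟨(j, σ), hy, hj, hσ, hray⟩

/-- Near the conjugation points the curves are straight segments, finitely many in number. This is
the only part of them where the solution can be nonzero. -/
theorem hausdorffMeasure_Γ_lt_top (D : Problem N) (i : Fin N) :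
    (μH[1] : Measure ℂ) (D.Γ i ∩ D.nhdK D.ε) < ⊤ := by
  refine (measure_mono (Γ_inter_nhdK_subset i)).trans_lt
    ((measure_iUnion_le _).trans_lt ?_)
  rw [tsum_fintype]
  refine ENNReal.sum_lt_top.2 fun p _ => (measure_mono ?_).trans_lt
    (hausdorffMeasure_segment_lt_top (D.g p.1) (Complex.exp (D.θ p.1 * Complex.I) *
      Complex.exp ((sgn p.2 * D.halfAngle p.1 : ℝ) * Complex.I)) D.ε)
  rintro y ⟨-, hε, -, r, hr, hz⟩
  refine ⟨r, ⟨hr, ?_⟩, ?_⟩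
  · rw [← norm_coord, hz, norm_mul, Complex.norm_exp_ofReal_mul_I] at hε
    simpa [abs_of_pos hr] using hε
  · conv_rhs => rw [← D.add_exp_mul_coord p.1 y, hz]
    ring

theorem Ω_eq {j : Fin N} {σ : Fin 2} (s : Fin (D.S (D.side j σ))) {y : ℂ} (hy : ‖y - D.g j‖ < D.ε) :
    D.Ω (D.side j σ) s y = D.g (D.tgt j σ s)
      + Complex.exp (D.θ (D.tgt j σ s) * Complex.I) * (D.rot j σ s * D.coord j y) := by
  rw [← D.Ω_rot j σ s _ (by simpa [norm_coord] using hy), add_exp_mul_coord]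

theorem hausdorffMeasure_Ω_image_lt_top (D : Problem N) (i : Fin N) (s : Fin (D.S i)) :
    (μH[1] : Measure ℂ) (D.Ω i s '' (D.Γ i ∩ D.nhdK D.ε)) < ⊤ := by
  refine (measure_mono (image_mono (Γ_inter_nhdK_subset i))).trans_lt ?_
  rw [image_iUnion]
  refine (measure_iUnion_le _).trans_lt ?_
  rw [tsum_fintype]
  refine ENNReal.sum_lt_top.2 fun p _ => ?_
  by_cases hp : D.side p.1 p.2 = i
  · subst hp
    refine (measure_mono ?_).trans_lt
      (hausdorffMeasure_segment_lt_top (D.g (D.tgt p.1 p.2 s))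
        (Complex.exp (D.θ (D.tgt p.1 p.2 s) * Complex.I) * (D.rot p.1 p.2 s *
        Complex.exp ((sgn p.2 * D.halfAngle p.1 : ℝ) * Complex.I))) D.ε)
    rintro _ ⟨y, ⟨-, hε, -, r, hr, hz⟩, rfl⟩
    refine ⟨r, ⟨hr, ?_⟩, ?_⟩
    · rw [← norm_coord, hz, norm_mul, Complex.norm_exp_ofReal_mul_I] at hε
      simpa [abs_of_pos hr] using hε
    · dsimp only
      rw [Ω_eq s hε, hz]
      ring
  · have : D.sideArc i p.1 p.2 = ∅ := eq_empty_of_forall_notMem fun y hy => hp hy.2.2.1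
    simp [this]

/-- The transformations take the sides of the angle at `g_j` inside the angle at the target. -/
theorem abs_arg_rot_lt (D : Problem N) (j : Fin N) (σ : Fin 2) (s : Fin (D.S (D.side j σ))) :
    |(D.rot j σ s * Complex.exp ((sgn σ * D.halfAngle j : ℝ) * Complex.I)).arg|
      < D.halfAngle (D.tgt j σ s) := by
  -- A sample point of the side at distance `ε/2`: its image lies in `G` and in the disc of radius
  -- `ε₁`, hence inside the target angle, and the argument does not depend on the radius.
  set r := D.ε / 2 with hr
  have hr0 : 0 < r := half_pos D.ε_pos
  set z : ℂ := r * Complex.exp ((sgn σ * D.halfAngle j : ℝ) * Complex.I) with hz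
  have hzn : ‖z‖ = r := by
    rw [hz, norm_mul, Complex.norm_exp_ofReal_mul_I]
    simp [abs_of_pos hr0]
  set y := D.g j + Complex.exp (D.θ j * Complex.I) * z with hy
  have hc : D.coord j y = z := D.coord_add_exp_mul j z
  have hyε : ‖y - D.g j‖ < D.ε := by
    rw [← norm_coord, hc, hzn]
    linarith
  have hyΓ : y ∈ D.Γ (D.side j σ) :=
    (mem_Γ_side_iff σ (hyε.trans_le D.ε_le)).2 (hc ▸ ⟨r, hr0, hz.trans (by push_cast; rfl)⟩)
  have hin : D.Ω (D.side j σ) s y ∈ D.G := D.Ω_inside _ s ⟨y, ⟨hyΓ, mem_nhdK.2 ⟨j, hyε⟩⟩, rfl⟩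
  have hball : ‖D.Ω (D.side j σ) s y - D.g (D.tgt j σ s)‖ < D.ε₁ := by
    have := D.Ω_ball j σ s ⟨y, mem_ball_iff_norm.2 hyε, rfl⟩
    exact mem_ball_iff_norm.1 this
  have := ((mem_G_iff hball).1 hin).2
  rw [Ω_eq s hyε, coord_add_exp_mul, hc, hz, ← mul_assoc, mul_comm (D.rot j σ s), mul_assoc,
    Complex.arg_real_mul _ hr0] at this
  exact this

end Problem
/-! ### Equation and traces for functions smooth inside and continuous up to the boundary -/

theorem isTrace_self {G Γ : Set ℂ} {u : ℂ → ℂ} (hG : IsOpen G) (hu : u ∈ sobolev 1 G)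
    (hc : ContinuousOn u (closure G)) (hm : MemLp u 2 (arcLength Γ)) : IsTrace G Γ u u := by
  refine ⟨hm, fun _ => u, fun _ => ⟨hu, hc⟩, ?_, ?_⟩
  · simp only [sub_self, sobolevNorm_of_eqOn_zero hG (u := 0) (fun _ _ => rfl)]
    exact tendsto_const_nhds
  · simp

theorem memLp_arcLength_of_measure_lt_top {G Γ : Set ℂ} {u : ℂ → ℂ} (hG : Bornology.IsBounded G)
    (hc : ContinuousOn u (closure G)) (hΓ : Γ ⊆ closure G) (hfin : (μH[1] : Measure ℂ) Γ < ⊤) :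
    MemLp u 2 (arcLength Γ) := by
  have : IsFiniteMeasure (arcLength Γ) := ⟨by simpa [arcLength] using hfin⟩
  obtain ⟨C, hC⟩ := hG.isCompact_closure.exists_bound_of_continuousOn hc
  refine MemLp.of_bound ?_ C ?_
  · exact (hc.aestronglyMeasurable isClosed_closure.measurableSet).mono_measure
      (Measure.restrict_mono hΓ le_rfl)
  · refine ae_mono (Measure.restrict_mono hΓ le_rfl : arcLength Γ ≤ _) ?_
    filter_upwards [ae_restrict_mem isClosed_closure.measurableSet] with y hy
    exact hC y hy

/-- A whole boundary curve need not have finite length, so boundedness is used only on the part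
where the function may be nonzero. -/
theorem memLp_arcLength_of_eqOn_zero {G Γ W : Set ℂ} {u : ℂ → ℂ} (hG : Bornology.IsBounded G)
    (hc : ContinuousOn u (closure G)) (hΓ : Γ ⊆ closure G) (hΓm : MeasurableSet Γ) (hW : IsOpen W)
    (hfin : (μH[1] : Measure ℂ) (Γ ∩ W) < ⊤) (h0 : ∀ y ∈ Γ \ W, u y = 0) :
    MemLp u 2 (arcLength Γ) := by
  have h1 : MemLp ((Γ ∩ W).indicator u) 2 (arcLength Γ) := by
    rw [memLp_indicator_iff_restrict (hΓm.inter hW.measurableSet), arcLength,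
      Measure.restrict_restrict (hΓm.inter hW.measurableSet), inter_right_comm, inter_self]
    exact memLp_arcLength_of_measure_lt_top hG hc (inter_subset_left.trans hΓ) hfin
  refine h1.ae_eq ?_
  filter_upwards [ae_restrict_mem hΓm] with y hy
  by_cases hyW : y ∈ W
  · rw [indicator_of_mem (mem_inter hy hyW)]
  · rw [indicator_of_notMem fun h => hyW h.2, h0 y ⟨hy, hyW⟩]

theorem memLp_mul_of_continuous {G : Set ℂ} (hG : IsOpen G) (hGb : Bornology.IsBounded G)
    {q u : ℂ → ℂ} (hq : Continuous q) (hu : MemLp u 2 (volume.restrict G)) :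
    MemLp (fun y => q y * u y) 2 (volume.restrict G) := by
  obtain ⟨C, hC⟩ := hGb.isCompact_closure.exists_bound_of_continuousOn hq.continuousOn
  refine hu.of_le_mul (c := C) (hq.aestronglyMeasurable.mul hu.1) ?_
  filter_upwards [ae_restrict_mem hG.measurableSet] with y hy
  rw [norm_mul]
  exact mul_le_mul_of_nonneg_right (hC y (subset_closure hy)) (norm_nonneg _)

namespace Problem

variable {N : ℕ} (D : Problem N)

/-- The function `P u` for `u` twice differentiable in the classical sense. -/
def applyP (u : ℂ → ℂ) (y : ℂ) : ℂ :=
  (∑ i, ∑ k, D.p₂ i k y * pd k (pd i u) y) + ((∑ k, D.p₁ k y * pd k u y) + D.p₀ y * u y)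

variable {D}

theorem solvesEquation_applyP {u : ℂ → ℂ} (hu : ContDiffOn ℝ 2 u D.G)
    (h1 : ∀ i, MemLp (pd i u) 2 (volume.restrict D.G)) :
    D.SolvesEquation (D.applyP u) u := by
  intro w hw
  have hG := D.isOpen_G
  have hu1 : ContDiffOn ℝ 1 u D.G := hu.of_le one_le_two
  have hpd : ∀ i, ContDiffOn ℝ 1 (pd i u) D.G := contDiffOn_pd_two hG hu
  have hpdc : ∀ i k, ContinuousOn (pd k (pd i u)) D.G := fun i k =>
    (continuousOn_pd (n := 0) hG (by simpa using hpd i) k).continuousOn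
  have hwd : ∀ i, weakDeriv D.G (if i = 0 then (1, 0) else (0, 1)) u
      =ᵐ[volume.restrict D.G] pd i u := fun i =>
    (isWeakDeriv_pd hG i hu1 (h1 i)).ae_eq_weakDeriv hG
  have hall := ae_all_iff.2 hwd
  have htest : ∀ i k, IsTest D.G fun z => D.p₂ i k z * w z := fun i k =>
    hw.smooth_mul (D.p₂_smooth i k)
  have hint : ∀ {v φ : ℂ → ℂ}, ContinuousOn v D.G → IsTest D.G φ →
      IntegrableOn (fun y => v y * φ y) D.G := fun hv hφ =>
    (integrable_mul_of_tsupport_subset hG hv hφ.smooth.continuous hφ.compact hφ.supp).integrableOn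
  -- One integration by parts returns the derivative from `p_ik w` to the classical second
  -- derivatives of `u`.
  have e1 : ∫ y in D.G, ∑ i, ∑ k, weakDeriv D.G (if i = 0 then (1, 0) else (0, 1)) u y
        * pd k (fun z => D.p₂ i k z * w z) y
      = -∫ y in D.G, (∑ i, ∑ k, D.p₂ i k y * pd k (pd i u) y) * w y := by
    rw [integral_congr_ae (g := fun y => ∑ i, ∑ k, pd i u y * pd k (fun z => D.p₂ i k z * w z) y)
      (by filter_upwards [hall] with y hy; simp only [hy])]
    have e2 : (fun y => (∑ i, ∑ k, D.p₂ i k y * pd k (pd i u) y) * w y)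
        = fun y => ∑ i, ∑ k, pd k (pd i u) y * (D.p₂ i k y * w y) := by
      ext y
      rw [Finset.sum_mul]
      refine Finset.sum_congr rfl fun i _ => ?_
      rw [Finset.sum_mul]
      exact Finset.sum_congr rfl fun k _ => by ring
    rw [e2, integral_finsetSum _ fun i _ => integrable_finsetSum _ fun k _ =>
        hint (hpd i).continuousOn ((htest i k).pd k),
      integral_finsetSum _ fun i _ => integrable_finsetSum _ fun k _ => hint (hpdc i k) (htest i k),
      ← Finset.sum_neg_distrib]
    refine Finset.sum_congr rfl fun i _ => ?_
    rw [integral_finsetSum _ fun k _ => hint (hpd i).continuousOn ((htest i k).pd k),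
      integral_finsetSum _ fun k _ => hint (hpdc i k) (htest i k), ← Finset.sum_neg_distrib]
    exact Finset.sum_congr rfl fun k _ => setIntegral_mul_pd hG (hpd i) (htest i k) k
  have e3 : ∫ y in D.G, ((∑ k, D.p₁ k y * weakDeriv D.G (if k = 0 then (1, 0) else (0, 1)) u y)
        + D.p₀ y * u y) * w y
      = ∫ y in D.G, ((∑ k, D.p₁ k y * pd k u y) + D.p₀ y * u y) * w y :=
    integral_congr_ae (by filter_upwards [hall] with y hy; simp only [hy])
  have c1 : ContinuousOn (fun y => ∑ i, ∑ k, D.p₂ i k y * pd k (pd i u) y) D.G :=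
    continuousOn_finsetSum _ fun i _ => continuousOn_finsetSum _ fun k _ =>
      (D.p₂_smooth i k).continuous.continuousOn.mul (hpdc i k)
  have c2 : ContinuousOn (fun y => (∑ k, D.p₁ k y * pd k u y) + D.p₀ y * u y) D.G :=
    (continuousOn_finsetSum _ fun k _ => (D.p₁_smooth k).continuous.continuousOn.mul
      (continuousOn_pd (n := 0) hG (by simpa using hu1) k).continuousOn).add
      (D.p₀_smooth.continuous.continuousOn.mul hu.continuousOn)
  rw [e1, e3, neg_neg, ← integral_add (hint c1 hw) (hint c2 hw)]
  simp only [applyP, add_mul]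

theorem memLp_applyP {u : ℂ → ℂ} {P : Fin 2 → Fin 2 → ℂ → ℂ} (hu : IsSingular D.G u P)
    (hP : MemLp (fun y => ∑ i, ∑ k, D.p₂ i k y * P i k y) 2 (volume.restrict D.G)) :
    MemLp (D.applyP u) 2 (volume.restrict D.G) := by
  have hmul := fun {q v : ℂ → ℂ} (hq : ContDiff ℝ ∞ q) (hv : MemLp v 2 (volume.restrict D.G)) =>
    memLp_mul_of_continuous D.isOpen_G D.isBounded_G hq.continuous hv
  have h1 : MemLp (fun y => ∑ i, ∑ k, D.p₂ i k y * (pd k (pd i u) y - P i k y)) 2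
      (volume.restrict D.G) :=
    memLp_finsetSum _ fun i _ => memLp_finsetSum _ fun k _ =>
      hmul (D.p₂_smooth i k) (hu.memLp_pd_pd i k)
  have h2 : MemLp (fun y => ∑ k, D.p₁ k y * pd k u y) 2 (volume.restrict D.G) :=
    memLp_finsetSum _ fun k _ => hmul (D.p₁_smooth k) (hu.memLp_pd k)
  refine ((h1.add hP).add (h2.add (hmul D.p₀_smooth hu.memLp))).ae_eq (ae_of_all _ fun y => ?_)
  simp only [applyP, Pi.add_apply, mul_sub, Finset.sum_sub_distrib, sub_add_cancel]

end Problem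
/-! ### The singular function -/

/-- A smooth radial cutoff function, equal to `1` for `‖z‖ ≤ δ` and to `0` for `‖z‖ ≥ 2δ`. -/
def cutoff (δ : ℝ) (z : ℂ) : ℂ := (Real.smoothTransition (2 - ‖z‖ ^ 2 / δ ^ 2) : ℝ)

theorem contDiff_cutoff (δ : ℝ) : ContDiff ℝ ∞ (cutoff δ) :=
  Complex.ofRealCLM.contDiff.comp (Real.smoothTransition.contDiff.comp
    (contDiff_const.sub ((contDiff_norm_sq ℝ).div_const _)))

theorem cutoff_eq_one {δ : ℝ} (hδ : 0 < δ) {z : ℂ} (hz : ‖z‖ ≤ δ) : cutoff δ z = 1 := by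
  rw [cutoff, Real.smoothTransition.one_of_one_le, Complex.ofReal_one]
  have : ‖z‖ ^ 2 / δ ^ 2 ≤ 1 := by
    rw [div_le_one (by positivity)]
    gcongr
  linarith

theorem cutoff_eq_zero {δ : ℝ} (hδ : 0 < δ) {z : ℂ} (hz : 2 * δ ≤ ‖z‖) : cutoff δ z = 0 := by
  rw [cutoff, Real.smoothTransition.zero_of_nonpos, Complex.ofReal_zero]
  have : 2 ≤ ‖z‖ ^ 2 / δ ^ 2 := by
    rw [le_div_iff₀ (by positivity)]
    nlinarith
  linarith

theorem cutoff_congr {δ : ℝ} {z w : ℂ} (h : ‖z‖ = ‖w‖) : cutoff δ z = cutoff δ w := by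
  rw [cutoff, cutoff, h]

/-- A smooth function equal to `1` at a given point and to `0` on a given finite set. -/
theorem exists_contDiff_eq_one_eq_zero {Q : Set ℝ} (hQ : Q.Finite) {p : ℝ} (hp : p ∉ Q) :
    ∃ η : ℝ → ℂ, ContDiff ℝ 2 η ∧ η p = 1 ∧ ∀ q ∈ Q, η q = 0 := by
  -- The Lagrange interpolation polynomial.
  refine ⟨fun t => ∏ q ∈ hQ.toFinset, ((t : ℂ) - q) / ((p : ℂ) - q), ?_, ?_, fun q hq => ?_⟩
  · exact contDiff_prod fun q _ => (Complex.ofRealCLM.contDiff.sub contDiff_const).div_const _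
  · refine Finset.prod_eq_one fun q hq => div_self ?_
    rw [← Complex.ofReal_sub]
    exact Complex.ofReal_ne_zero.2 (sub_ne_zero.2 fun h => hp (h ▸ hQ.mem_toFinset.1 hq))
  · exact Finset.prod_eq_zero (hQ.mem_toFinset.2 hq) (by simp)

theorem IsCorner.isSingular_cornerTerm_of_eq_zero {G : Set ℂ} {c : ℂ} {θ ε : ℝ}
    (hG : IsCorner G c θ ε) {κ : ℂ → ℂ} (hκ : IsCutoff c ε κ) (h0 : κ c = 0) {a : ℂ}
    (ha : 0 < a.re) {f h : ℝ → ℂ} (hf : ContDiff ℝ 2 f) (hh : ContDiff ℝ 2 h) :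
    IsSingular G (cornerTerm κ c θ a f h) 0 := by
  have hsf : ∀ i, ContDiff ℝ 1 (stepF θ a i f) := fun i =>
    contDiff_stepF θ a i (n := 1) (by simpa [one_add_one_eq_two] using hf)
  have hsh : ∀ i, ContDiff ℝ 1 (stepH θ a i f h) := fun i =>
    contDiff_stepH θ a i (n := 1) (hf.of_le one_le_two) (by simpa [one_add_one_eq_two] using hh)
  refine (hG.isSingular_cornerTerm hκ ha hf hh).congr_second fun i k => ?_
  simp only [Pi.zero_apply, sub_zero]
  refine hG.memLp_mul_cornerFun_of_eq_zero hκ h0 (by simpa using ha) ?_ ?_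
  · exact (contDiff_stepF θ (a - 1) k (n := 0) (by simpa using hsf i)).continuous
  · exact (contDiff_stepH θ (a - 1) k (n := 0) ((hsf i).of_le (by simp))
      (by simpa using hsh i)).continuous

namespace Problem

variable {N : ℕ} (D : Problem N)

/-- The polar angle of the image of the side `γ_{jσ}`. -/
def imageAngle (j : Fin N) (σ : Fin 2) (s : Fin (D.S (D.side j σ))) : ℝ :=
  (D.rot j σ s * Complex.exp ((sgn σ * D.halfAngle j : ℝ) * Complex.I)).arg

/-- Radii `R`, `δ` so small that the functions below are supported near the conjugation points. -/
structure IsSmall (R δ : ℝ) : Prop where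
  lt_ε : R < D.ε
  lt_one : R < 1
  pos : 0 < δ
  le : 2 * δ ≤ R
  le_mul : ∀ j σ s, 2 * δ ≤ R * ‖D.rot j σ s‖

theorem exists_isSmall {κ : ℝ} (hκ : 0 < κ) : ∃ R δ, R < κ ∧ D.IsSmall R δ := by
  set R := min D.ε (min 1 κ) / 2 with hR
  have hm : 0 < min D.ε (min 1 κ) := lt_min D.ε_pos (lt_min one_pos hκ)
  have hR0 : 0 < R := half_pos hm
  have h1 : R < min D.ε (min 1 κ) := half_lt_self hm
  -- The second bound makes the cutoff composed with each homothety vanish outside the disc of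
  -- radius `R` as well.
  have hev : ∀ᶠ δ in 𝓝[>] (0 : ℝ), 2 * δ ≤ R ∧ ∀ j σ s, 2 * δ ≤ R * ‖D.rot j σ s‖ := by
    have key : ∀ c : ℝ, 0 < c → ∀ᶠ δ in 𝓝[>] (0 : ℝ), 2 * δ ≤ c := by
      intro c hc
      filter_upwards [Ioo_mem_nhdsGT (half_pos hc)] with δ hδ
      linarith [hδ.2]
    refine (key R hR0).and ?_
    simp only [eventually_all]
    exact fun j σ s => key _ (mul_pos hR0 (norm_pos_iff.2 (D.rot_ne j σ s)))
  obtain ⟨δ, ⟨h2, h3⟩, hδ⟩ := (hev.and self_mem_nhdsWithin).exists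
  exact ⟨R, δ, h1.trans_le ((min_le_right _ _).trans (min_le_right _ _)), h1.trans_le (min_le_left _ _),
    h1.trans_le ((min_le_right _ _).trans (min_le_left _ _)), hδ, h2, h3⟩

/-- The image angles are finitely many and lie strictly between the two sides, so they differ from
the end where `η` must be `1` and can join the opposite end in the list of zeros. -/
theorem exists_separator (j : Fin N) (σ : Fin 2) : ∃ η : ℝ → ℂ, ContDiff ℝ 2 η ∧
    (∀ σ', η (sgn σ' * D.halfAngle j) = if σ' = σ then 1 else 0) ∧
    ∀ j' σ' s, D.tgt j' σ' s = j → η (D.imageAngle j' σ' s) = 0 := by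
  set A : Set ℝ := range fun p : (j : Fin N) × (σ : Fin 2) × Fin (D.S (D.side j σ)) =>
    D.imageAngle p.1 p.2.1 p.2.2
  have hpos := D.halfAngle_pos j
  obtain ⟨η, h1, h2, h3⟩ := exists_contDiff_eq_one_eq_zero
    (Q := insert (-(sgn σ * D.halfAngle j)) (A ∩ Ioo (-D.halfAngle j) (D.halfAngle j)))
    (((finite_range _).inter_of_left _).insert _) (p := sgn σ * D.halfAngle j) (by
      fin_cases σ <;> simp [sgn] <;> intro h <;> linarith)
  refine ⟨η, h1, fun σ' => ?_, fun j' σ' s hs => h3 _ (mem_insert_of_mem _ ?_)⟩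
  · split_ifs with h
    · rw [h, h2]
    · rw [← h3 _ (mem_insert _ _)]
      congr 1
      fin_cases σ <;> fin_cases σ' <;> simp [sgn] at h ⊢
  · refine ⟨⟨⟨j', σ', s⟩, rfl⟩, abs_lt.1 ?_⟩
    rw [← hs]
    exact D.abs_arg_rot_lt j' σ' s

/-- The cutoff function of the terms correcting the boundary conditions. -/
def corrCutoff (δ : ℝ) (j : Fin N) (σ : Fin 2) (s : Fin (D.S (D.side j σ))) (y : ℂ) : ℂ :=
  D.b _ s (D.g j) * cutoff δ (y - D.g j) - D.b _ s y * cutoff δ (‖D.rot j σ s‖ * (y - D.g j))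

/-- The logarithmic part of the nonlocal term. -/
def transF (μ : ℂ) (f : Fin N → ℝ → ℂ) (j : Fin N) (σ : Fin 2) (s : Fin (D.S (D.side j σ))) : ℂ :=
  (‖D.rot j σ s‖ : ℂ) ^ μ * f (D.tgt j σ s) (D.imageAngle j σ s)

/-- The part of the nonlocal term without logarithm. -/
def transH (μ : ℂ) (f h : Fin N → ℝ → ℂ) (j : Fin N) (σ : Fin 2)
    (s : Fin (D.S (D.side j σ))) : ℂ :=
  (‖D.rot j σ s‖ : ℂ) ^ μ * (Real.log ‖D.rot j σ s‖ * f (D.tgt j σ s) (D.imageAngle j σ s)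
    + h (D.tgt j σ s) (D.imageAngle j σ s))

/-- The power-logarithmic function at the conjugation point `g_j` with the terms correcting the
boundary conditions. -/
def localTerm (δ : ℝ) (η : Fin N → Fin 2 → ℝ → ℂ) (μ : ℂ) (f h : Fin N → ℝ → ℂ) (j : Fin N) :
    ℂ → ℂ :=
  cornerTerm (fun y => cutoff δ (y - D.g j)) (D.g j) (D.θ j) μ (f j) (h j)
    + ∑ σ, ∑ s, cornerTerm (D.corrCutoff δ j σ s) (D.g j) (D.θ j) μ
        (fun t => D.transF μ f j σ s * η j σ t) (fun t => D.transH μ f h j σ s * η j σ t)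

/-- The singular function. -/
def singularFun (δ : ℝ) (η : Fin N → Fin 2 → ℝ → ℂ) (μ : ℂ) (f h : Fin N → ℝ → ℂ) : ℂ → ℂ :=
  ∑ j, D.localTerm δ η μ f h j

/-- The leading part of the second derivatives of the singular function at `g_j`. -/
def leadingPart (δ : ℝ) (μ : ℂ) (f h : Fin N → ℝ → ℂ) (j : Fin N) (i k : Fin 2) (y : ℂ) : ℂ :=
  cutoff δ (y - D.g j) * cornerFun (D.g j) (D.θ j) (μ - 2)
    (stepF (D.θ j) (μ - 1) k (stepF (D.θ j) μ i (f j)))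
    (stepH (D.θ j) (μ - 1) k (stepF (D.θ j) μ i (f j)) (stepH (D.θ j) μ i (f j) (h j))) y

variable {D} {R δ : ℝ} {η : Fin N → Fin 2 → ℝ → ℂ} {μ : ℂ} {f h : Fin N → ℝ → ℂ}

theorem IsSmall.cutoff_eq_zero (hs : D.IsSmall R δ) {j : Fin N} {y : ℂ} (hy : R ≤ ‖y - D.g j‖) :
    cutoff δ (y - D.g j) = 0 :=
  NonlocalElliptic.cutoff_eq_zero hs.pos (hs.le.trans hy)

theorem IsSmall.corrCutoff_eq_zero (hs : D.IsSmall R δ) {j : Fin N} {y : ℂ}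
    (hy : R ≤ ‖y - D.g j‖) (σ : Fin 2) (s : Fin (D.S (D.side j σ))) :
    D.corrCutoff δ j σ s y = 0 := by
  rw [corrCutoff, hs.cutoff_eq_zero hy, NonlocalElliptic.cutoff_eq_zero hs.pos]
  · simp
  · rw [norm_mul, Complex.norm_real, norm_norm, mul_comm ‖D.rot j σ s‖]
    exact (hs.le_mul j σ s).trans (mul_le_mul_of_nonneg_right hy (norm_nonneg _))

theorem IsSmall.lt_min (hs : D.IsSmall R δ) : R < min D.ε₁ 1 :=
  _root_.lt_min (hs.lt_ε.trans_le D.ε_le) hs.lt_one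

theorem IsSmall.isCutoff (hs : D.IsSmall R δ) (j : Fin N) :
    IsCutoff (D.g j) D.ε₁ fun y => cutoff δ (y - D.g j) :=
  ⟨(contDiff_cutoff δ).comp (contDiff_id.sub contDiff_const), R, hs.lt_min,
    fun _ hy => hs.cutoff_eq_zero hy⟩

theorem IsSmall.isCutoff_corrCutoff (hs : D.IsSmall R δ) (j : Fin N) (σ : Fin 2)
    (s : Fin (D.S (D.side j σ))) : IsCutoff (D.g j) D.ε₁ (D.corrCutoff δ j σ s) := by
  refine ⟨?_, R, hs.lt_min, fun y hy => hs.corrCutoff_eq_zero hy σ s⟩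
  exact (contDiff_const.mul ((contDiff_cutoff δ).comp (contDiff_id.sub contDiff_const))).sub
    ((D.b_smooth _ s).mul
      ((contDiff_cutoff δ).comp (contDiff_const.mul (contDiff_id.sub contDiff_const))))

theorem localTerm_eq_zero (hs : D.IsSmall R δ) {j : Fin N} {y : ℂ} (hy : R ≤ ‖y - D.g j‖) :
    D.localTerm δ η μ f h j y = 0 := by
  simp [localTerm, Finset.sum_apply, cornerTerm, hs.cutoff_eq_zero hy, hs.corrCutoff_eq_zero hy]

theorem singularFun_eq_localTerm (hs : D.IsSmall R δ) {j : Fin N} {y : ℂ}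
    (hy : ‖y - D.g j‖ < D.ε₁) :
    D.singularFun δ η μ f h y = D.localTerm δ η μ f h j y := by
  rw [singularFun, Finset.sum_apply]
  refine Finset.sum_eq_single_of_mem j (Finset.mem_univ _) fun k _ hk => localTerm_eq_zero hs ?_
  by_contra! hlt
  exact hk (eq_of_norm_lt (hlt.trans (hs.lt_ε.trans_le D.ε_le)) hy)

theorem singularFun_eq_zero (hs : D.IsSmall R δ) {y : ℂ} (hy : y ∉ D.nhdK R) :
    D.singularFun δ η μ f h y = 0 := by
  rw [singularFun, Finset.sum_apply]
  refine Finset.sum_eq_zero fun k _ => localTerm_eq_zero hs ?_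
  by_contra! hlt
  exact hy (mem_nhdK.2 ⟨k, hlt⟩)

theorem isSingular_localTerm (hs : D.IsSmall R δ) (hμ : 0 < μ.re)
    (hη : ∀ j σ, ContDiff ℝ 2 (η j σ)) (hf : ∀ j, ContDiff ℝ 2 (f j))
    (hh : ∀ j, ContDiff ℝ 2 (h j)) (j : Fin N) :
    IsSingular D.G (D.localTerm δ η μ f h j) (D.leadingPart δ μ f h j) := by
  have h1 := (D.isCorner j).isSingular_cornerTerm (hs.isCutoff j) hμ (hf j) (hh j)
  have h2 : ∀ σ s, IsSingular D.G (cornerTerm (D.corrCutoff δ j σ s) (D.g j) (D.θ j) μ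
      (fun t => D.transF μ f j σ s * η j σ t) (fun t => D.transH μ f h j σ s * η j σ t)) 0 := by
    intro σ s
    refine (D.isCorner j).isSingular_cornerTerm_of_eq_zero (hs.isCutoff_corrCutoff j σ s) ?_ hμ
      (contDiff_const.mul (hη j σ)) (contDiff_const.mul (hη j σ))
    simp [corrCutoff]
  have h3 := h1.add D.isOpen_G (IsSingular.sum D.isOpen_G Finset.univ
    fun σ _ => IsSingular.sum D.isOpen_G Finset.univ fun s _ => h2 σ s)
  simp only [Finset.sum_const_zero, add_zero] at h3
  exact h3

theorem isSingular_singularFun (hs : D.IsSmall R δ) (hμ : 0 < μ.re)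
    (hη : ∀ j σ, ContDiff ℝ 2 (η j σ)) (hf : ∀ j, ContDiff ℝ 2 (f j))
    (hh : ∀ j, ContDiff ℝ 2 (h j)) :
    IsSingular D.G (D.singularFun δ η μ f h) (∑ j, D.leadingPart δ μ f h j) :=
  IsSingular.sum D.isOpen_G _ fun j _ => isSingular_localTerm hs hμ hη hf hh j

theorem cornerFun_eq (j : Fin N) (a : ℂ) (p q : ℝ → ℂ) (y : ℂ) :
    cornerFun (D.g j) (D.θ j) a p q y = Complex.exp (a * Real.log ‖y - D.g j‖)
      * (Real.log ‖y - D.g j‖ * p (D.coord j y).arg + q (D.coord j y).arg) := by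
  rw [cornerFun, powLog, norm_cornerLog_re, cornerLog, Complex.log_im, ← coord]

theorem localTerm_eq {j : Fin N} {y : ℂ} (hy : y ≠ D.g j) :
    D.localTerm δ η μ f h j y = Complex.exp (μ * Real.log ‖y - D.g j‖)
      * (cutoff δ (y - D.g j) * (Real.log ‖y - D.g j‖ * f j (D.coord j y).arg
          + h j (D.coord j y).arg)
        + ∑ σ, ∑ s, D.corrCutoff δ j σ s y * ((Real.log ‖y - D.g j‖ * D.transF μ f j σ s
          + D.transH μ f h j σ s) * η j σ (D.coord j y).arg)) := by
  simp only [localTerm, Pi.add_apply, Finset.sum_apply, cornerTerm, if_neg hy, cornerFun_eq, mul_add,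
    Finset.mul_sum]
  congr 1
  · ring
  · refine Finset.sum_congr rfl fun σ _ => Finset.sum_congr rfl fun s _ => ?_
    ring

/-- The values of the singular function on the image of a side. -/
theorem singularFun_Ω (hs : D.IsSmall R δ)
    (hη : ∀ j σ s σ', η (D.tgt j σ s) σ' (D.imageAngle j σ s) = 0) {j : Fin N} {σ : Fin 2}
    (s : Fin (D.S (D.side j σ))) {y : ℂ} (hyg : y ≠ D.g j) (hy : ‖y - D.g j‖ < D.ε)
    (hray : D.coord j y ∈ ray (sgn σ * D.halfAngle j)) :
    D.singularFun δ η μ f h (D.Ω _ s y) = Complex.exp (μ * Real.log ‖y - D.g j‖)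
      * (cutoff δ (‖D.rot j σ s‖ * (y - D.g j))
        * (Real.log ‖y - D.g j‖ * D.transF μ f j σ s + D.transH μ f h j σ s)) := by
  set w := D.Ω _ s y with hw
  set k := D.tgt j σ s with hk
  have hball : ‖w - D.g k‖ < D.ε₁ := mem_ball_iff_norm.1 (D.Ω_ball j σ s ⟨y, mem_ball_iff_norm.2 hy, rfl⟩)
  have hc : D.coord k w = D.rot j σ s * D.coord j y := by
    rw [hw, Ω_eq s hy, coord_add_exp_mul]
  have hn : ‖w - D.g k‖ = ‖D.rot j σ s‖ * ‖y - D.g j‖ := by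
    rw [← norm_coord, hc, norm_mul, norm_coord]
  have hy0 : 0 < ‖y - D.g j‖ := norm_pos_iff.2 (sub_ne_zero.2 hyg)
  have hr0 : 0 < ‖D.rot j σ s‖ := norm_pos_iff.2 (D.rot_ne j σ s)
  have hwg : w ≠ D.g k := by
    intro h0
    rw [h0, sub_self, norm_zero] at hn
    exact (mul_pos hr0 hy0).ne hn
  have harg : (D.coord k w).arg = D.imageAngle j σ s := by
    obtain ⟨r, hr, hz⟩ := hray
    rw [hc, hz, mul_left_comm, Complex.arg_real_mul _ hr, imageAngle]
  have hcut : cutoff δ (w - D.g k) = cutoff δ (‖D.rot j σ s‖ * (y - D.g j)) :=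
    cutoff_congr (by simp [hn])
  -- The homothety contributes `χ^μ` through the power and, below, `log χ` through the logarithm;
  -- these are the factors in `transF` and `transH`.
  have hpow : Complex.exp (μ * Real.log ‖w - D.g k‖)
      = (‖D.rot j σ s‖ : ℂ) ^ μ * Complex.exp (μ * Real.log ‖y - D.g j‖) := by
    rw [hn, Real.log_mul hr0.ne' hy0.ne', Complex.ofReal_add, mul_add, Complex.exp_add,
      Complex.cpow_def_of_ne_zero (by exact_mod_cast hr0.ne'), ← Complex.ofReal_log hr0.le,
      mul_comm μ (Real.log ‖D.rot j σ s‖ : ℂ)]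
  rw [singularFun_eq_localTerm hs hball, localTerm_eq hwg, harg, hcut, hpow, hn,
    Real.log_mul hr0.ne' hy0.ne', transF, transH]
  -- The corrections at the target vanish on image rays, so only the main term is carried over.
  simp only [hη, hk, mul_zero, Finset.sum_const_zero, add_zero]
  push_cast
  ring

/-- The homogeneous boundary conditions hold near the conjugation points. -/
theorem singularFun_boundary (hs : D.IsSmall R δ)
    (hη₁ : ∀ j σ σ', η j σ (sgn σ' * D.halfAngle j) = if σ' = σ then 1 else 0)
    (hη : ∀ j σ s σ', η (D.tgt j σ s) σ' (D.imageAngle j σ s) = 0)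
    (hbF : ∀ j σ, f j (sgn σ * D.halfAngle j) + ∑ s, D.b _ s (D.g j) * D.transF μ f j σ s = 0)
    (hbH : ∀ j σ, h j (sgn σ * D.halfAngle j) + ∑ s, D.b _ s (D.g j) * D.transH μ f h j σ s = 0)
    {i : Fin N} {y : ℂ} (hy : y ∈ D.Γ i) (hK : y ∈ D.nhdK D.ε) :
    D.singularFun δ η μ f h y + ∑ s, D.b i s y * D.singularFun δ η μ f h (D.Ω i s y) = 0 := by
  obtain ⟨j, hj⟩ := mem_nhdK.1 hK
  have hj₁ := hj.trans_le D.ε_le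
  obtain ⟨σ, rfl, hray, harg⟩ := exists_side hy hj₁
  have hne : y ≠ D.g j := fun h0 => (D.Γ_subset_frontier _ hy).2 ⟨j, h0.symm⟩
  rw [singularFun_eq_localTerm hs hj₁, localTerm_eq hne, harg]
  simp only [hη₁, singularFun_Ω hs hη _ hne hj hray, corrCutoff]
  rw [Finset.sum_eq_single_of_mem σ (Finset.mem_univ _)]
  · simp only [if_true, mul_one]
    rw [mul_add, add_assoc, Finset.mul_sum, ← Finset.sum_add_distrib]
    -- The part of the correction containing `b(y)` cancels the true nonlocal term and leaves `ξ(y)`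
    -- times the frozen conditions, one for the coefficient of `log r` and one for the remainder.
    have e := congrArg₂ (fun a b => (Real.log ‖y - D.g j‖ : ℂ) * a + b) (hbF j σ) (hbH j σ)
    simp only [mul_zero, add_zero] at e
    have e' := congrArg (fun a => Complex.exp (μ * Real.log ‖y - D.g j‖)
      * cutoff δ (y - D.g j) * a) e
    simp only [mul_zero, mul_add, Finset.mul_sum] at e'
    rw [← e', add_add_add_comm, ← Finset.sum_add_distrib]
    congr 1
    · ring
    · exact Finset.sum_congr rfl fun s _ => by ring
  · intro σ' _ hσ'
    simp [Ne.symm hσ']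

end Problem
/-! ### The generalized solution -/

/-- Transfer of square integrability to the model angle. -/
theorem memLp_comp_add_exp_mul {c : ℂ} {θ : ℝ} {F : ℂ → ℂ} {A : Set ℂ} (hA : MeasurableSet A)
    (hF : MemLp F 2 (volume.restrict A)) :
    MemLp (fun z => F (c + Complex.exp (θ * Complex.I) * z)) 2
      (volume.restrict ((fun z => c + Complex.exp (θ * Complex.I) * z) ⁻¹' A)) := by
  have he0 : Complex.exp (θ * Complex.I) ∈ Submonoid.unitSphere ℂ := by
    simp [Submonoid.unitSphere, Complex.norm_exp_ofReal_mul_I]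
  have h1 : MeasurePreserving (rotation (⟨_, he0⟩ : Circle)) :=
    (rotation (⟨_, he0⟩ : Circle)).measurePreserving
  have h2 : MeasurePreserving (fun z : ℂ => c + z) := measurePreserving_add_left volume c
  have h3 : MeasurePreserving (fun z : ℂ => c + Complex.exp (θ * Complex.I) * z) := h2.comp h1
  exact hF.comp_measurePreserving (h3.restrict_preimage hA)

namespace Problem

variable {N : ℕ} {D : Problem N} {R δ : ℝ} {η : Fin N → Fin 2 → ℝ → ℂ} {μ : ℂ}
  {f h : Fin N → ℝ → ℂ}

theorem continuous_stepF_stepF {θ : ℝ} {a : ℂ} {p : ℝ → ℂ} (hp : ContDiff ℝ 2 p) (i k : Fin 2) :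
    Continuous (stepF θ (a - 1) k (stepF θ a i p)) := by
  have hsf : ContDiff ℝ 1 (stepF θ a i p) :=
    contDiff_stepF θ a i (n := 1) (by simpa [one_add_one_eq_two] using hp)
  exact (contDiff_stepF θ (a - 1) k (n := 0) (by simpa using hsf)).continuous

theorem continuous_stepH_stepH {θ : ℝ} {a : ℂ} {p q : ℝ → ℂ} (hp : ContDiff ℝ 2 p)
    (hq : ContDiff ℝ 2 q) (i k : Fin 2) :
    Continuous (stepH θ (a - 1) k (stepF θ a i p) (stepH θ a i p q)) := by
  have hsf : ContDiff ℝ 1 (stepF θ a i p) :=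
    contDiff_stepF θ a i (n := 1) (by simpa [one_add_one_eq_two] using hp)
  have hsh : ContDiff ℝ 1 (stepH θ a i p q) :=
    contDiff_stepH θ a i (n := 1) (hp.of_le one_le_two) (by simpa [one_add_one_eq_two] using hq)
  exact (contDiff_stepH θ (a - 1) k (n := 0) (hsf.of_le (by simp)) (by simpa using hsh)).continuous

/-- The leading part is annihilated by the frozen operator, up to square integrable terms. -/
theorem memLp_sum_mul_leadingPart (hs : D.IsSmall R δ) (hμ : 0 < μ.re)
    (hf : ∀ j, ContDiff ℝ 2 (f j)) (hh : ∀ j, ContDiff ℝ 2 (h j))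
    (hF : ∀ j, ∀ t ∈ Ioo (-D.halfAngle j) (D.halfAngle j),
      ∑ i, ∑ k, D.p₂ i k (D.g j) * stepF (D.θ j) (μ - 1) k (stepF (D.θ j) μ i (f j)) t = 0)
    (hH : ∀ j, ∀ t ∈ Ioo (-D.halfAngle j) (D.halfAngle j),
      ∑ i, ∑ k, D.p₂ i k (D.g j) * stepH (D.θ j) (μ - 1) k (stepF (D.θ j) μ i (f j))
        (stepH (D.θ j) μ i (f j) (h j)) t = 0) (j : Fin N) :
    MemLp (fun y => ∑ i, ∑ k, D.p₂ i k y * D.leadingPart δ μ f h j i k y) 2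
      (volume.restrict D.G) := by
  -- Only coefficient differences are estimated, since the frozen sum vanishes by `hF` and `hH`. The
  -- exponent `μ - 2` has real part above `-2`, just what a factor zero at `g_j` allows.
  have h1 : MemLp (fun y => ∑ i, ∑ k, (D.p₂ i k y - D.p₂ i k (D.g j)) * cutoff δ (y - D.g j)
      * cornerFun (D.g j) (D.θ j) (μ - 2) (stepF (D.θ j) (μ - 1) k (stepF (D.θ j) μ i (f j)))
        (stepH (D.θ j) (μ - 1) k (stepF (D.θ j) μ i (f j)) (stepH (D.θ j) μ i (f j) (h j))) y) 2
      (volume.restrict D.G) := by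
    refine memLp_finsetSum _ fun i _ => memLp_finsetSum _ fun k _ => ?_
    refine (D.isCorner j).memLp_mul_cornerFun_of_eq_zero
      ((hs.isCutoff j).smooth_mul ((D.p₂_smooth i k).sub contDiff_const)) ?_ ?_
      (continuous_stepF_stepF (hf j) i k) (continuous_stepH_stepH (hf j) (hh j) i k)
    · simp
    · simpa using hμ
  refine h1.ae_eq ?_
  filter_upwards [ae_restrict_mem D.isOpen_G.measurableSet] with y hy
  rcases lt_or_ge ‖y - D.g j‖ R with hr | hr
  · have hyj : ‖y - D.g j‖ < D.ε₁ := hr.trans (hs.lt_ε.trans_le D.ε_le)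
    have ht := abs_lt.1 ((mem_G_iff hyj).1 hy).2
    have e := congrArg₂ (fun a b => cutoff δ (y - D.g j) * (Complex.exp ((μ - 2) *
      Real.log ‖y - D.g j‖) * ((Real.log ‖y - D.g j‖ : ℂ) * a + b))) (hF j _ ht) (hH j _ ht)
    simp only [mul_zero, add_zero, Finset.mul_sum, ← Finset.sum_add_distrib] at e
    rw [← sub_eq_zero, ← Finset.sum_sub_distrib, ← neg_eq_zero, ← e, ← Finset.sum_neg_distrib]
    refine Finset.sum_congr rfl fun i _ => ?_
    rw [← Finset.sum_sub_distrib, ← Finset.sum_neg_distrib]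
    refine Finset.sum_congr rfl fun k _ => ?_
    rw [leadingPart, cornerFun_eq]
    ring
  · simp [leadingPart, hs.cutoff_eq_zero hr]

/-- If the singular function has square integrable second derivatives, then the leading parts of
these derivatives vanish. -/
theorem eq_zero_of_singularFun_mem_sobolev (hs : D.IsSmall R δ) (hμ : 0 < μ.re) (hμ1 : μ.re ≤ 1)
    (hη : ∀ j σ, ContDiff ℝ 2 (η j σ)) (hf : ∀ j, ContDiff ℝ 2 (f j))
    (hh : ∀ j, ContDiff ℝ 2 (h j)) (hu : D.singularFun δ η μ f h ∈ sobolev 2 D.G)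
    (j : Fin N) (i k : Fin 2) {t : ℝ} (ht : t ∈ Ioo (-D.halfAngle j) (D.halfAngle j)) :
    stepF (D.θ j) (μ - 1) k (stepF (D.θ j) μ i (f j)) t = 0 ∧
      stepH (D.θ j) (μ - 1) k (stepF (D.θ j) μ i (f j)) (stepH (D.θ j) μ i (f j) (h j)) t = 0 := by
  have hsing := isSingular_singularFun hs hμ hη hf hh
  have hP : MemLp ((∑ j, D.leadingPart δ μ f h j) i k) 2 (volume.restrict D.G) := by
    refine ((memLp_pd_pd_of_mem_sobolev D.isOpen_G hsing.contDiffOn hu i k).sub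
      (hsing.memLp_pd_pd i k)).ae_eq (ae_of_all _ fun y => ?_)
    simp
  set A := D.G ∩ Metric.ball (D.g j) δ with hA
  have hAm : MeasurableSet A := D.isOpen_G.measurableSet.inter measurableSet_ball
  have hδR : δ < R := by linarith [hs.pos, hs.le]
  have hδε : δ < D.ε₁ := hδR.trans (hs.lt_ε.trans_le D.ε_le)
  -- In the disc of radius `δ` the cutoff is `1` and the terms of the other corners vanish, so the
  -- square integrable leading part is the pure power-logarithmic function.
  have hC : MemLp (cornerFun (D.g j) (D.θ j) (μ - 2)
      (stepF (D.θ j) (μ - 1) k (stepF (D.θ j) μ i (f j)))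
      (stepH (D.θ j) (μ - 1) k (stepF (D.θ j) μ i (f j)) (stepH (D.θ j) μ i (f j) (h j)))) 2
      (volume.restrict A) := by
    refine (hP.mono_measure (Measure.restrict_mono inter_subset_left le_rfl :
      volume.restrict A ≤ _)).ae_eq ?_
    filter_upwards [ae_restrict_mem hAm] with y hy
    have hyj : ‖y - D.g j‖ < δ := mem_ball_iff_norm.1 hy.2
    simp only [Finset.sum_apply]
    rw [Finset.sum_eq_single_of_mem j (Finset.mem_univ _), leadingPart,
      cutoff_eq_one hs.pos hyj.le, one_mul]
    intro l _ hl
    rw [leadingPart, hs.cutoff_eq_zero, zero_mul]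
    by_contra! hlt
    exact hl (eq_of_norm_lt (hlt.trans (hs.lt_ε.trans_le D.ε_le)) (hyj.trans hδε))
  have hT := memLp_comp_add_exp_mul (c := D.g j) (θ := D.θ j) hAm hC
  have hpre : (fun z => D.g j + Complex.exp (D.θ j * Complex.I) * z) ⁻¹' A
      = sector (D.halfAngle j) ∩ Metric.ball 0 δ := by
    ext z
    have hn : ‖D.g j + Complex.exp (D.θ j * Complex.I) * z - D.g j‖ = ‖z‖ := by
      rw [← norm_coord, coord_add_exp_mul]
    simp only [hA, mem_preimage, mem_inter_iff, mem_ball_iff_norm, hn, sub_zero]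
    refine and_congr_left fun hz => D.G_angle j z ?_
    simpa using hz.trans hδε
  rw [hpre] at hT
  refine eq_zero_of_memLp_powLog (a := μ - 2) (by simp; linarith) (continuous_stepF_stepF (hf j) i k)
    (continuous_stepH_stepH (hf j) (hh j) i k) (D.halfAngle_lt j).le hs.pos ?_ t ht
  refine hT.ae_eq (ae_of_all _ fun z => ?_)
  have := D.coord_add_exp_mul j z
  rw [coord] at this
  simp only [cornerFun, cornerLog, this]

theorem Γ_subset_closure (D : Problem N) (i : Fin N) : D.Γ i ⊆ closure D.G :=
  fun _ hy => frontier_subset_closure (D.Γ_subset_frontier i hy).1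

theorem measurableSet_Γ (D : Problem N) (i : Fin N) : MeasurableSet (D.Γ i) := by
  obtain ⟨V, hV, h⟩ := D.Γ_relOpen i
  rw [h]
  exact hV.measurableSet.inter isClosed_frontier.measurableSet

/-- The first estimate gives zero trace norm, and values on the curve are determined by it almost
everywhere. -/
theorem op_ae_eq_zero {B : D.FarOperators} (u : sobolev 2 (D.G \ closure (D.nhdK B.κ₁)))
    (hu : ∀ y ∈ D.G \ closure (D.nhdK B.κ₁), (u : ℂ → ℂ) y = 0) (i : Fin N) :
    ∀ᵐ y ∂(arcLength (D.Γ i)), B.op i u y = 0 := by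
  refine ae_eq_zero_of_traceNorm_eq_zero D.isOpen_G D.isBounded_G (D.Γ_relOpen i) (D.Γ_smooth i) ?_
  have h := B.bound₁ i u
  rw [sobolevNorm_of_eqOn_zero (D.isOpen_G.sdiff isClosed_closure) hu, mul_zero] at h
  exact nonpos_iff_eq_zero.1 h

/-- A power-logarithmic solution of the model problem gives a generalized solution. -/
theorem exists_isGeneralizedSolution (B : D.FarOperators) (hμ : 0 < μ.re) (hμ1 : μ.re ≤ 1)
    (hf : ∀ j, ContDiff ℝ 2 (f j)) (hh : ∀ j, ContDiff ℝ 2 (h j))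
    (hF : ∀ j, ∀ t ∈ Ioo (-D.halfAngle j) (D.halfAngle j),
      ∑ i, ∑ k, D.p₂ i k (D.g j) * stepF (D.θ j) (μ - 1) k (stepF (D.θ j) μ i (f j)) t = 0)
    (hH : ∀ j, ∀ t ∈ Ioo (-D.halfAngle j) (D.halfAngle j),
      ∑ i, ∑ k, D.p₂ i k (D.g j) * stepH (D.θ j) (μ - 1) k (stepF (D.θ j) μ i (f j))
        (stepH (D.θ j) μ i (f j) (h j)) t = 0)
    (hbF : ∀ j σ, f j (sgn σ * D.halfAngle j) + ∑ s, D.b _ s (D.g j) * D.transF μ f j σ s = 0)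
    (hbH : ∀ j σ, h j (sgn σ * D.halfAngle j)
      + ∑ s, D.b _ s (D.g j) * D.transH μ f h j σ s = 0) :
    ∃ f₀ : ℂ → ℂ, MemLp f₀ 2 (volume.restrict D.G) ∧
      ∃ u : ℂ → ℂ, D.IsGeneralizedSolution B f₀ (fun _ _ => 0) u ∧ u ∈ sobolev 1 D.G ∧
        (u ∈ sobolev 2 D.G → ∀ j i k, ∀ t ∈ Ioo (-D.halfAngle j) (D.halfAngle j),
          stepF (D.θ j) (μ - 1) k (stepF (D.θ j) μ i (f j)) t = 0 ∧
          stepH (D.θ j) (μ - 1) k (stepF (D.θ j) μ i (f j))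
            (stepH (D.θ j) μ i (f j) (h j)) t = 0) := by
  -- Choosing `R < κ₁` makes `u` vanish on the whole domain of the far operators.
  obtain ⟨R, δ, hRκ, hs⟩ := D.exists_isSmall (B.κ₂_pos.trans B.κ₂_lt)
  choose η hη hη₁ hη₀ using D.exists_separator
  set u := D.singularFun δ η μ f h with hu
  have hsing : IsSingular D.G u _ := isSingular_singularFun hs hμ hη hf hh
  have hu1 : u ∈ sobolev 1 D.G :=
    mem_sobolev_one D.isOpen_G (hsing.contDiffOn.of_le one_le_two) hsing.memLp hsing.memLp_pd
  have hzero : ∀ {r : ℝ}, R ≤ r → ∀ y ∉ D.nhdK r, u y = 0 := fun hr y hy =>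
    singularFun_eq_zero hs fun h => hy (Metric.thickening_mono hr _ h)
  have hfar : ∀ y ∈ D.G \ closure (D.nhdK B.κ₁), u y = 0 := fun y hy =>
    hzero hRκ.le y fun h => hy.2 (subset_closure h)
  have hu2 : u ∈ sobolev 2 (D.G \ closure (D.nhdK B.κ₁)) :=
    mem_sobolev_of_eqOn_zero (D.isOpen_G.sdiff isClosed_closure).measurableSet hfar 2
  refine ⟨D.applyP u, ?_, u, ⟨hu1, solvesEquation_applyP hsing.contDiffOn hsing.memLp_pd,
    hu2, fun i => ⟨u, fun _ => u, ?_, fun s => ?_, ?_⟩⟩, hu1, fun h2 j i k t ht =>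
      eq_zero_of_singularFun_mem_sobolev hs hμ hμ1 hη hf hh h2 j i k ht⟩
  · refine memLp_applyP hsing ?_
    refine (memLp_finsetSum Finset.univ fun j _ =>
      memLp_sum_mul_leadingPart hs hμ hf hh hF hH j).ae_eq (ae_of_all _ fun y => ?_)
    simp only [Finset.sum_apply, Finset.mul_sum]
    rw [Finset.sum_comm]
    exact Finset.sum_congr rfl fun i _ => Finset.sum_comm
  · exact isTrace_self D.isOpen_G hu1 hsing.continuousOn
      (memLp_arcLength_of_eqOn_zero D.isBounded_G hsing.continuousOn (D.Γ_subset_closure i)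
        (D.measurableSet_Γ i) Metric.isOpen_thickening (D.hausdorffMeasure_Γ_lt_top i)
        fun y hy => hzero hs.lt_ε.le y hy.2)
  · exact isTrace_self D.isOpen_G hu1 hsing.continuousOn
      (memLp_arcLength_of_measure_lt_top D.isBounded_G hsing.continuousOn
        ((D.Ω_inside i s).trans subset_closure) (D.hausdorffMeasure_Ω_image_lt_top i s))
  · filter_upwards [ae_restrict_mem (D.measurableSet_Γ i), op_ae_eq_zero ⟨u, hu2⟩ hfar i]
      with y hy hop
    rw [hop, add_zero]
    by_cases hK : y ∈ D.nhdK D.ε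
    · rw [indicator_of_mem hK]
      exact singularFun_boundary hs (fun j σ σ' => hη₁ j σ σ')
        (fun j σ s σ' => hη₀ _ σ' j σ s rfl) hbF hbH hy hK
    · rw [indicator_of_notMem hK, hzero hs.lt_ε.le y hK, add_zero]

end Problem
/-! ### Solutions of the model problem with a parameter -/

/-- The derivative of `symbolOp` with respect to `μ`. -/
def symbolOpDeriv (a : Fin 2 → Fin 2 → ℂ) (θ : ℝ) (μ : ℂ) (t : ℝ) (x₀ x₁ : ℂ) : ℂ :=
  form a (dirE θ t) (dirE θ t) * ((2 * μ - 1) * x₀)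
    + (form a (dirE θ t) (dirN θ t) + form a (dirN θ t) (dirE θ t)) * x₁
    + form a (dirN θ t) (dirN θ t) * x₀

theorem hasDerivAt_symbolOp (a : Fin 2 → Fin 2 → ℂ) (θ t : ℝ) (x₀ x₁ x₂ lam : ℂ) :
    HasDerivAt (fun z => symbolOp a θ (Complex.I * z) t x₀ x₁ x₂)
      (Complex.I * symbolOpDeriv a θ (Complex.I * lam) t x₀ x₁) lam := by
  have h1 : HasDerivAt (fun z : ℂ => Complex.I * z) Complex.I lam := by
    simpa using (hasDerivAt_id lam).const_mul Complex.I
  have h2 := h1.sub_const 1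
  have h := ((((h1.mul h2).mul_const x₀).const_mul (form a (dirE θ t) (dirE θ t))).add
    ((h2.mul_const x₁).const_mul
      (form a (dirE θ t) (dirN θ t) + form a (dirN θ t) (dirE θ t)))).add
    (((h1.mul_const x₀).const_add x₂).const_mul (form a (dirN θ t) (dirN θ t)))
  refine h.congr_deriv ?_
  simp only [symbolOpDeriv]
  ring

theorem sum_mul_stepF_stepF (a : Fin 2 → Fin 2 → ℂ) (θ : ℝ) (μ : ℂ) {f : ℝ → ℂ}
    (hf : ContDiff ℝ 2 f) (t : ℝ) :
    ∑ i, ∑ k, a i k * stepF θ (μ - 1) k (stepF θ μ i f) t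
      = symbolOp a θ μ t (f t) (deriv f t) (deriv (deriv f) t) := by
  simp only [stepF_stepF θ μ _ _ hf, Fin.sum_univ_two, symbolOp, form]
  ring

/-- The logarithm contributes the `μ`-derivative of the symbol. Equating this to zero is the
equation of an associated vector, up to the factor `i` from `μ = iλ`. -/
theorem sum_mul_stepH_stepH (a : Fin 2 → Fin 2 → ℂ) (θ : ℝ) (μ : ℂ) {f h : ℝ → ℂ}
    (hf : ContDiff ℝ 2 f) (hh : ContDiff ℝ 2 h) (t : ℝ) :
    ∑ i, ∑ k, a i k * stepH θ (μ - 1) k (stepF θ μ i f) (stepH θ μ i f h) t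
      = symbolOp a θ μ t (h t) (deriv h t) (deriv (deriv h) t)
        + symbolOpDeriv a θ μ t (f t) (deriv f t) := by
  simp only [stepH_stepH θ μ _ _ hf hh, Fin.sum_univ_two, symbolOp, symbolOpDeriv, form]
  ring

/-- The tensors `e ⊗ e`, `e ⊗ n + n ⊗ e`, `n ⊗ n` are linearly independent. -/
theorem eq_zero_of_dir {θ t : ℝ} {x y z : ℂ}
    (h : ∀ i k, dirE θ t k * dirE θ t i * x + (dirE θ t k * dirN θ t i + dirN θ t k * dirE θ t i) * y
      + dirN θ t k * dirN θ t i * z = 0) : x = 0 ∧ y = 0 ∧ z = 0 := by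
  have h00 := h 0 0
  have h01 := h 0 1
  have h11 := h 1 1
  simp only [dirE, dirN, Matrix.cons_val_zero, Matrix.cons_val_one] at h00 h01 h11
  have hcs : (Real.cos (t + θ) : ℂ) ^ 2 + (Real.sin (t + θ) : ℂ) ^ 2 = 1 := by
    exact_mod_cast Real.cos_sq_add_sin_sq (t + θ)
  set c : ℂ := (Real.cos (t + θ) : ℂ)
  set s : ℂ := (Real.sin (t + θ) : ℂ)
  refine ⟨?_, ?_, ?_⟩
  -- The matrix of the tensor is contracted with `e` and `n`; normalization leaves `(c² + s²)² - 1 =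
  -- (c² + s² - 1)(c² + s² + 1)`.
  · linear_combination c ^ 2 * h00 + 2 * c * s * h01 + s ^ 2 * h11
      - x * (c ^ 2 + s ^ 2 + 1) * hcs
  · linear_combination (-c * s) * h00 + (c ^ 2 - s ^ 2) * h01 + c * s * h11
      - y * (c ^ 2 + s ^ 2 + 1) * hcs
  · linear_combination s ^ 2 * h00 - 2 * c * s * h01 + c ^ 2 * h11
      - z * (c ^ 2 + s ^ 2 + 1) * hcs

/-- Solutions of `h'' + h = 0` on an interval. -/
theorem eq_cos_add_sin {a : ℝ} (ha : 0 < a) {h : ℝ → ℂ} (hh : ContDiff ℝ 2 h)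
    (h0 : ∀ t ∈ Ioo (-a) a, deriv (deriv h) t + h t = 0) :
    ∀ t ∈ Ioo (-a) a, h t = h 0 * Real.cos t + deriv h 0 * Real.sin t := by
  have h1 : ∀ t, HasDerivAt h (deriv h t) t := fun t =>
    (hh.differentiable two_ne_zero t).hasDerivAt
  have h2 : ∀ t, HasDerivAt (deriv h) (deriv (deriv h) t) t := fun t =>
    ((contDiff_succ_iff_deriv (n := 1)).1 (by simpa [one_add_one_eq_two] using hh)).2.2.differentiable
      one_ne_zero t |>.hasDerivAt
  have hc : ∀ t : ℝ, HasDerivAt (fun t : ℝ => (Real.cos t : ℂ)) ((-Real.sin t : ℝ) : ℂ) t :=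
    fun t => (Real.hasDerivAt_cos t).ofReal_comp
  have hs : ∀ t : ℝ, HasDerivAt (fun t : ℝ => (Real.sin t : ℂ)) ((Real.cos t : ℝ) : ℂ) t :=
    fun t => (Real.hasDerivAt_sin t).ofReal_comp
  have hconst : ∀ {F : ℝ → ℂ}, (∀ t ∈ Ioo (-a) a, HasDerivAt F 0 t) →
      ∀ t ∈ Ioo (-a) a, F t = F 0 := fun hF t ht =>
    isOpen_Ioo.is_const_of_deriv_eq_zero isPreconnected_Ioo
      (fun x hx => (hF x hx).differentiableAt.differentiableWithinAt) (fun x hx => (hF x hx).deriv)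
      ht ⟨by linarith, ha⟩
  intro t ht
  -- Rotating the pair `(h, h')` by the angle `t` gives two first integrals, from which `h` is
  -- recovered.
  have hA := hconst (F := fun t => h t * (Real.cos t : ℂ) - deriv h t * (Real.sin t : ℂ))
    (fun x hx => (((h1 x).mul (hc x)).sub ((h2 x).mul (hs x))).congr_deriv (by
      push_cast
      linear_combination (-Complex.sin x) * h0 x hx)) t ht
  have hB := hconst (F := fun t => h t * (Real.sin t : ℂ) + deriv h t * (Real.cos t : ℂ))
    (fun x hx => (((h1 x).mul (hs x)).add ((h2 x).mul (hc x))).congr_deriv (by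
      push_cast
      linear_combination Complex.cos x * h0 x hx)) t ht
  have hcs : (Real.cos t : ℂ) ^ 2 + (Real.sin t : ℂ) ^ 2 = 1 := by
    exact_mod_cast (Real.cos_sq_add_sin_sq t)
  simp only [Real.cos_zero, Real.sin_zero, Complex.ofReal_one, Complex.ofReal_zero, mul_one,
    mul_zero, sub_zero, zero_add] at hA hB
  linear_combination (Real.cos t : ℂ) * hA + (Real.sin t : ℂ) * hB - h t * hcs

namespace Problem

variable {N : ℕ} {D : Problem N}

theorem sgn_mul_mem_Icc (D : Problem N) (j : Fin N) (σ : Fin 2) :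
    sgn σ * D.halfAngle j ∈ Icc (-D.halfAngle j) (D.halfAngle j) := by
  have := D.halfAngle_pos j
  fin_cases σ <;> simp [sgn] <;> linarith

theorem imageAngle_mem_Icc (D : Problem N) (j : Fin N) (σ : Fin 2) (s : Fin (D.S (D.side j σ))) :
    D.imageAngle j σ s ∈ Icc (-D.halfAngle (D.tgt j σ s)) (D.halfAngle (D.tgt j σ s)) :=
  Ioo_subset_Icc_self (abs_lt.1 (D.abs_arg_rot_lt j σ s))

theorem angularBC_eq (lam : ℂ) (Φ : D.Angular) {f : Fin N → ℝ → ℂ}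
    (hf : ∀ j, ∀ t ∈ Icc (-D.halfAngle j) (D.halfAngle j), f j t = (Φ j).toFun t)
    (j : Fin N) (σ : Fin 2) :
    D.angularBC lam Φ j σ = f j (sgn σ * D.halfAngle j)
      + ∑ s, D.b _ s (D.g j) * D.transF (Complex.I * lam) f j σ s := by
  rw [angularBC, hf j _ (D.sgn_mul_mem_Icc j σ)]
  congr 1
  refine Finset.sum_congr rfl fun s _ => ?_
  rw [transF, hf _ _ (D.imageAngle_mem_Icc j σ s), imageAngle]
  ring

/-- Differentiating `χ^(iλ)` yields `i log χ`, the same term that `log (χ r) = log χ + log r`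
produces in `transH`. -/
theorem deriv_angularBC (lam : ℂ) (Φ : D.Angular) {f : Fin N → ℝ → ℂ}
    (hf : ∀ j, ∀ t ∈ Icc (-D.halfAngle j) (D.halfAngle j), f j t = (Φ j).toFun t)
    (j : Fin N) (σ : Fin 2) :
    deriv (fun z => D.angularBC z Φ j σ) lam
      = ∑ s, D.b _ s (D.g j) * (Complex.I * Real.log ‖D.rot j σ s‖
        * D.transF (Complex.I * lam) f j σ s) := by
  simp only [angularBC_eq _ Φ hf, transF]
  have h1 : HasDerivAt (fun z : ℂ => Complex.I * z) Complex.I lam := by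
    simpa using (hasDerivAt_id lam).const_mul Complex.I
  refine HasDerivAt.deriv ?_
  refine HasDerivAt.const_add _ (HasDerivAt.fun_sum fun s _ => HasDerivAt.const_mul _ ?_)
  have hr : (‖D.rot j σ s‖ : ℂ) ≠ 0 := by
    exact_mod_cast norm_ne_zero_iff.2 (D.rot_ne j σ s)
  refine ((h1.const_cpow (Or.inl hr)).mul_const _).congr_deriv ?_
  rw [Complex.ofReal_log (norm_nonneg _)]
  ring

/-- The components of a solution of `L̃(λ)φ + ψ = 0` are twice continuously differentiable. -/
theorem exists_contDiff_of_angularOp (lam : ℂ) (Φ : D.Angular) {Q : Fin N → ℝ → ℂ}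
    (hQ : ∀ j, Continuous (Q j))
    (h : ∀ j, ∀ᵐ t ∂(volume.restrict (Ioo (-D.halfAngle j) (D.halfAngle j))),
      D.angularOp lam Φ j t + Q j t = 0) :
    ∃ f : Fin N → ℝ → ℂ, ∀ j, ContDiff ℝ 2 (f j) ∧
      (∀ t ∈ Icc (-D.halfAngle j) (D.halfAngle j), f j t = (Φ j).toFun t) ∧
      (∀ t ∈ Icc (-D.halfAngle j) (D.halfAngle j), deriv (f j) t = (Φ j).d1 t) ∧
      ∀ t ∈ Icc (-D.halfAngle j) (D.halfAngle j), symbolOp (fun i k => D.p₂ i k (D.g j)) (D.θ j)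
        (Complex.I * lam) t (f j t) (deriv (f j) t) (deriv (deriv (f j)) t) + Q j t = 0 := by
  have key := fun j => IntervalW2.exists_contDiff_of_symbolOp
    (D.elliptic _ (frontier_subset_closure (D.g_mem j))) (D.θ j) (Complex.I * lam)
    (D.halfAngle_pos j) (Φ j) (hQ j).continuousOn (h j)
  choose f hf using key
  exact ⟨f, hf⟩

theorem continuous_symbolOpDeriv (a : Fin 2 → Fin 2 → ℂ) (θ : ℝ) (μ : ℂ) {f : ℝ → ℂ}
    (hf : ContDiff ℝ 2 f) : Continuous fun t => symbolOpDeriv a θ μ t (f t) (deriv f t) := by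
  have hE : ∀ i, Continuous fun t => dirE θ t i := fun i => (contDiff_dirE θ i).continuous
  have hN : ∀ i, Continuous fun t => dirN θ t i := fun i => (contDiff_dirN θ i).continuous
  have e1 := continuous_form_dir a hE hE
  have e2 := continuous_form_dir a hE hN
  have e3 := continuous_form_dir a hN hE
  have e4 := continuous_form_dir a hN hN
  have h0 := hf.continuous
  have h1 : Continuous (deriv f) := hf.continuous_deriv one_le_two
  unfold symbolOpDeriv
  fun_prop

theorem re_I_mul (lam : ℂ) : (Complex.I * lam).re = -lam.im := by simp

/-- An eigenvector with an associated vector yields a solution outside `W²`. -/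
theorem exists_solution_of_isAssociated (B : D.FarOperators) {lam : ℂ} (h1 : -1 ≤ lam.im)
    (h2 : lam.im < 0) {Φ Φ₁ : D.Angular} (hΦ : D.IsEigenvector lam Φ)
    (hΦ₁ : D.IsAssociated lam Φ Φ₁) :
    ∃ f₀ : ℂ → ℂ, MemLp f₀ 2 (volume.restrict D.G) ∧
      ∃ u : ℂ → ℂ, D.IsGeneralizedSolution B f₀ (fun _ _ => 0) u ∧
        u ∈ sobolev 1 D.G ∧ u ∉ sobolev 2 D.G := by
  obtain ⟨⟨j₀, t₀, ht₀, hne⟩, hop, hbc⟩ := hΦ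
  set μ := Complex.I * lam with hμ
  have hμ0 : 0 < μ.re := by rw [hμ, re_I_mul]; linarith
  have hμ1 : μ.re ≤ 1 := by rw [hμ, re_I_mul]; linarith
  obtain ⟨f, hf⟩ := exists_contDiff_of_angularOp lam Φ (Q := fun _ _ => 0)
    (fun _ => continuous_const) (by simpa using hop)
  obtain ⟨h, hh⟩ := exists_contDiff_of_angularOp lam Φ₁
    (Q := fun j t => Complex.I * symbolOpDeriv (fun i k => D.p₂ i k (D.g j)) (D.θ j) μ t
      (f j t) (deriv (f j) t))
    (fun j => continuous_const.mul (continuous_symbolOpDeriv _ _ _ (hf j).1)) (fun j => by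
      filter_upwards [hΦ₁.1 j, ae_restrict_mem measurableSet_Ioo] with t ht htm
      have hd : deriv (fun z => D.angularOp z Φ j t) lam = _ :=
        (hasDerivAt_symbolOp (fun i k => D.p₂ i k (D.g j)) (D.θ j) t ((Φ j).toFun t) ((Φ j).d1 t)
          ((Φ j).d2 t) lam).deriv
      rw [hd] at ht
      rwa [(hf j).2.1 t (Ioo_subset_Icc_self htm), (hf j).2.2.1 t (Ioo_subset_Icc_self htm)])
  have hcd : ∀ j, ContDiff ℝ 2 fun t => Complex.I * f j t := fun j => contDiff_const.mul (hf j).1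
  have hd1 : ∀ j, (deriv fun t => Complex.I * f j t) = fun t => Complex.I * deriv (f j) t :=
    fun j => funext fun t => deriv_const_mul_field _
  have hd2 : ∀ j, (deriv fun t => Complex.I * deriv (f j) t)
      = fun t => Complex.I * deriv (deriv (f j)) t :=
    fun j => funext fun t => deriv_const_mul_field _
  -- The logarithm is paired with `iφ` rather than `φ`, because the definition of an associated
  -- vector differentiates in `λ`, not in `μ = iλ`.
  refine Exists.elim (exists_isGeneralizedSolution (μ := μ)
    (f := fun j t => Complex.I * f j t) (h := h) B hμ0 hμ1 hcd (fun j => (hh j).1) ?_ ?_ ?_ ?_)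
    fun f₀ ⟨hf₀, u, hu, hu1, hu2⟩ => ?_
  · intro j t ht
    rw [sum_mul_stepF_stepF (fun i k => D.p₂ i k (D.g j)) (D.θ j) μ (hcd j) t, hd1, hd2]
    have := (hf j).2.2.2 t (Ioo_subset_Icc_self ht)
    simp only [symbolOp] at this ⊢
    linear_combination Complex.I * this
  · intro j t ht
    rw [sum_mul_stepH_stepH (fun i k => D.p₂ i k (D.g j)) (D.θ j) μ (hcd j) (hh j).1 t, hd1]
    have := (hh j).2.2.2 t (Ioo_subset_Icc_self ht)
    simp only [symbolOpDeriv] at this ⊢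
    linear_combination this
  · intro j σ
    have := hbc j σ
    rw [angularBC_eq lam Φ (fun j => (hf j).2.1)] at this
    rw [← mul_zero Complex.I, ← this, mul_add, Finset.mul_sum]
    congr 1
    refine Finset.sum_congr rfl fun s _ => ?_
    simp only [transF]
    ring
  · intro j σ
    have := hΦ₁.2 j σ
    rw [angularBC_eq lam Φ₁ (fun j => (hh j).2.1), deriv_angularBC lam Φ (fun j => (hf j).2.1),
      add_assoc, ← Finset.sum_add_distrib] at this
    rw [← this]
    congr 1
    refine Finset.sum_congr rfl fun s _ => ?_
    simp only [transF, transH]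
    ring
  · refine ⟨f₀, hf₀, u, hu, hu1, fun hW => ?_⟩
    have key := hu2 hW j₀
    have hF := eq_zero_of_dir fun i k => (stepF_stepF (D.θ j₀) μ i k (hcd j₀) t₀).symm.trans
      (key i k t₀ ht₀).1
    have hH := eq_zero_of_dir fun i k =>
      (stepH_stepH (D.θ j₀) μ i k (hcd j₀) (hh j₀).1 t₀).symm.trans (key i k t₀ ht₀).2
    have hfne : Complex.I * f j₀ t₀ ≠ 0 := by
      rw [(hf j₀).2.1 t₀ (Ioo_subset_Icc_self ht₀)]
      exact mul_ne_zero Complex.I_ne_zero hne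
    -- The `e ⊗ e` coefficient of the logarithmic part forces `μ = 1`. That of the remainder, `μ(μ -
    -- 1)h + (2μ - 1)f`, then reduces to `f`, which is nonzero at `t₀`.
    have hm : μ * (μ - 1) = 0 := (mul_eq_zero.1 hF.1).resolve_right hfne
    have hμne : μ ≠ 0 := by
      intro h0
      simp [h0] at hμ0
    have hμe : μ = 1 := sub_eq_zero.1 ((mul_eq_zero.1 hm).resolve_left hμne)
    have hX := hH.1
    rw [hμe] at hX
    exact hfne (by linear_combination hX)

/-- An eigenvector with a component that is not polynomial yields a solution outside `W²`. -/
theorem exists_solution_of_not_isPolynomialVector (B : D.FarOperators) {lam : ℂ} (h1 : -1 ≤ lam.im)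
    (h2 : lam.im < 0) {Φ : D.Angular} (hΦ : D.IsEigenvector lam Φ)
    (hpoly : ¬ D.IsPolynomialVector lam Φ) :
    ∃ f₀ : ℂ → ℂ, MemLp f₀ 2 (volume.restrict D.G) ∧
      ∃ u : ℂ → ℂ, D.IsGeneralizedSolution B f₀ (fun _ _ => 0) u ∧
        u ∈ sobolev 1 D.G ∧ u ∉ sobolev 2 D.G := by
  obtain ⟨-, hop, hbc⟩ := hΦ
  set μ := Complex.I * lam with hμ
  have hμ0 : 0 < μ.re := by rw [hμ, re_I_mul]; linarith
  have hμ1 : μ.re ≤ 1 := by rw [hμ, re_I_mul]; linarith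
  obtain ⟨h, hh⟩ := exists_contDiff_of_angularOp lam Φ (Q := fun _ _ => 0)
    (fun _ => continuous_const) (by simpa using hop)
  have hcd : ContDiff ℝ 2 fun _ : ℝ => (0 : ℂ) := contDiff_const
  refine Exists.elim (exists_isGeneralizedSolution (μ := μ)
    (f := fun _ _ => 0) (h := h) B hμ0 hμ1 (fun _ => hcd) (fun j => (hh j).1) ?_ ?_ ?_ ?_)
    fun f₀ ⟨hf₀, u, hu, hu1, hu2⟩ => ?_
  · intro j t ht
    rw [sum_mul_stepF_stepF (fun i k => D.p₂ i k (D.g j)) (D.θ j) μ hcd t]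
    simp [symbolOp]
  · intro j t ht
    rw [sum_mul_stepH_stepH (fun i k => D.p₂ i k (D.g j)) (D.θ j) μ hcd (hh j).1 t]
    have := (hh j).2.2.2 t (Ioo_subset_Icc_self ht)
    simpa [symbolOpDeriv] using this
  · simp [transF]
  · intro j σ
    have := hbc j σ
    rw [angularBC_eq lam Φ (fun j => (hh j).2.1)] at this
    simpa [transF, transH] using this
  · refine ⟨f₀, hf₀, u, hu, hu1, fun hW => hpoly fun j => ?_⟩
    have key : ∀ t ∈ Ioo (-D.halfAngle j) (D.halfAngle j),
        μ * (μ - 1) * h j t = 0 ∧ deriv (deriv (h j)) t + μ * h j t = 0 := by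
      intro t ht
      have hH := eq_zero_of_dir fun i k =>
        (stepH_stepH (D.θ j) μ i k hcd (hh j).1 t).symm.trans (hu2 hW j i k t ht).2
      simp only [mul_zero, add_zero] at hH
      exact ⟨hH.1, hH.2.2⟩
    have hμne : μ ≠ 0 := by
      intro h0
      simp [h0] at hμ0
    -- For `μ = 1` the `n ⊗ n` coefficient makes `r h` linear in `y₁, y₂`; for other `μ` the `e ⊗ e`
    -- coefficient makes `h` zero. Either way the component is polynomial.
    by_cases hμe : μ = 1
    · have hsol := eq_cos_add_sin (D.halfAngle_pos j) (hh j).1 fun t ht => by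
        simpa [hμe] using (key t ht).2
      refine ⟨MvPolynomial.C (h j 0) * MvPolynomial.X 0
        + MvPolynomial.C (deriv (h j) 0) * MvPolynomial.X 1, fun r _ t ht => ?_⟩
      rw [← (hh j).2.1 t (Ioo_subset_Icc_self ht), hsol t ht, ← hμ, hμe]
      simp
      ring
    · refine ⟨0, fun r _ t ht => ?_⟩
      have h0 : h j t = 0 :=
        (mul_eq_zero.1 (key t ht).1).resolve_left (mul_ne_zero hμne (sub_ne_zero.2 hμe))
      rw [← (hh j).2.1 t (Ioo_subset_Icc_self ht), h0]
      simp

end Problem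
end NonlocalElliptic

end

/-! ### The theorem: the two ways of being improper -/

theorem mainTheorem5 {N : ℕ} (D : NonlocalElliptic.Problem N)
    (himproper : ∃ lam : ℂ, -1 ≤ lam.im ∧ lam.im < 0 ∧ D.IsImproperEigenvalue lam)
    (B : D.FarOperators) :
    ∃ f₀ : ℂ → ℂ, MeasureTheory.MemLp f₀ 2 (MeasureTheory.volume.restrict D.G) ∧
      ∃ u : ℂ → ℂ, D.IsGeneralizedSolution B f₀ (fun _ _ => 0) u ∧
        u ∈ NonlocalElliptic.sobolev 1 D.G ∧ u ∉ NonlocalElliptic.sobolev 2 D.G := by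
  obtain ⟨lam, h1, h2, hev, hnot⟩ := himproper
  have : ∃ Φ, D.IsEigenvector lam Φ ∧
      ¬((¬ ∃ Φ₁, D.IsAssociated lam Φ Φ₁) ∧ D.IsPolynomialVector lam Φ) := by
    by_contra! hall
    exact hnot ⟨hev, fun Φ hΦ => by simpa using hall Φ hΦ⟩
  obtain ⟨Φ, hΦ, hor⟩ := this
  by_cases hass : ∃ Φ₁, D.IsAssociated lam Φ Φ₁
  · obtain ⟨Φ₁, hΦ₁⟩ := hass
    exact NonlocalElliptic.Problem.exists_solution_of_isAssociated B h1 h2 hΦ hΦ₁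
  · exact NonlocalElliptic.Problem.exists_solution_of_not_isPolynomialVector B h1 h2 hΦ
      fun hp => hor ⟨hass, hp⟩
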